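/- Let $\zeta$ be the Riemann zeta-function, $c$ Euler's constant, and $J(T)=\int_0^T|\zeta(\tfrac12+it)|^2\,dt$. Let $\mu\in C^\infty([y_0,\infty))$, $y_0\ge 1$, be increasing with $\mu(y)\ge 7y\ln y$ for all $y\ge y_0$. The Jacob's ladder generated by $\mu$ is the function $\varphi_1(T)=\tfrac12\varphi(T)$, where $y=\varphi(T)\in[y_0,\infty)$ is the unique solution of $$\int_0^{\mu(y)}\left|\zeta\left(\tfrac12+it\right)\right|^2e^{-2t/y}\,dt=\int_0^T\left|\zeta\left(\tfrac12+it\right)\right|^2dt ;$$ it is a strictly increasing bijection from a half-line $[T_0,\infty)$, with $T_0\ge0$, onto $[y_0/2,\infty)$. For all sufficiently large $T$ write $\overset{0}{T}=T$ and $\overset{r}{T}=\varphi_1^{-1}(\overset{r-1}{T})$, $r=1,2,\dots$, for its reverse iterations. For real $0<a<b$ put $$(a,b]^+=\left\{t\in(a,b]:\ \ln t>\left|\zeta\left(\tfrac12+it\right)\right|^2\right\},\qquad (a,b]^-=\left\{t\in(a,b]:\ \ln t\le\left|\zeta\left(\tfrac12+it\right)\right|^2\right\}.$$ Then, for every fixed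 $k\in\mathbb N$ and every $r=1,\dots,k$, $$\begin{aligned}\lim_{T\to\infty}\Bigg[&\int_{(\overset{r-1}{T},\overset{r}{T}]^+}\left\{\ln t-\left|\zeta\left(\tfrac12+it\right)\right|^2\right\}dt-\int_{(\overset{r-1}{T},\overset{r}{T}]^-}\left\{-\ln t+\left|\zeta\left(\tfrac12+it\right)\right|^2\right\}dt\\&+\int_{\overset{r-1}{T}}^{\overset{r}{T}}\left|\zeta\left(\tfrac12+it\right)\right|^2dt-\int_{\overset{r}{T}}^{\overset{r+1}{T}}\left|\zeta\left(\tfrac12+it\right)\right|^2dt-(\ln 2\pi-1-c)\left(\overset{r}{T}-\overset{r-1}{T}\right)\Bigg]=0 .\end{aligned}$$ -/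

import Mathlib

open Filter Set MeasureTheory
open scoped Topology ContDiff

noncomputable section

namespace JacobLadder

/-- `|ζ(1/2 + it)|²`. -/
def zetaSq (t : ℝ) : ℝ := ‖riemannZeta (1 / 2 + (t : ℂ) * Complex.I)‖ ^ 2

/-- The Hardy-Littlewood integral `J(T) = ∫₀ᵀ |ζ(1/2 + it)|² dt`. -/
def hardyLittlewood (T : ℝ) : ℝ := ∫ t in (0 : ℝ)..T, zetaSq t

/-- The admissible functions `μ` on `[y₀, ∞)`: smooth, increasing, with `μ(y) ≥ 7 y ln y`.
The normalisation `y₀ ≥ 1` makes `μ ≥ 0`. -/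
structure Admissible (μ : ℝ → ℝ) (y₀ : ℝ) : Prop where
  one_le : 1 ≤ y₀
  contDiffOn : ContDiffOn ℝ ∞ μ (Ici y₀)
  monotoneOn : MonotoneOn μ (Ici y₀)
  lower_bound : ∀ y ∈ Ici y₀, 7 * y * Real.log y ≤ μ y

/-- `Φ_μ(y) = ∫₀^{μ(y)} |ζ(1/2 + it)|² e^{-2t/y} dt`; for admissible `μ` it is continuous and
strictly increasing on `[y₀, ∞)`. -/
def truncatedLaplace (μ : ℝ → ℝ) (y : ℝ) : ℝ :=
  ∫ t in (0 : ℝ)..μ y, zetaSq t * Real.exp (-(2 * t / y))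

/-- The solution `y = φ_μ(T) ∈ [y₀, ∞)` of the nonlinear integral equation
`∫₀^{μ(y)} |ζ(1/2 + it)|² e^{-2t/y} dt = ∫₀ᵀ |ζ(1/2 + it)|² dt`. -/
def integralEquationSolution (μ : ℝ → ℝ) (y₀ T : ℝ) : ℝ :=
  Function.invFunOn (truncatedLaplace μ) (Ici y₀) (hardyLittlewood T)

/-- Jacob's ladder `φ₁(T) = φ_μ(T) / 2`. -/
def ladder (μ : ℝ → ℝ) (y₀ T : ℝ) : ℝ := integralEquationSolution μ y₀ T / 2

/-- The half-line `[T₀, ∞)`, `T₀ ≥ 0`, `J(T₀) = Φ_μ(y₀)`, on which the ladder is defined; the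
ladder maps it bijectively onto `[y₀ / 2, ∞)`. -/
def ladderDomain (μ : ℝ → ℝ) (y₀ : ℝ) : Set ℝ :=
  {T | 0 ≤ T ∧ truncatedLaplace μ y₀ ≤ hardyLittlewood T}

/-- The inverse function `φ₁⁻¹` of Jacob's ladder. -/
def ladderInv (μ : ℝ → ℝ) (y₀ : ℝ) : ℝ → ℝ :=
  Function.invFunOn (ladder μ y₀) (ladderDomain μ y₀)

/-- The reverse iterations `φ₁^{-r}(T)`, that is `T⁰ = T` and `Tʳ = φ₁⁻¹(Tʳ⁻¹)`. -/
def reverseIterate (μ : ℝ → ℝ) (y₀ : ℝ) (r : ℕ) (T : ℝ) : ℝ := (ladderInv μ y₀)^[r] T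

/-- `(a, b]⁺`, the part of `(a, b]` on which `ln t > |ζ(1/2 + it)|²`. -/
def posPart (a b : ℝ) : Set ℝ := {t | t ∈ Ioc a b ∧ zetaSq t < Real.log t}

/-- `(a, b]⁻`, the part of `(a, b]` on which `ln t ≤ |ζ(1/2 + it)|²`. -/
def negPart (a b : ℝ) : Set ℝ := {t | t ∈ Ioc a b ∧ Real.log t ≤ zetaSq t}

end JacobLadder

end

namespace JacobLadder

/-! Write J for the Hardy-Littlewood integral and Φ for `truncatedLaplace μ`. The defining equation
of the ladder says J(φ₁⁻¹(U)) = Φ(2U) (`ladderInv_spec`). The two integrals over the ± parts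
recombine into ∫ (ln t - |ζ|²), the |ζ|² over the same interval cancels, and the bracket becomes
[Φ(2a) - M(a)] - [Φ(2b) - M(b)], where a and b are consecutive iterates and M(x) = x ln x + (γ - ln
2π)x. So it suffices that Φ(2x) - M(x) converges (`tendsto_truncatedLaplace_sub`). The limit is π,
but its value cancels.

Convergence is the classical asymptotic formula for the Laplace transform of |ζ(1/2 + it)|².
Parseval's formula for the Mellin transform of 1/(e^{wx} - 1) - 1/(wx), on the two rays w =
e^{±i(π/2 - δ)}, turns this transform into ∫ of a product of two such functions, up to O(|δ|). The
addition formula `bose_mul_bose` splits the product into terms with closed integrals and two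
remainders, bounded by expanding in geometric series (`norm_integral_bose_mul_boseReg_le`). Cutting
the transform at μ(y) costs almost nothing because μ(y) ≥ 7y ln y.

One further fact is needed: a ≤ b for consecutive iterates, since otherwise (a, b] is empty and the
± integrals say nothing. It follows from J(U) < Φ(2U) for large U, hence from J(U) ≤ U ln U + (2γ -
1 - ln 2π + ε)U together with γ < 2/3. This upper bound is Tauberian. The estimate of the Laplace
transform holds for complex δ with a loss (|δ| / Re δ)³; Gaussian smoothing in Fourier space
transfers it to J minus its main term, and monotonicity of J removes the smoothing. -/

/-! ### The Gamma integral on the complex right half-plane -/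

theorem integrableOn_rpow_mul_exp_neg_mul {a b : ℝ} (ha : -1 < a) (hb : 0 < b) :
    IntegrableOn (fun t : ℝ => t ^ a * Real.exp (-(b * t))) (Ioi 0) := by
  have := integrableOn_rpow_mul_exp_neg_mul_rpow (p := 1) ha one_pos hb
  simpa [Real.rpow_one, neg_mul] using this

theorem norm_cexp_neg_mul (r : ℂ) (t : ℝ) : ‖Complex.exp (-(r * t))‖ = Real.exp (-(r.re * t)) := by
  rw [Complex.norm_exp]; simp

theorem integrableOn_cpow_mul_cexp_neg_mul {s r : ℂ} (hs : 0 < s.re) (hr : 0 < r.re) :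
    IntegrableOn (fun t : ℝ => (t : ℂ) ^ (s - 1) * Complex.exp (-(r * t))) (Ioi 0) := by
  refine Integrable.mono' (integrableOn_rpow_mul_exp_neg_mul (a := s.re - 1) (by linarith) hr) ?_ ?_
  · refine ContinuousOn.aestronglyMeasurable (fun t ht => ContinuousAt.continuousWithinAt ?_)
      measurableSet_Ioi
    exact (Complex.continuousAt_ofReal_cpow_const _ _ (Or.inr ht.ne')).mul (by fun_prop)
  · filter_upwards [ae_restrict_mem measurableSet_Ioi] with t ht
    rw [norm_mul, norm_cexp_neg_mul, Complex.norm_cpow_eq_rpow_re_of_pos ht]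
    simp

/-- Supplies analyticity in r for the identity theorem. On the half-plane Re z > Re r / 2 the
differentiated integrand has a majorant independent of z. -/
theorem hasDerivAt_integral_cpow_mul_cexp_neg_mul {s r : ℂ} (hs : 0 < s.re) (hr : 0 < r.re) :
    HasDerivAt (fun r : ℂ => ∫ t in Ioi (0 : ℝ), (t : ℂ) ^ (s - 1) * Complex.exp (-(r * t)))
      (∫ t in Ioi (0 : ℝ), (t : ℂ) ^ (s - 1) * (Complex.exp (-(r * t)) * (-t))) r := by
  have hU : {z : ℂ | r.re / 2 < z.re} ∈ 𝓝 r :=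
    (isOpen_lt continuous_const Complex.continuous_re).mem_nhds (show r.re / 2 < r.re by linarith)
  have hmeas : ∀ z : ℂ, 0 < z.re → AEStronglyMeasurable
      (fun t : ℝ => (t : ℂ) ^ (s - 1) * Complex.exp (-(z * t))) (volume.restrict (Ioi 0)) :=
    fun z hz => (integrableOn_cpow_mul_cexp_neg_mul hs hz).aestronglyMeasurable
  refine (hasDerivAt_integral_of_dominated_loc_of_deriv_le
    (F := fun r : ℂ => fun t : ℝ => (t : ℂ) ^ (s - 1) * Complex.exp (-(r * t)))
    (F' := fun r : ℂ => fun t : ℝ => (t : ℂ) ^ (s - 1) * (Complex.exp (-(r * t)) * (-t)))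
    (bound := fun t : ℝ => t ^ s.re * Real.exp (-(r.re / 2 * t))) hU ?_
    (integrableOn_cpow_mul_cexp_neg_mul hs hr) ?_ ?_ ?_ ?_).2
  · filter_upwards [hU] with z hz
    exact hmeas z (lt_trans (by linarith) (show r.re / 2 < z.re from hz))
  · have := (hmeas r hr).mul (f := fun t : ℝ => (t : ℂ) ^ (s - 1) * Complex.exp (-(r * t)))
      (g := fun t : ℝ => (-t : ℂ)) (by fun_prop)
    simpa [mul_assoc, Pi.mul_def] using this
  · filter_upwards [ae_restrict_mem measurableSet_Ioi] with t (ht : 0 < t) z (hz : _ < _)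
    rw [norm_mul, norm_mul, norm_cexp_neg_mul, Complex.norm_cpow_eq_rpow_re_of_pos ht, norm_neg,
      Complex.norm_real, Real.norm_of_nonneg ht.le]
    have h1 : t ^ (s - 1).re * (Real.exp (-(z.re * t)) * t) = t ^ s.re * Real.exp (-(z.re * t)) := by
      rw [Complex.sub_re, Complex.one_re, Real.rpow_sub_one ht.ne']; field_simp
    rw [h1]
    gcongr
  · exact integrableOn_rpow_mul_exp_neg_mul (by linarith) (by linarith)
  · filter_upwards with t z _
    have : HasDerivAt (fun z : ℂ => -(z * t)) (-(t : ℂ)) z := by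
      simpa using ((hasDerivAt_id' z).mul_const (t : ℂ)).fun_neg
    exact this.cexp.const_mul _

theorem isPreconnected_re_pos : IsPreconnected {z : ℂ | 0 < z.re} :=
  (convex_halfSpace_re_gt 0).isPreconnected

/-- Identity theorem: real points decreasing to x₀ + 1 accumulate inside the half-plane. It serves
both to rotate the Gamma integral to complex r and to continue a Mellin transform from real s > 1 to
Re s > 0. -/
theorem eqOn_re_pos_of_eq_ofReal {f g : ℂ → ℂ} (hf : DifferentiableOn ℂ f {z : ℂ | 0 < z.re})
    (hg : DifferentiableOn ℂ g {z : ℂ | 0 < z.re}) {x₀ : ℝ} (hx₀ : 0 < x₀)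
    (h : ∀ x : ℝ, x₀ < x → f x = g x) : EqOn f g {z : ℂ | 0 < z.re} := by
  have ho : IsOpen {z : ℂ | 0 < z.re} := isOpen_lt continuous_const Complex.continuous_re
  refine (hf.analyticOnNhd ho).eqOn_of_preconnected_of_frequently_eq (hg.analyticOnNhd ho)
    isPreconnected_re_pos (z₀ := ((x₀ + 1 : ℝ) : ℂ)) (by simp; linarith) ?_
  have ht : Tendsto (fun x : ℝ => (x : ℂ)) (𝓝[>] (x₀ + 1)) (𝓝[≠] ((x₀ + 1 : ℝ) : ℂ)) := by
    refine tendsto_nhdsWithin_iff.2 ⟨(Complex.continuous_ofReal.tendsto _).mono_left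
      nhdsWithin_le_nhds, ?_⟩
    filter_upwards [self_mem_nhdsWithin] with x (hx : _ < x)
    simpa using mod_cast hx.ne'
  refine ht.frequently (Eventually.frequently ?_)
  filter_upwards [self_mem_nhdsWithin] with x (hx : _ < x)
  exact h x (by linarith)

/-- The Gamma integral along a complex ray of the right half-plane. -/
theorem integral_cpow_mul_cexp_neg_mul {s r : ℂ} (hs : 0 < s.re) (hr : 0 < r.re) :
    ∫ t in Ioi (0 : ℝ), (t : ℂ) ^ (s - 1) * Complex.exp (-(r * t)) = Complex.Gamma s * r ^ (-s) := by
  refine eqOn_re_pos_of_eq_ofReal (x₀ := 1)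
    (f := fun r : ℂ => ∫ t in Ioi (0 : ℝ), (t : ℂ) ^ (s - 1) * Complex.exp (-(r * t)))
    (g := fun r : ℂ => Complex.Gamma s * r ^ (-s)) ?_ ?_ one_pos ?_ hr
  · exact fun z hz => (hasDerivAt_integral_cpow_mul_cexp_neg_mul hs hz).differentiableAt.differentiableWithinAt
  · intro z hz
    refine DifferentiableAt.differentiableWithinAt ?_
    exact (differentiableAt_id.cpow_const (Or.inl hz)).const_mul _
  · intro x hx
    have h0 : 0 < x := by linarith
    rw [Complex.integral_cpow_mul_exp_neg_mul_Ioi hs h0, mul_comm, one_div, Complex.inv_cpow,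
      Complex.cpow_neg]
    rw [Complex.arg_ofReal_of_nonneg h0.le]; exact Real.pi_ne_zero.symm

theorem cpow_neg_natCast_mul {w : ℂ} (hw : 0 < w.re) (n : ℕ) (hn : n ≠ 0) (s : ℂ) :
    ((n : ℂ) * w) ^ (-s) = (n : ℂ) ^ (-s) * w ^ (-s) := by
  have hw0 : w ≠ 0 := by rintro rfl; simp at hw
  have hn0 : (n : ℂ) ≠ 0 := Nat.cast_ne_zero.2 hn
  rw [Complex.cpow_def_of_ne_zero (mul_ne_zero hn0 hw0), Complex.cpow_def_of_ne_zero hn0,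
    Complex.cpow_def_of_ne_zero hw0, ← Complex.exp_add, ← Complex.ofReal_natCast,
    Complex.log_ofReal_mul (by positivity) hw0, Complex.ofReal_log (by positivity)]
  congr 1
  push_cast
  ring

/-! ### The Bose function and its regularisations at the origin -/

/-- The periodic Bernoulli-type kernel `{s}(1 - {s}) / 2`. -/
noncomputable def fractKernel (s : ℝ) : ℝ := Int.fract s * (1 - Int.fract s) / 2

theorem fractKernel_nonneg (s : ℝ) : 0 ≤ fractKernel s := by
  have := Int.fract_nonneg s
  have := (Int.fract_lt_one s).le
  unfold fractKernel
  have : 0 ≤ 1 - Int.fract s := by linarith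
  positivity

theorem fractKernel_le (s : ℝ) : fractKernel s ≤ 1 / 8 := by
  unfold fractKernel
  nlinarith [sq_nonneg (Int.fract s - 1 / 2)]

theorem norm_fractKernel_le (s : ℝ) : ‖(fractKernel s : ℂ)‖ ≤ 1 / 8 := by
  rw [Complex.norm_real, Real.norm_of_nonneg (fractKernel_nonneg s)]
  exact fractKernel_le s

theorem fractKernel_add_one (s : ℝ) : fractKernel (s + 1) = fractKernel s := by
  simp [fractKernel]

@[fun_prop]
theorem measurable_fractKernel : Measurable fractKernel := by
  unfold fractKernel
  fun_prop

/-- The Bose function `1 / (e^z - 1)`. -/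
noncomputable def bose (z : ℂ) : ℂ := 1 / (Complex.exp z - 1)

/-- The Bose function with the first two terms of its Laurent expansion at `0` removed. -/
noncomputable def boseReg (z : ℂ) : ℂ := bose z - 1 / z + 1 / 2

theorem ne_zero_of_re_pos {z : ℂ} (hz : 0 < z.re) : z ≠ 0 := by rintro rfl; simp at hz

theorem one_lt_norm_cexp {z : ℂ} (hz : 0 < z.re) : 1 < ‖Complex.exp z‖ := by
  rw [Complex.norm_exp]; exact Real.one_lt_exp_iff.2 hz

theorem cexp_sub_one_ne_zero {z : ℂ} (hz : 0 < z.re) : Complex.exp z - 1 ≠ 0 := by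
  intro h
  have := one_lt_norm_cexp hz
  rw [sub_eq_zero.1 h] at this
  simp at this

theorem integrableOn_cexp_neg_mul {z : ℂ} (hz : 0 < z.re) :
    IntegrableOn (fun s : ℝ => Complex.exp (-(z * s))) (Ioi 0) := by
  have := integrableOn_cpow_mul_cexp_neg_mul (s := 1) (r := z) (by simp) hz
  simpa using this

theorem integrableOn_fractKernel_mul_cexp {z : ℂ} (hz : 0 < z.re) :
    IntegrableOn (fun s : ℝ => (fractKernel s : ℂ) * Complex.exp (-(z * s))) (Ioi 0) :=
  (integrableOn_cexp_neg_mul hz).bdd_mul (c := 1 / 8) (by fun_prop)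
    (Eventually.of_forall norm_fractKernel_le)

theorem integral_fractKernel_zero_one {z : ℂ} (hz : z ≠ 0) :
    ∫ s in (0 : ℝ)..1, (fractKernel s : ℂ) * Complex.exp (-(z * s)) =
      (1 / z ^ 2) * ((1 + Complex.exp (-z)) / 2 - (1 - Complex.exp (-z)) / z) := by
  have h1 : ∫ s in (0 : ℝ)..1, (fractKernel s : ℂ) * Complex.exp (-(z * s)) =
      ∫ s in (0 : ℝ)..1, ((s * (1 - s) / 2 : ℂ)) * Complex.exp (-(z * s)) := by
    refine intervalIntegral.integral_congr_Ioo_of_le zero_le_one fun s hs => ?_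
    have : Int.fract s = s := Int.fract_eq_self.2 ⟨hs.1.le, hs.2⟩
    simp [fractKernel, this]
  rw [h1]
  -- The antiderivative comes from repeated integration by parts against s(1 - s)/2, whose
  -- successive derivatives are 1/2 - s and -1.
  have hd : ∀ s ∈ uIcc (0 : ℝ) 1, HasDerivAt (fun s : ℝ => -Complex.exp (-(z * s)) *
      ((s * (1 - s) / 2 : ℂ) / z + (1 / 2 - s) / z ^ 2 - 1 / z ^ 3))
      ((s * (1 - s) / 2 : ℂ) * Complex.exp (-(z * s))) s := by
    intro s _
    have h2 : HasDerivAt (fun s : ℂ => -Complex.exp (-(z * s)) *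
      ((s * (1 - s) / 2 : ℂ) / z + (1 / 2 - s) / z ^ 2 - 1 / z ^ 3))
      (-(Complex.exp (-(z * s)) * (-(z * 1))) * ((s * (1 - s) / 2 : ℂ) / z + (1 / 2 - s) / z ^ 2 - 1 / z ^ 3)
        + -Complex.exp (-(z * s)) * ((1 * (1 - s) + s * (-1)) / 2 / z + (-1) / z ^ 2)) s := by
      refine HasDerivAt.fun_mul (((hasDerivAt_id' (s : ℂ)).const_mul z).fun_neg.cexp.fun_neg) ?_
      refine ((HasDerivAt.div_const (HasDerivAt.div_const ((hasDerivAt_id' (s : ℂ)).fun_mul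
        ((hasDerivAt_id' (s : ℂ)).const_sub 1)) 2) z).fun_add
        (((hasDerivAt_id' (s : ℂ)).const_sub (1/2)).div_const (z^2))).sub_const _
    convert h2.comp_ofReal using 1
    field_simp
    ring
  rw [intervalIntegral.integral_eq_sub_of_hasDerivAt hd]
  · simp
    field_simp
    ring
  · exact (by fun_prop : Continuous _).intervalIntegrable _ _

/-- Since the kernel has period 1, the integral I satisfies I = ∫₀¹ + e^{-z} I, which is solved for
I. This is Euler-Maclaurin summation in closed form; the factor z² yields a bound valid in the whole
half-plane, with explicit dependence on Re z. -/
theorem boseReg_eq_integral {z : ℂ} (hz : 0 < z.re) :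
    boseReg z = z ^ 2 * ∫ s in Ioi (0 : ℝ), (fractKernel s : ℂ) * Complex.exp (-(z * s)) := by
  set I := ∫ s in Ioi (0 : ℝ), (fractKernel s : ℂ) * Complex.exp (-(z * s)) with hI
  have hint := integrableOn_fractKernel_mul_cexp hz
  have hz0 := ne_zero_of_re_pos hz
  have h1 : I = (∫ s in (0 : ℝ)..1, (fractKernel s : ℂ) * Complex.exp (-(z * s)))
      + ∫ s in Ioi (1 : ℝ), (fractKernel s : ℂ) * Complex.exp (-(z * s)) := by
    rw [intervalIntegral.integral_interval_add_Ioi hint (hint.mono_set (Ioi_subset_Ioi zero_le_one))]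
  have h2 : ∫ s in Ioi (1 : ℝ), (fractKernel s : ℂ) * Complex.exp (-(z * s)) =
      Complex.exp (-z) * I := by
    have := (measurePreserving_add_right volume (1 : ℝ)).setIntegral_preimage_emb
      (measurableEmbedding_addRight 1)
      (fun s : ℝ => (fractKernel s : ℂ) * Complex.exp (-(z * s))) (Ioi 1)
    rw [preimage_add_const_Ioi, sub_self] at this
    rw [← this, hI, ← integral_const_mul]
    refine integral_congr_ae (Eventually.of_forall fun s => ?_)
    simp only [fractKernel_add_one]
    rw [show -(z * ((s + 1 : ℝ) : ℂ)) = -(z * s) + -z by push_cast; ring, Complex.exp_add]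
    ring
  rw [h2, integral_fractKernel_zero_one hz0] at h1
  have h3 : Complex.exp z - 1 ≠ 0 := cexp_sub_one_ne_zero hz
  rw [Complex.exp_neg] at h1
  have h4 := Complex.exp_ne_zero z
  have h5 : (1 - (Complex.exp z)⁻¹) * I = (1 / z ^ 2) * ((1 + (Complex.exp z)⁻¹) / 2 - (1 - (Complex.exp z)⁻¹) / z) := by
    linear_combination h1
  have h6 : I = (1 / z ^ 2) * ((1 + (Complex.exp z)⁻¹) / 2 - (1 - (Complex.exp z)⁻¹) / z) / (1 - (Complex.exp z)⁻¹) := by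
    rw [← h5]
    have : 1 - (Complex.exp z)⁻¹ ≠ 0 := by
      intro h; apply h3; field_simp at h; simpa using h
    field_simp
  rw [h6, boseReg, bose]
  field_simp
  ring

theorem norm_boseReg_le {z : ℂ} (hz : 0 < z.re) : ‖boseReg z‖ ≤ ‖z‖ ^ 2 / (8 * z.re) := by
  rw [boseReg_eq_integral hz, norm_mul, norm_pow]
  have h1 : ‖∫ s in Ioi (0 : ℝ), (fractKernel s : ℂ) * Complex.exp (-(z * s))‖ ≤
      ∫ s in Ioi (0 : ℝ), 1 / 8 * Real.exp (-z.re * s) := by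
    refine norm_integral_le_of_norm_le ((integrableOn_exp_mul_Ioi (by linarith) 0).const_mul _) ?_
    refine Eventually.of_forall fun s => ?_
    rw [norm_mul, norm_cexp_neg_mul, neg_mul]
    gcongr
    exact norm_fractKernel_le s
  rw [integral_const_mul, integral_exp_mul_Ioi (by linarith)] at h1
  simp at h1
  calc _ ≤ ‖z‖ ^ 2 * (8⁻¹ * z.re⁻¹) := by gcongr
    _ = _ := by field_simp

theorem norm_bose_le {z : ℂ} (hz : 0 < z.re) : ‖bose z‖ ≤ 1 / (Real.exp z.re - 1) := by
  have := one_lt_norm_cexp hz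
  rw [bose, norm_div, norm_one]
  rw [Complex.norm_exp] at this
  have h := norm_sub_norm_le (Complex.exp z) 1
  rw [Complex.norm_exp, norm_one] at h
  exact one_div_le_one_div_of_le (by linarith) h

theorem norm_bose_le_of_one_le {w : ℂ} (hw : 0 < w.re) {x : ℝ} (hx : 1 ≤ x) :
    ‖bose (w * x)‖ ≤ (1 / (1 - Real.exp (-w.re))) * Real.exp (-(w.re * x)) := by
  have h0 : 0 < w.re * x := by positivity
  refine (norm_bose_le (by simpa using h0)).trans ?_
  have h1 : Real.exp (-w.re) < 1 := Real.exp_lt_one_iff.2 (by linarith)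
  have h2 : Real.exp (-(w.re * x)) ≤ Real.exp (-w.re) := by
    apply Real.exp_le_exp.2; nlinarith
  have h3 : Real.exp (w.re * x) * Real.exp (-(w.re * x)) = 1 := by rw [← Real.exp_add]; simp
  have h4 : 1 < Real.exp (w.re * x) := Real.one_lt_exp_iff.2 h0
  simp only [Complex.mul_re, Complex.ofReal_re, Complex.ofReal_im, mul_zero, sub_zero]
  rw [div_mul_eq_mul_div, one_mul, div_le_div_iff₀ (by linarith) (by linarith)]
  nlinarith

theorem differentiableAt_bose {z : ℂ} (hz : 0 < z.re) : DifferentiableAt ℂ bose z := by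
  unfold bose
  exact (differentiableAt_const _).div (by fun_prop) (cexp_sub_one_ne_zero hz)

theorem continuousOn_bose_mul {w : ℂ} (hw : 0 < w.re) :
    ContinuousOn (fun x : ℝ => bose (w * x)) (Ioi 0) := by
  intro x (hx : 0 < x)
  refine ContinuousAt.continuousWithinAt ?_
  have : ContinuousAt bose (w * x) := (differentiableAt_bose (by simp; positivity)).continuousAt
  exact ContinuousAt.comp (f := fun x : ℝ => w * (x : ℂ)) this (by fun_prop)

theorem continuousOn_inv_mul {w : ℂ} (hw : 0 < w.re) :
    ContinuousOn (fun x : ℝ => 1 / (w * x)) (Ioi 0) := by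
  intro x (hx : 0 < x)
  have hw0 := ne_zero_of_re_pos hw
  have : (x : ℂ) ≠ 0 := mod_cast hx.ne'
  exact (continuousAt_const.div (by fun_prop) (by simp [*])).continuousWithinAt

/-- `1 / (e^{wx} - 1) - 1 / (wx)`. -/
noncomputable def boseCor (w : ℂ) (x : ℝ) : ℂ := bose (w * x) - 1 / (w * x)

/-- `1 / (e^{wx} - 1) - e^{-x} / (wx)`. -/
noncomputable def boseSub (w : ℂ) (x : ℝ) : ℂ := bose (w * x) - (Real.exp (-x) : ℂ) / (w * x)

/-- `1 / (e^{wx} - 1) - 1 / (wx) + e^{-x} / 2`. -/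
noncomputable def boseCorReg (w : ℂ) (x : ℝ) : ℂ := boseCor w x + (Real.exp (-x) : ℂ) / 2

theorem hasSum_bose {z : ℂ} (hz : 0 < z.re) :
    HasSum (fun n : ℕ => Complex.exp (-((n + 1 : ℕ) * z))) (bose z) := by
  have h1 : ‖Complex.exp (-z)‖ < 1 := by
    rw [Complex.norm_exp]; exact Real.exp_lt_one_iff.2 (by simpa using hz)
  have h := (hasSum_geometric_of_norm_lt_one h1).mul_left (Complex.exp (-z))
  have h2 : (fun n : ℕ => Complex.exp (-((n + 1 : ℕ) * z))) =
      fun n : ℕ => Complex.exp (-z) * Complex.exp (-z) ^ n := by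
    funext n
    rw [← Complex.exp_nat_mul, ← Complex.exp_add]
    congr 1; push_cast; ring
  have h3 : bose z = Complex.exp (-z) * (1 - Complex.exp (-z))⁻¹ := by
    have := cexp_sub_one_ne_zero hz
    have h0 := Complex.exp_ne_zero z
    rw [bose, Complex.exp_neg]
    have : 1 - (Complex.exp z)⁻¹ ≠ 0 := by
      intro h; apply this; field_simp at h; simpa using h
    field_simp
  rw [h2, h3]
  exact h

theorem re_mul_ofReal (w : ℂ) (x : ℝ) : (w * x).re = w.re * x := by simp

theorem re_mul_ofReal_pos {w : ℂ} (hw : 0 < w.re) {x : ℝ} (hx : 0 < x) : 0 < (w * x).re := by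
  rw [re_mul_ofReal]; positivity

theorem norm_boseReg_mul_le {w : ℂ} (hw : 0 < w.re) {x : ℝ} (hx : 0 < x) :
    ‖boseReg (w * x)‖ ≤ ‖w‖ ^ 2 / (8 * w.re) * x := by
  refine (norm_boseReg_le (re_mul_ofReal_pos hw hx)).trans_eq ?_
  rw [re_mul_ofReal, norm_mul, Complex.norm_real, Real.norm_of_nonneg hx.le]
  field_simp

theorem boseCor_eq (w : ℂ) (x : ℝ) : boseCor w x = boseReg (w * x) - 1 / 2 := by
  simp [boseCor, boseReg]

theorem norm_boseCor_le {w : ℂ} (hw : 0 < w.re) {x : ℝ} (hx : 0 < x) :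
    ‖boseCor w x‖ ≤ ‖w‖ ^ 2 / (8 * w.re) * x + 1 / 2 := by
  rw [boseCor_eq]
  refine (norm_sub_le _ _).trans ?_
  have := norm_boseReg_mul_le hw hx
  have h2 : ‖(1 / 2 : ℂ)‖ = 1 / 2 := by simp
  rw [h2]; linarith

theorem norm_one_sub_exp_neg_le {x : ℝ} (hx : 0 ≤ x) : ‖(1 - Real.exp (-x) : ℂ)‖ ≤ x := by
  have h1 := Real.add_one_le_exp (-x)
  have h2 : Real.exp (-x) ≤ 1 := Real.exp_le_one_iff.2 (by linarith)
  rw [← Complex.ofReal_one, ← Complex.ofReal_sub, Complex.norm_real, Real.norm_of_nonneg (by linarith)]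
  linarith

theorem norm_boseCorReg_le {w : ℂ} (hw : 0 < w.re) {x : ℝ} (hx : 0 < x) :
    ‖boseCorReg w x‖ ≤ (‖w‖ ^ 2 / (8 * w.re) + 1 / 2) * x := by
  have h : boseCorReg w x = boseReg (w * x) - (1 - Real.exp (-x)) / 2 := by
    rw [boseCorReg, boseCor_eq]; ring
  rw [h]
  refine (norm_sub_le _ _).trans ?_
  have := norm_boseReg_mul_le hw hx
  have h2 := norm_one_sub_exp_neg_le hx.le
  rw [norm_div, Complex.norm_ofNat]
  linarith

theorem boseSub_eq (w : ℂ) (x : ℝ) :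
    boseSub w x = boseCor w x + w⁻¹ * ((1 - Real.exp (-x)) / x) := by
  simp only [boseSub, boseCor, div_eq_mul_inv, mul_inv]; ring

theorem norm_boseSub_le {w : ℂ} (hw : 0 < w.re) {x : ℝ} (hx : 0 < x) :
    ‖boseSub w x‖ ≤ ‖w‖ ^ 2 / (8 * w.re) * x + 1 / 2 + ‖w‖⁻¹ := by
  rw [boseSub_eq]
  refine (norm_add_le _ _).trans ?_
  have h2 : ‖(1 - Real.exp (-x) : ℂ) / x‖ ≤ 1 := by
    rw [norm_div, Complex.norm_real, Real.norm_of_nonneg hx.le, div_le_one hx]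
    exact norm_one_sub_exp_neg_le hx.le
  have h3 : ‖w⁻¹ * ((1 - Real.exp (-x) : ℂ) / x)‖ ≤ ‖w‖⁻¹ := by
    rw [norm_mul, norm_inv]
    exact mul_le_of_le_one_right (by positivity) h2
  have := norm_boseCor_le hw hx
  linarith

theorem continuousOn_boseCor {w : ℂ} (hw : 0 < w.re) : ContinuousOn (boseCor w) (Ioi 0) :=
  (continuousOn_bose_mul hw).sub (continuousOn_inv_mul hw)

theorem continuousOn_boseSub {w : ℂ} (hw : 0 < w.re) : ContinuousOn (boseSub w) (Ioi 0) := by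
  refine (continuousOn_bose_mul hw).sub ?_
  have : ContinuousOn (fun x : ℝ => (Real.exp (-x) : ℂ) * (1 / (w * x))) (Ioi 0) :=
    ContinuousOn.mul (by fun_prop) (continuousOn_inv_mul hw)
  simpa only [mul_one_div] using this

theorem continuousOn_boseCorReg {w : ℂ} (hw : 0 < w.re) : ContinuousOn (boseCorReg w) (Ioi 0) :=
  (continuousOn_boseCor hw).add (by fun_prop)

/-! ### Growth at the endpoints and convergence of the Mellin transforms -/

theorem isBigO_zero_of_norm_le {f : ℝ → ℂ} {A B : ℝ} (h : ∀ x : ℝ, 0 < x → ‖f x‖ ≤ A * x + B) :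
    f =O[𝓝[>] 0] (fun x : ℝ => x ^ (-0 : ℝ)) := by
  refine Asymptotics.IsBigO.of_bound (|A| + |B|) ?_
  filter_upwards [Ioo_mem_nhdsGT one_pos] with x hx
  simp only [neg_zero, Real.rpow_zero, norm_one, mul_one]
  refine (h x hx.1).trans ?_
  have h1 : A * x ≤ |A| := by
    calc A * x ≤ |A| * x := by gcongr; exacts [hx.1.le, le_abs_self A]
      _ ≤ |A| * 1 := by gcongr; exact hx.2.le
      _ = |A| := mul_one _
  linarith [le_abs_self B]

theorem isBigO_zero_boseCor {w : ℂ} (hw : 0 < w.re) :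
    boseCor w =O[𝓝[>] 0] (fun x : ℝ => x ^ (-0 : ℝ)) :=
  isBigO_zero_of_norm_le fun _ hx => norm_boseCor_le hw hx

theorem isBigO_zero_bose {w : ℂ} (hw : 0 < w.re) :
    (fun x : ℝ => bose (w * x)) =O[𝓝[>] 0] (fun x : ℝ => x ^ (-1 : ℝ)) := by
  have h1 : (fun x : ℝ => 1 / (w * x)) =O[𝓝[>] 0] (fun x : ℝ => x ^ (-1 : ℝ)) := by
    refine Asymptotics.IsBigO.of_bound (‖w‖⁻¹) (Eventually.of_forall fun x => ?_)
    rw [Real.rpow_neg_one, norm_div, norm_mul, Complex.norm_real, norm_inv, norm_one, one_div,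
      mul_inv]
  have h2 : (fun x : ℝ => x ^ (-0 : ℝ)) =O[𝓝[>] 0] (fun x : ℝ => x ^ (-1 : ℝ)) := by
    refine Asymptotics.IsBigO.of_bound 1 ?_
    filter_upwards [Ioo_mem_nhdsGT one_pos] with x hx
    rw [neg_zero, Real.rpow_zero, norm_one, one_mul, Real.rpow_neg_one, norm_inv,
      Real.norm_of_nonneg hx.1.le]
    exact (one_le_inv₀ hx.1).2 hx.2.le
  refine (((isBigO_zero_boseCor hw).trans h2).add h1).congr_left fun x => ?_
  simp [boseCor]

theorem isBigO_zero_boseSub {w : ℂ} (hw : 0 < w.re) :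
    boseSub w =O[𝓝[>] 0] (fun x : ℝ => x ^ (-0 : ℝ)) :=
  isBigO_zero_of_norm_le (A := ‖w‖ ^ 2 / (8 * w.re)) (B := 1 / 2 + ‖w‖⁻¹) fun _ hx =>
    (norm_boseSub_le hw hx).trans_eq (by ring)

theorem isBigO_zero_boseCorReg {w : ℂ} (hw : 0 < w.re) :
    boseCorReg w =O[𝓝[>] 0] (fun x : ℝ => x ^ (-(-1) : ℝ)) := by
  refine Asymptotics.IsBigO.of_bound (‖w‖ ^ 2 / (8 * w.re) + 1 / 2) ?_
  filter_upwards [self_mem_nhdsWithin] with x (hx : 0 < x)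
  simp only [neg_neg, Real.rpow_one, Real.norm_of_nonneg hx.le]
  exact norm_boseCorReg_le hw hx

theorem isBigO_top_bose {w : ℂ} (hw : 0 < w.re) :
    (fun x : ℝ => bose (w * x)) =O[atTop] (fun x : ℝ => Real.exp (-w.re * x)) := by
  refine Asymptotics.IsBigO.of_bound (1 / (1 - Real.exp (-w.re))) ?_
  filter_upwards [eventually_ge_atTop 1] with x hx
  rw [Real.norm_of_nonneg (Real.exp_pos _).le, neg_mul]
  exact norm_bose_le_of_one_le hw hx

theorem isBigO_top_exp_div {w : ℂ} :
    (fun x : ℝ => (Real.exp (-x) : ℂ) / (w * x)) =O[atTop] (fun x : ℝ => Real.exp (-1 * x)) := by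
  refine Asymptotics.IsBigO.of_bound (‖w‖⁻¹) ?_
  filter_upwards [eventually_ge_atTop 1] with x hx
  rw [Real.norm_of_nonneg (Real.exp_pos _).le, neg_one_mul, norm_div, Complex.norm_real,
    Real.norm_of_nonneg (Real.exp_pos _).le, norm_mul, Complex.norm_real,
    Real.norm_of_nonneg (by linarith), div_eq_mul_inv, mul_comm, mul_inv]
  gcongr
  exact mul_le_of_le_one_right (by positivity) (inv_le_one_of_one_le₀ hx)

theorem isBigO_top_one_div {w : ℂ} :
    (fun x : ℝ => 1 / (w * x)) =O[atTop] (fun x : ℝ => x ^ (-1 : ℝ)) := by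
  refine Asymptotics.IsBigO.of_bound (‖w‖⁻¹) ?_
  filter_upwards [eventually_ge_atTop 1] with x hx
  rw [Real.rpow_neg_one, norm_div, norm_mul, Complex.norm_real, norm_inv, norm_one, one_div,
    mul_inv]

theorem isBigO_exp_mono {a b : ℝ} (h : b ≤ a) :
    (fun x : ℝ => Real.exp (-a * x)) =O[atTop] (fun x : ℝ => Real.exp (-b * x)) := by
  refine Asymptotics.IsBigO.of_bound 1 ?_
  filter_upwards [eventually_ge_atTop 0] with x hx
  rw [Real.norm_of_nonneg (Real.exp_pos _).le, Real.norm_of_nonneg (Real.exp_pos _).le, one_mul]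
  apply Real.exp_le_exp.2; nlinarith

theorem isBigO_top_boseSub {w : ℂ} (hw : 0 < w.re) :
    boseSub w =O[atTop] (fun x : ℝ => Real.exp (-(min w.re 1) * x)) :=
  ((isBigO_top_bose hw).trans (isBigO_exp_mono (min_le_left _ _))).sub
    (isBigO_top_exp_div.trans (isBigO_exp_mono (min_le_right _ _)))

theorem isBigO_top_boseCor {w : ℂ} (hw : 0 < w.re) :
    boseCor w =O[atTop] (fun x : ℝ => x ^ (-1 : ℝ)) :=
  ((isBigO_top_bose hw).trans (isLittleO_exp_neg_mul_rpow_atTop hw _).isBigO).sub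
    isBigO_top_one_div

theorem isBigO_top_boseCorReg {w : ℂ} (hw : 0 < w.re) :
    boseCorReg w =O[atTop] (fun x : ℝ => x ^ (-1 : ℝ)) := by
  refine (isBigO_top_boseCor hw).add ?_
  refine Asymptotics.IsBigO.trans ?_ (isLittleO_exp_neg_mul_rpow_atTop one_pos _).isBigO
  refine Asymptotics.IsBigO.of_bound 1 (Eventually.of_forall fun x => ?_)
  rw [norm_div, Complex.norm_real, Real.norm_of_nonneg (Real.exp_pos _).le, neg_one_mul,
    Complex.norm_ofNat, Real.norm_of_nonneg (Real.exp_pos _).le]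
  linarith [Real.exp_pos (-x)]

theorem mellinConvergent_boseSub {w : ℂ} (hw : 0 < w.re) {s : ℂ} (hs : 0 < s.re) :
    MellinConvergent (boseSub w) s :=
  mellinConvergent_of_isBigO_rpow_exp (lt_min hw one_pos)
    ((continuousOn_boseSub hw).locallyIntegrableOn measurableSet_Ioi) (isBigO_top_boseSub hw)
    (isBigO_zero_boseSub hw) hs

theorem differentiableAt_mellin_boseSub {w : ℂ} (hw : 0 < w.re) {s : ℂ} (hs : 0 < s.re) :
    DifferentiableAt ℂ (mellin (boseSub w)) s :=
  mellin_differentiableAt_of_isBigO_rpow_exp (lt_min hw one_pos)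
    ((continuousOn_boseSub hw).locallyIntegrableOn measurableSet_Ioi) (isBigO_top_boseSub hw)
    (isBigO_zero_boseSub hw) hs

theorem mellinConvergent_boseCor {w : ℂ} (hw : 0 < w.re) {s : ℂ} (hs : 0 < s.re) (hs1 : s.re < 1) :
    MellinConvergent (boseCor w) s :=
  mellinConvergent_of_isBigO_rpow
    ((continuousOn_boseCor hw).locallyIntegrableOn measurableSet_Ioi) (isBigO_top_boseCor hw) hs1
    (isBigO_zero_boseCor hw) hs

theorem mellinConvergent_boseCorReg {w : ℂ} (hw : 0 < w.re) {s : ℂ} (hs : -1 < s.re)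
    (hs1 : s.re < 1) : MellinConvergent (boseCorReg w) s :=
  mellinConvergent_of_isBigO_rpow
    ((continuousOn_boseCorReg hw).locallyIntegrableOn measurableSet_Ioi)
    (isBigO_top_boseCorReg hw) hs1 (isBigO_zero_boseCorReg hw) hs

theorem differentiableAt_mellin_boseCorReg {w : ℂ} (hw : 0 < w.re) {s : ℂ} (hs : -1 < s.re)
    (hs1 : s.re < 1) : DifferentiableAt ℂ (mellin (boseCorReg w)) s :=
  mellin_differentiableAt_of_isBigO_rpow
    ((continuousOn_boseCorReg hw).locallyIntegrableOn measurableSet_Ioi)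
    (isBigO_top_boseCorReg hw) hs1 (isBigO_zero_boseCorReg hw) hs

/-! ### Mellin transforms in terms of Γζ, and their values at 0 and 1 -/

/-- Expand the Bose function in its geometric series and integrate termwise along the ray; the norms
sum like ∑ n^{-Re s}. -/
theorem hasMellin_bose {w : ℂ} (hw : 0 < w.re) {s : ℂ} (hs : 1 < s.re) :
    HasMellin (fun x : ℝ => bose (w * x)) s (w ^ (-s) * Complex.Gamma s * riemannZeta s) := by
  have hs0 : 0 < s.re := by linarith
  set f : ℕ → ℝ → ℂ := fun n t => (t : ℂ) ^ (s - 1) * Complex.exp (-(((n + 1 : ℕ) * w) * t)) with hf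
  have hre : ∀ n : ℕ, 0 < (((n + 1 : ℕ) : ℂ) * w).re := by
    intro n
    rw [← Complex.ofReal_natCast, Complex.re_ofReal_mul]
    positivity
  have hre' : ∀ n : ℕ, (((n + 1 : ℕ) : ℂ) * w).re = (n + 1 : ℕ) * w.re := by
    intro n
    rw [← Complex.ofReal_natCast, Complex.re_ofReal_mul]
  have hint : ∀ n, Integrable (f n) (volume.restrict (Ioi 0)) :=
    fun n => integrableOn_cpow_mul_cexp_neg_mul hs0 (hre n)
  have hnorm : ∀ n, ∫ t in Ioi (0 : ℝ), ‖f n t‖ =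
      (w.re⁻¹) ^ s.re * Real.Gamma s.re * (1 / ((n + 1 : ℕ) : ℝ) ^ s.re) := by
    intro n
    have h1 : ∫ t in Ioi (0 : ℝ), ‖f n t‖ =
        ∫ t in Ioi (0 : ℝ), t ^ (s.re - 1) * Real.exp (-((n + 1 : ℕ) * w.re * t)) := by
      refine setIntegral_congr_fun measurableSet_Ioi fun t (ht : 0 < t) => ?_
      simp only [hf]
      rw [norm_mul, norm_cexp_neg_mul, hre', Complex.norm_cpow_eq_rpow_re_of_pos ht]
      simp
    rw [h1, Real.integral_rpow_mul_exp_neg_mul_Ioi hs0 (by positivity), one_div, mul_inv,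
      Real.mul_rpow (by positivity) (by positivity), one_div, Real.inv_rpow (by positivity) s.re]
    ring
  have hsum : Summable fun n => ∫ t in Ioi (0 : ℝ), ‖f n t‖ := by
    simp_rw [hnorm]
    refine Summable.mul_left _ ?_
    exact (summable_nat_add_iff 1).2 (Real.summable_one_div_nat_rpow.2 hs)
  have htsum : ∀ t ∈ Ioi (0 : ℝ), ∑' n, f n t = (t : ℂ) ^ (s - 1) • bose (w * t) := by
    intro t ht
    have := (hasSum_bose (re_mul_ofReal_pos hw ht)).mul_left ((t : ℂ) ^ (s - 1))
    rw [smul_eq_mul, ← this.tsum_eq]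
    simp only [hf, mul_assoc]
  have hS := hasSum_integral_of_summable_integral_norm hint hsum
  rw [setIntegral_congr_fun measurableSet_Ioi htsum] at hS
  refine ⟨?_, ?_⟩
  · exact mellinConvergent_of_isBigO_rpow_exp hw
      ((continuousOn_bose_mul hw).locallyIntegrableOn measurableSet_Ioi) (isBigO_top_bose hw)
      (isBigO_zero_bose hw) hs
  · rw [mellin, ← hS.tsum_eq, zeta_eq_tsum_one_div_nat_add_one_cpow hs, ← tsum_mul_left]
    refine tsum_congr fun n => ?_
    simp only [hf]
    rw [integral_cpow_mul_cexp_neg_mul hs0 (hre n), cpow_neg_natCast_mul hw _ (by omega),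
      Complex.cpow_neg (n + 1 : ℕ)]
    push_cast
    ring

theorem hasMellin_exp_div {w : ℂ} {s : ℂ} (hs : 1 < s.re) :
    HasMellin (fun x : ℝ => (Real.exp (-x) : ℂ) / (w * x)) s (w⁻¹ * Complex.Gamma (s - 1)) := by
  have hs' : 0 < (s - 1).re := by simpa using hs
  have hone : 0 < (1 : ℂ).re := by simp
  have h := integral_cpow_mul_cexp_neg_mul hs' hone
  have hi := (integrableOn_cpow_mul_cexp_neg_mul hs' hone).const_mul w⁻¹
  have heq : ∀ t ∈ Ioi (0 : ℝ), w⁻¹ * ((t : ℂ) ^ (s - 1 - 1) * Complex.exp (-(1 * t))) =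
      (t : ℂ) ^ (s - 1) • ((Real.exp (-t) : ℂ) / (w * t)) := by
    intro t (ht : 0 < t)
    have ht0 : (t : ℂ) ≠ 0 := mod_cast ht.ne'
    rw [Complex.cpow_sub _ _ ht0, Complex.cpow_one, smul_eq_mul, Complex.ofReal_exp]
    push_cast
    rw [one_mul]
    field_simp
  refine ⟨hi.congr ?_, ?_⟩
  · filter_upwards [ae_restrict_mem measurableSet_Ioi] with t ht using heq t ht
  · rw [mellin, ← setIntegral_congr_fun measurableSet_Ioi heq, integral_const_mul, h]
    simp

/-- Subtracting e^{-x}/(wx) rather than 1/(wx) removes the singularity at 0 and keeps exponential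
decay, so the transform is analytic on all of Re s > 0. The factor s - 1 clears the pole of ζ, and
the identity continues from real s > 1. -/
theorem sub_one_mul_mellin_boseSub {w : ℂ} (hw : 0 < w.re) {s : ℂ} (hs : 0 < s.re) :
    (s - 1) * mellin (boseSub w) s =
      Complex.Gamma s * (w ^ (-s) * riemannZeta₁ s - w⁻¹) := by
  have hw0 := ne_zero_of_re_pos hw
  refine eqOn_re_pos_of_eq_ofReal (x₀ := 1) (f := fun s => (s - 1) * mellin (boseSub w) s)
    (g := fun s => Complex.Gamma s * (w ^ (-s) * riemannZeta₁ s - w⁻¹)) ?_ ?_ one_pos ?_ hs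
  · intro z hz
    exact (DifferentiableAt.mul (by fun_prop)
      (differentiableAt_mellin_boseSub hw hz)).differentiableWithinAt
  · intro z (hz : 0 < z.re)
    refine DifferentiableAt.differentiableWithinAt ?_
    refine DifferentiableAt.mul (Complex.differentiableAt_Gamma _ fun m h => ?_) ?_
    · rw [h] at hz
      simp at hz
      linarith [(Nat.cast_nonneg m : (0 : ℝ) ≤ m)]
    · refine DifferentiableAt.sub (DifferentiableAt.mul ?_ (differentiable_riemannZeta₁ z))
        (by fun_prop)
      exact DifferentiableAt.const_cpow (by fun_prop) (Or.inl hw0)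
  · intro x hx
    have hx' : 1 < (x : ℂ).re := by simpa using hx
    have hx1 : (x : ℂ) ≠ 1 := by rintro h; rw [h] at hx'; simp at hx'
    have hx2 : (x : ℂ) - 1 ≠ 0 := sub_ne_zero.2 hx1
    have h := hasMellin_sub (hasMellin_bose hw hx').1 (hasMellin_exp_div (w := w) hx').1
    have h2 : mellin (boseSub w) x = _ := h.2
    rw [h2, (hasMellin_bose hw hx').2, (hasMellin_exp_div hx').2,
      riemannZeta_eq_inv_sub_mul hx1]
    have h3 := Complex.Gamma_add_one ((x : ℂ) - 1) hx2
    rw [sub_add_cancel] at h3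
    rw [h3]
    field_simp

theorem mellin_boseSub {w : ℂ} (hw : 0 < w.re) {s : ℂ} (hs : 0 < s.re) (hs1 : s ≠ 1) :
    mellin (boseSub w) s =
      w ^ (-s) * Complex.Gamma s * riemannZeta s - w⁻¹ * Complex.Gamma (s - 1) := by
  have hs2 : s - 1 ≠ 0 := sub_ne_zero.2 hs1
  have h := sub_one_mul_mellin_boseSub hw hs
  have h3 := Complex.Gamma_add_one (s - 1) hs2
  rw [sub_add_cancel] at h3
  rw [riemannZeta_eq_inv_sub_mul hs1]
  apply mul_left_cancel₀ hs2
  rw [h, h3]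
  field_simp

theorem mellin_eq_integral_one (f : ℝ → ℂ) : mellin f 1 = ∫ x in Ioi (0 : ℝ), f x := by
  simp [mellin]

theorem integrableOn_boseSub {w : ℂ} (hw : 0 < w.re) : IntegrableOn (boseSub w) (Ioi 0) := by
  have := mellinConvergent_boseSub hw (s := 1) (by simp)
  simpa [MellinConvergent] using this

/-- The integral is the Mellin transform at s = 1, which is the derivative at 1 of (s - 1) times
that transform. On the other side Γ'(1) is multiplied by zero, so only the derivative of w^{-s} (s -
1)ζ(s) survives; it supplies γ and log w. -/
theorem integral_boseSub {w : ℂ} (hw : 0 < w.re) :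
    ∫ x in Ioi (0 : ℝ), boseSub w x =
      ((Real.eulerMascheroniConstant : ℂ) - Complex.log w) / w := by
  have hw0 := ne_zero_of_re_pos hw
  rw [← mellin_eq_integral_one]
  have h1 : HasDerivAt (fun s : ℂ => (s - 1) * mellin (boseSub w) s) (mellin (boseSub w) 1) 1 := by
    have := (((hasDerivAt_id' (1 : ℂ)).sub_const 1).fun_mul
      (differentiableAt_mellin_boseSub hw (s := 1) (by simp)).hasDerivAt)
    simpa using this
  have h2 : HasDerivAt (fun s : ℂ => Complex.Gamma s * (w ^ (-s) * riemannZeta₁ s - w⁻¹))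
      (((Real.eulerMascheroniConstant : ℂ) - Complex.log w) / w) 1 := by
    have hz := (differentiable_riemannZeta₁ 1).hasDerivAt
    rw [deriv_riemannZeta₁_one] at hz
    have hc : HasDerivAt (fun s : ℂ => w ^ (-s)) (w ^ (-1 : ℂ) * Complex.log w * (-1)) 1 :=
      ((hasDerivAt_id' (1 : ℂ)).fun_neg).const_cpow (Or.inl hw0)
    have := Complex.hasDerivAt_Gamma_one.fun_mul ((hc.fun_mul hz).sub_const w⁻¹)
    refine this.congr_deriv ?_
    rw [riemannZeta₁_one, Complex.Gamma_one, Complex.cpow_neg_one]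
    field_simp
    ring
  have h3 : (fun s : ℂ => (s - 1) * mellin (boseSub w) s) =ᶠ[𝓝 1]
      (fun s : ℂ => Complex.Gamma s * (w ^ (-s) * riemannZeta₁ s - w⁻¹)) := by
    filter_upwards [(isOpen_lt continuous_const Complex.continuous_re).mem_nhds
      (show (0 : ℝ) < (1 : ℂ).re by simp)] with s hs
    exact sub_one_mul_mellin_boseSub hw hs
  exact h1.unique (h2.congr_of_eventuallyEq h3)

/-- Integration by parts with u = 1 - e^{-x} and v = x^{s-1}/(s - 1). Up to the factor w⁻¹ this
function is the difference of `boseSub` and `boseCor`, so it carries the Mellin transform from one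
to the other in the strip 0 < Re s < 1. -/
theorem hasMellin_one_sub_exp_div {s : ℂ} (hs : 0 < s.re) (hs1 : s.re < 1) :
    HasMellin (fun x : ℝ => (1 - Real.exp (-x) : ℂ) / x) s (-Complex.Gamma (s - 1)) := by
  have hc : ContinuousOn (fun x : ℝ => (1 - Real.exp (-x) : ℂ) / x) (Ioi 0) := by
    intro x (hx : 0 < x)
    have : (x : ℂ) ≠ 0 := mod_cast hx.ne'
    exact (ContinuousAt.div (by fun_prop) (by fun_prop) this).continuousWithinAt
  have hconv : MellinConvergent (fun x : ℝ => (1 - Real.exp (-x) : ℂ) / x) s := by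
    refine mellinConvergent_of_isBigO_rpow (a := 1) (b := 0)
      (hc.locallyIntegrableOn measurableSet_Ioi) ?_ hs1 ?_ hs
    · refine Asymptotics.IsBigO.of_bound 1 ?_
      filter_upwards [eventually_gt_atTop 0] with x hx
      rw [Real.rpow_neg_one, norm_div, norm_inv, Complex.norm_real, one_mul, div_eq_mul_inv]
      refine mul_le_of_le_one_left (by positivity) ?_
      rw [← Complex.ofReal_one, ← Complex.ofReal_sub, Complex.norm_real]
      have h2 : Real.exp (-x) ≤ 1 := Real.exp_le_one_iff.2 (by linarith)
      rw [Real.norm_of_nonneg (by linarith)]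
      linarith [Real.exp_pos (-x)]
    · refine isBigO_zero_of_norm_le (A := 0) (B := 1) fun x hx => ?_
      rw [norm_div, Complex.norm_real, Real.norm_of_nonneg hx.le, div_le_iff₀ hx]
      linarith [norm_one_sub_exp_neg_le hx.le]
  refine ⟨hconv, ?_⟩
  have hs2 : s - 1 ≠ 0 := by
    intro h
    have : s.re = 1 := by rw [sub_eq_zero.1 h]; simp
    linarith
  have hone : 0 < (1 : ℂ).re := by simp
  have hG := integral_cpow_mul_cexp_neg_mul hs hone
  have hGi := integrableOn_cpow_mul_cexp_neg_mul hs hone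
  simp only [one_mul, Complex.one_cpow, mul_one] at hG hGi
  have heq : ∀ x ∈ Ioi (0 : ℝ), (x : ℂ) ^ (s - 1) • ((1 - Real.exp (-x) : ℂ) / x) =
      (1 - Complex.exp (-x)) * (x : ℂ) ^ (s - 1 - 1) := by
    intro x (hx : 0 < x)
    have hx0 : (x : ℂ) ≠ 0 := mod_cast hx.ne'
    rw [Complex.cpow_sub (s - 1) _ hx0, Complex.cpow_one, smul_eq_mul]
    push_cast
    ring
  have hparts := integral_Ioi_mul_deriv_eq_deriv_mul (a := (0 : ℝ)) (a' := (0 : ℂ)) (b' := 0)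
    (u := fun x : ℝ => (1 - Complex.exp (-x))) (u' := fun x : ℝ => Complex.exp (-x))
    (v := fun x : ℝ => (x : ℂ) ^ (s - 1) / (s - 1)) (v' := fun x : ℝ => (x : ℂ) ^ (s - 1 - 1))
    ?_ ?_ ?_ ?_ ?_ ?_
  · rw [mellin, setIntegral_congr_fun measurableSet_Ioi heq, hparts]
    have h4 : ∫ x in Ioi (0 : ℝ), Complex.exp (-x) * ((x : ℂ) ^ (s - 1) / (s - 1)) =
        (s - 1)⁻¹ * Complex.Gamma s := by
      rw [← hG, ← integral_const_mul]
      congr 1 with x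
      ring
    rw [h4]
    have h3 := Complex.Gamma_add_one (s - 1) hs2
    rw [sub_add_cancel] at h3
    rw [h3]
    field_simp
    simp
  · intro x _
    have := (((hasDerivAt_id' (x : ℂ)).fun_neg.cexp).const_sub 1).comp_ofReal
    simpa using this
  · intro x (hx : 0 < x)
    have := hasDerivAt_ofReal_cpow_const' (r := s - 1 - 1) hx.ne' (by
      intro h; apply hs2; linear_combination h)
    simpa using this
  · have := hconv.congr (g := fun x : ℝ => (1 - Complex.exp (-x)) * (x : ℂ) ^ (s - 1 - 1)) (by
      filter_upwards [ae_restrict_mem measurableSet_Ioi] with x hx using heq x hx)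
    exact this
  · refine (hGi.const_mul (s - 1)⁻¹).congr (Eventually.of_forall fun x => ?_)
    simp only [Pi.mul_apply]
    ring
  · rw [tendsto_zero_iff_norm_tendsto_zero]
    have hlim : Tendsto (fun x : ℝ => x ^ s.re * ‖s - 1‖⁻¹) (𝓝[>] 0) (𝓝 0) := by
      have : Tendsto (fun x : ℝ => x ^ s.re) (𝓝[>] 0) (𝓝 (0 ^ s.re)) :=
        (Real.continuousAt_rpow_const _ _ (Or.inr hs.le)).tendsto.mono_left nhdsWithin_le_nhds
      rw [Real.zero_rpow hs.ne'] at this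
      simpa using this.mul_const (‖s - 1‖⁻¹)
    refine squeeze_zero' (Eventually.of_forall fun _ => norm_nonneg _) ?_ hlim
    filter_upwards [self_mem_nhdsWithin] with x (hx : 0 < x)
    have h5 := norm_one_sub_exp_neg_le hx.le
    push_cast at h5
    simp only [Pi.mul_apply]
    rw [norm_mul, norm_div, Complex.norm_cpow_eq_rpow_re_of_pos hx]
    have h6 : x ^ s.re = x * x ^ (s - 1).re := by
      rw [Complex.sub_re, Complex.one_re, Real.rpow_sub_one hx.ne']; field_simp
    rw [h6, div_eq_mul_inv, ← mul_assoc]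
    gcongr
  · rw [tendsto_zero_iff_norm_tendsto_zero]
    have hlim : Tendsto (fun x : ℝ => x ^ (-(1 - s.re)) * ‖s - 1‖⁻¹) atTop (𝓝 0) := by
      simpa using (tendsto_rpow_neg_atTop (show 0 < 1 - s.re by linarith)).mul_const (‖s - 1‖⁻¹)
    refine squeeze_zero' (Eventually.of_forall fun _ => norm_nonneg _) ?_ hlim
    filter_upwards [eventually_gt_atTop 0] with x hx
    simp only [Pi.mul_apply]
    rw [norm_mul, norm_div, Complex.norm_cpow_eq_rpow_re_of_pos hx, div_eq_mul_inv]
    have h7 : ‖(1 - Complex.exp (-x) : ℂ)‖ ≤ 1 := by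
      rw [← Complex.ofReal_neg, ← Complex.ofReal_exp, ← Complex.ofReal_one, ← Complex.ofReal_sub,
        Complex.norm_real]
      have h2 : Real.exp (-x) ≤ 1 := Real.exp_le_one_iff.2 (by linarith)
      rw [Real.norm_of_nonneg (by linarith)]
      linarith [Real.exp_pos (-x)]
    have h8 : (s - 1).re = -(1 - s.re) := by simp
    rw [h8]
    exact mul_le_of_le_one_left (by positivity) h7

theorem mellin_boseCor {w : ℂ} (hw : 0 < w.re) {s : ℂ} (hs : 0 < s.re) (hs1 : s.re < 1) :
    mellin (boseCor w) s = w ^ (-s) * Complex.Gamma s * riemannZeta s := by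
  have h1 := hasMellin_one_sub_exp_div hs hs1
  have h2 : s ≠ 1 := by rintro rfl; simp at hs1
  have h3 := hasMellin_sub (mellinConvergent_boseSub hw hs) (h1.1.const_smul w⁻¹)
  have h4 : (fun t : ℝ => boseSub w t - w⁻¹ • ((1 - Real.exp (-t) : ℂ) / t)) = boseCor w := by
    funext t
    rw [boseSub_eq, smul_eq_mul]
    ring
  rw [h4] at h3
  rw [h3.2, mellin_const_smul, h1.2, mellin_boseSub hw hs h2, smul_eq_mul]
  ring

theorem mellin_boseCorReg {w : ℂ} (hw : 0 < w.re) {s : ℂ} (hs : 0 < s.re) (hs1 : s.re < 1) :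
    mellin (boseCorReg w) s =
      w ^ (-s) * Complex.Gamma s * riemannZeta s + Complex.Gamma s / 2 := by
  have hone : 0 < (1 : ℂ).re := by simp
  have hG := integral_cpow_mul_cexp_neg_mul hs hone
  have hGi := integrableOn_cpow_mul_cexp_neg_mul hs hone
  simp only [one_mul, Complex.one_cpow, mul_one] at hG hGi
  have hE : HasMellin (fun x : ℝ => (Real.exp (-x) : ℂ)) s (Complex.Gamma s) :=
    ⟨by simpa [MellinConvergent] using hGi, by simpa [mellin] using hG⟩
  have h3 := hasMellin_add (mellinConvergent_boseCor hw hs hs1) (hE.1.div_const 2)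
  have h4 : mellin (boseCorReg w) s = _ := h3.2
  rw [h4, mellin_boseCor hw hs hs1, mellin_div_const, hE.2]

/-- For 0 < s < 1 the transform is Γ(s)(w^{-s}ζ(s) + 1/2). As ζ(0) = -1/2, this is Γ(s + 1) times
the difference quotient of w^{-s}ζ(s) at 0. Let s → 0⁺: the left side is continuous, since the extra
e^{-x}/2 widens the strip to -1 < Re s < 1. -/
theorem mellin_boseCorReg_zero {w : ℂ} (hw : 0 < w.re) :
    mellin (boseCorReg w) 0 = (Complex.log w - Complex.log (2 * Real.pi)) / 2 := by
  have hw0 := ne_zero_of_re_pos hw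
  have hd : HasDerivAt (fun s : ℂ => w ^ (-s) * riemannZeta s)
      ((Complex.log w - Complex.log (2 * Real.pi)) / 2) 0 := by
    have hz := (differentiableAt_riemannZeta (s := 0) zero_ne_one).hasDerivAt
    rw [deriv_riemannZeta_zero] at hz
    have hc : HasDerivAt (fun s : ℂ => w ^ (-s)) (w ^ (-0 : ℂ) * Complex.log w * (-1)) 0 :=
      ((hasDerivAt_id' (0 : ℂ)).fun_neg).const_cpow (Or.inl hw0)
    refine (hc.fun_mul hz).congr_deriv ?_
    rw [riemannZeta_zero, neg_zero, Complex.cpow_zero]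
    ring
  have hreal : Tendsto (fun x : ℝ => (x : ℂ)) (𝓝[>] 0) (𝓝[≠] 0) := by
    refine tendsto_nhdsWithin_iff.2 ⟨?_, ?_⟩
    · exact (Complex.continuous_ofReal.tendsto' 0 0 (by simp)).mono_left nhdsWithin_le_nhds
    · filter_upwards [self_mem_nhdsWithin] with x (hx : 0 < x)
      simpa using hx.ne'
  have h1 : Tendsto (fun x : ℝ => mellin (boseCorReg w) x) (𝓝[>] 0) (𝓝 (mellin (boseCorReg w) 0)) :=
    (differentiableAt_mellin_boseCorReg hw (s := 0) (by simp) (by simp)).continuousAt.tendsto.comp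
      (hreal.mono_right nhdsWithin_le_nhds)
  have h2 : Tendsto (fun x : ℝ => Complex.Gamma (x + 1) *
      slope (fun s : ℂ => w ^ (-s) * riemannZeta s) 0 x) (𝓝[>] 0)
      (𝓝 (1 * ((Complex.log w - Complex.log (2 * Real.pi)) / 2))) := by
    refine Tendsto.mul ?_ ((hasDerivAt_iff_tendsto_slope.1 hd).comp hreal)
    have hcont : ContinuousAt Complex.Gamma 1 := Complex.hasDerivAt_Gamma_one.continuousAt
    rw [← Complex.Gamma_one]
    refine hcont.tendsto.comp ?_
    have : Tendsto (fun x : ℝ => (x : ℂ) + 1) (𝓝[>] 0) (𝓝 (0 + 1)) :=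
      (hreal.mono_right nhdsWithin_le_nhds).add_const 1
    simpa using this
  rw [one_mul] at h2
  refine tendsto_nhds_unique (h1.congr' ?_) h2
  filter_upwards [Ioo_mem_nhdsGT one_pos] with x hx
  have hx0 : (x : ℂ) ≠ 0 := mod_cast hx.1.ne'
  rw [mellin_boseCorReg hw (by simpa using hx.1) (by simpa using hx.2), Complex.Gamma_add_one _ hx0,
    slope_def_field, riemannZeta_zero, neg_zero, Complex.cpow_zero, sub_zero]
  field_simp
  ring

theorem integrableOn_boseCorReg_div {w : ℂ} (hw : 0 < w.re) :
    IntegrableOn (fun x : ℝ => boseCorReg w x / x) (Ioi 0) := by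
  have := mellinConvergent_boseCorReg hw (s := 0) (by simp) (by simp)
  refine this.congr_fun (fun x (hx : 0 < x) => ?_) measurableSet_Ioi
  simp [Complex.cpow_neg_one, div_eq_inv_mul]

theorem integral_boseCorReg_div {w : ℂ} (hw : 0 < w.re) :
    ∫ x in Ioi (0 : ℝ), boseCorReg w x / x = (Complex.log w - Complex.log (2 * Real.pi)) / 2 := by
  rw [← mellin_boseCorReg_zero hw, mellin]
  refine setIntegral_congr_fun measurableSet_Ioi fun x (hx : 0 < x) => ?_
  simp [Complex.cpow_neg_one, div_eq_inv_mul]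

/-! ### Decay of Γζ on the critical line and Parseval's formula -/

/-- `Γ(1/2 + it) ζ(1/2 + it)`. -/
noncomputable def gammaZeta (t : ℝ) : ℂ :=
  Complex.Gamma (1 / 2 + t * Complex.I) * riemannZeta (1 / 2 + t * Complex.I)

theorem half_add_ne_one (t : ℝ) : (1 / 2 + t * Complex.I : ℂ) ≠ 1 := by
  intro h
  have := congrArg Complex.re h
  simp at this

theorem re_half_add (t : ℝ) : (1 / 2 + t * Complex.I : ℂ).re = 1 / 2 := by simp

theorem im_half_add (t : ℝ) : (1 / 2 + t * Complex.I : ℂ).im = t := by simp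

theorem continuous_zeta_half : Continuous fun t : ℝ => riemannZeta (1 / 2 + t * Complex.I) := by
  refine continuous_iff_continuousAt.2 fun t => ?_
  exact ContinuousAt.comp (f := fun t : ℝ => (1 / 2 + t * Complex.I : ℂ))
    (differentiableAt_riemannZeta (half_add_ne_one t)).continuousAt (by fun_prop)

theorem continuous_zetaSq : Continuous zetaSq := by
  unfold zetaSq
  exact (continuous_zeta_half.norm).pow 2

theorem zetaSq_nonneg (t : ℝ) : 0 ≤ zetaSq t := by unfold zetaSq; positivity

theorem continuous_gammaZeta : Continuous gammaZeta := by
  refine Continuous.mul ?_ continuous_zeta_half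
  refine continuous_iff_continuousAt.2 fun t => ?_
  refine ContinuousAt.comp (f := fun t : ℝ => (1 / 2 + t * Complex.I : ℂ))
    (Complex.differentiableAt_Gamma _ fun m h => ?_).continuousAt (by fun_prop)
  have := congrArg Complex.re h
  rw [re_half_add] at this
  simp at this
  linarith [(Nat.cast_nonneg m : (0 : ℝ) ≤ m)]

theorem conj_half_add (t : ℝ) :
    (starRingEnd ℂ) (1 / 2 + t * Complex.I) = 1 / 2 + ((-t : ℝ) : ℂ) * Complex.I := by
  apply Complex.ext <;> simp

theorem zeta_half_neg (t : ℝ) : riemannZeta (1 / 2 + ((-t : ℝ) : ℂ) * Complex.I) =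
    (starRingEnd ℂ) (riemannZeta (1 / 2 + t * Complex.I)) := by
  rw [← conj_half_add, riemannZeta_conj]

theorem zetaSq_neg (t : ℝ) : zetaSq (-t) = zetaSq t := by
  rw [zetaSq, zetaSq, zeta_half_neg, RCLike.norm_conj]

/-- At s = 1/2 + it both 1 - s and the conjugate of s equal 1/2 - it: the reflection formula handles
the Gamma factors and conjugation the zeta factors. -/
theorem gammaZeta_mul_neg (t : ℝ) :
    gammaZeta t * gammaZeta (-t) = Real.pi * zetaSq t / Complex.cosh (Real.pi * t) := by
  have h1 : (1 / 2 + ((-t : ℝ) : ℂ) * Complex.I) = 1 - (1 / 2 + t * Complex.I) := by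
    push_cast; ring
  have h2 := Complex.Gamma_mul_Gamma_one_sub (1 / 2 + t * Complex.I)
  have h3 : Complex.sin (Real.pi * (1 / 2 + t * Complex.I)) = Complex.cosh (Real.pi * t) := by
    rw [show (Real.pi : ℂ) * (1 / 2 + t * Complex.I) = (Real.pi * t) * Complex.I + Real.pi / 2 by ring,
      Complex.sin_add_pi_div_two, Complex.cos_mul_I]
  have h4 : riemannZeta (1 / 2 + t * Complex.I) * riemannZeta (1 / 2 + ((-t : ℝ) : ℂ) * Complex.I) =
      zetaSq t := by
    rw [zeta_half_neg, Complex.mul_conj, Complex.normSq_eq_norm_sq, zetaSq]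
  rw [h3, ← h1] at h2
  rw [gammaZeta, gammaZeta, mul_mul_mul_comm, h2, h4]
  ring

theorem mellin_boseCor_half {w : ℂ} (hw : 0 < w.re) (t : ℝ) :
    mellin (boseCor w) (1 / 2 + t * Complex.I) =
      w ^ (-(1 / 2 + t * Complex.I : ℂ)) * gammaZeta t := by
  rw [mellin_boseCor hw (by rw [re_half_add]; norm_num) (by rw [re_half_add]; norm_num), gammaZeta,
    mul_assoc]

theorem norm_cpow_neg_half {w : ℂ} (hw : w ≠ 0) (t : ℝ) :
    ‖w ^ (-(1 / 2 + t * Complex.I : ℂ))‖ = ‖w‖ ^ (-(1 / 2) : ℝ) * Real.exp (w.arg * t) := by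
  rw [Complex.norm_cpow_of_ne_zero hw, Complex.neg_re, Complex.neg_im, re_half_add, im_half_add,
    div_eq_mul_inv, ← Real.exp_neg]
  simp

theorem integrableOn_rpow_mul_norm_boseCor {w : ℂ} (hw : 0 < w.re) :
    IntegrableOn (fun x : ℝ => x ^ (-(1 / 2) : ℝ) * ‖boseCor w x‖) (Ioi 0) := by
  have h := mellinConvergent_boseCor hw (s := 1 / 2) (by simp) (by norm_num)
  refine IntegrableOn.congr_fun h.norm (fun x (hx : 0 < x) => ?_) measurableSet_Ioi
  rw [norm_smul, Complex.norm_cpow_eq_rpow_re_of_pos hx]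
  norm_num

theorem exists_norm_mellin_boseCor_le (w : ℂ) :
    ∃ C : ℝ, ∀ t : ℝ, ‖mellin (boseCor w) (1 / 2 + t * Complex.I)‖ ≤ C := by
  refine ⟨∫ x in Ioi (0 : ℝ), x ^ (-(1 / 2) : ℝ) * ‖boseCor w x‖, fun t => ?_⟩
  refine (norm_integral_le_integral_norm _).trans_eq ?_
  refine setIntegral_congr_fun measurableSet_Ioi fun x (hx : 0 < x) => ?_
  rw [norm_smul, Complex.norm_cpow_eq_rpow_re_of_pos hx, Complex.sub_re, re_half_add]
  norm_num

theorem exists_exp_mul_norm_gammaZeta_le {w : ℂ} (hw : 0 < w.re) :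
    ∃ C : ℝ, ∀ t : ℝ, Real.exp (w.arg * t) * ‖gammaZeta t‖ ≤ C := by
  obtain ⟨C, hC⟩ := exists_norm_mellin_boseCor_le w
  have hw0 := ne_zero_of_re_pos hw
  have hp : 0 < ‖w‖ ^ (-(1 / 2) : ℝ) := Real.rpow_pos_of_pos (norm_pos_iff.2 hw0) _
  refine ⟨C / ‖w‖ ^ (-(1 / 2) : ℝ), fun t => ?_⟩
  have := hC t
  rw [mellin_boseCor_half hw, norm_mul, norm_cpow_neg_half hw0] at this
  rw [le_div_iff₀ hp]
  linarith

/-- This replaces Stirling's formula and growth bounds for ζ. The Mellin transform of `boseCor w` is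
bounded on the line, while w^{-s} contributes e^{t arg w}; taking arg w = ±θ forces the decay of Γζ
in both directions. -/
theorem exists_norm_gammaZeta_le {θ : ℝ} (hθ0 : 0 ≤ θ) (hθ : θ < Real.pi / 2) :
    ∃ C : ℝ, ∀ t : ℝ, ‖gammaZeta t‖ ≤ C * Real.exp (-(θ * |t|)) := by
  have key : ∀ φ : ℝ, -(Real.pi / 2) < φ → φ < Real.pi / 2 →
      ∃ C : ℝ, ∀ t : ℝ, Real.exp (φ * t) * ‖gammaZeta t‖ ≤ C := by
    intro φ h1 h2
    have hre : 0 < (Complex.exp (φ * Complex.I)).re := by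
      rw [Complex.exp_ofReal_mul_I_re]; exact Real.cos_pos_of_mem_Ioo ⟨h1, h2⟩
    have harg : (Complex.exp (φ * Complex.I)).arg = φ := by
      rw [Complex.arg_exp_mul_I, toIocMod_eq_self]
      constructor <;> linarith [Real.pi_pos]
    have := exists_exp_mul_norm_gammaZeta_le hre
    rwa [harg] at this
  obtain ⟨C₁, h₁⟩ := key θ (by linarith [Real.pi_pos]) hθ
  obtain ⟨C₂, h₂⟩ := key (-θ) (by linarith) (by linarith [Real.pi_pos])
  refine ⟨max C₁ C₂, fun t => ?_⟩
  have hE : ∀ y : ℝ, Real.exp y * Real.exp (-y) = 1 := fun y => by rw [← Real.exp_add]; simp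
  have hcase : Real.exp (θ * |t|) * ‖gammaZeta t‖ ≤ max C₁ C₂ := by
    rcases le_total 0 t with h | h
    · rw [abs_of_nonneg h]; exact (h₁ t).trans (le_max_left _ _)
    · rw [abs_of_nonpos h, show θ * -t = -θ * t by ring]; exact (h₂ t).trans (le_max_right _ _)
  calc ‖gammaZeta t‖ = (Real.exp (θ * |t|) * ‖gammaZeta t‖) * Real.exp (-(θ * |t|)) := by
        rw [mul_right_comm, hE, one_mul]
    _ ≤ _ := by gcongr

theorem integrable_of_integrableOn_Ioi_of_neg {E : Type*} [NormedAddCommGroup E] {f : ℝ → E}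
    (h1 : IntegrableOn f (Ioi 0)) (h2 : IntegrableOn (fun t => f (-t)) (Ioi 0)) :
    Integrable f := by
  have h3 : IntegrableOn f (Iic 0) := by
    have := (IntegrableOn.comp_neg_Iic (c := (0 : ℝ)) (μ := volume)
      (f := fun t => f (-t)) (by rwa [neg_zero, integrableOn_Ici_iff_integrableOn_Ioi]))
    simpa using this
  rw [← integrableOn_univ, ← Iic_union_Ioi (a := (0 : ℝ))]
  exact h3.union h1

theorem integrable_exp_neg_mul_abs {c : ℝ} (hc : 0 < c) :
    Integrable fun t : ℝ => Real.exp (-(c * |t|)) := by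
  have h1 : IntegrableOn (fun t : ℝ => Real.exp (-(c * |t|))) (Ioi 0) := by
    refine (integrableOn_exp_mul_Ioi (a := -c) (by linarith) 0).congr_fun (fun t ht => ?_)
      measurableSet_Ioi
    simp only
    rw [abs_of_pos ht, neg_mul]
  refine integrable_of_integrableOn_Ioi_of_neg h1 (h1.congr_fun (fun t _ => ?_) measurableSet_Ioi)
  simp only [abs_neg]

theorem continuous_mellin_boseCor_half {w : ℂ} (hw : 0 < w.re) :
    Continuous fun t : ℝ => mellin (boseCor w) (1 / 2 + t * Complex.I) := by
  have hw0 := ne_zero_of_re_pos hw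
  simp_rw [mellin_boseCor_half hw]
  refine Continuous.mul ?_ continuous_gammaZeta
  exact Continuous.const_cpow (by fun_prop) (Or.inl hw0)

theorem integrable_mellin_boseCor_half {w : ℂ} (hw : 0 < w.re) :
    Integrable fun t : ℝ => mellin (boseCor w) (1 / 2 + t * Complex.I) := by
  have hw0 := ne_zero_of_re_pos hw
  have harg : |w.arg| < Real.pi / 2 := Complex.abs_arg_lt_pi_div_two_iff.2 (Or.inl hw)
  -- The gap between |arg w| and θ is the rate of exponential decay that remains.
  obtain ⟨θ, h1, h2⟩ := exists_between harg
  obtain ⟨C, hC⟩ := exists_norm_gammaZeta_le ((abs_nonneg _).trans h1.le) h2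
  refine Integrable.mono' ((integrable_exp_neg_mul_abs (sub_pos.2 h1)).const_mul
    (‖w‖ ^ (-(1 / 2) : ℝ) * C)) (continuous_mellin_boseCor_half hw).aestronglyMeasurable
    (Eventually.of_forall fun t => ?_)
  rw [mellin_boseCor_half hw, norm_mul, norm_cpow_neg_half hw0]
  have h3 : Real.exp (w.arg * t) ≤ Real.exp (|w.arg| * |t|) := by
    apply Real.exp_le_exp.2
    rw [← abs_mul]; exact le_abs_self _
  calc _ ≤ ‖w‖ ^ (-(1 / 2) : ℝ) * Real.exp (|w.arg| * |t|) * (C * Real.exp (-(θ * |t|))) := by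
        gcongr; exact hC t
    _ = ‖w‖ ^ (-(1 / 2) : ℝ) * C * (Real.exp (|w.arg| * |t|) * Real.exp (-(θ * |t|))) := by ring
    _ = _ := by rw [← Real.exp_add]; congr 2; ring

/-- Parseval's formula for the Mellin transform of `boseCor`. -/
theorem integral_boseCor_mul_boseCor {w₁ w₂ : ℂ} (h₁ : 0 < w₁.re) (h₂ : 0 < w₂.re) :
    ∫ x in Ioi (0 : ℝ), boseCor w₁ x * boseCor w₂ x =
      (1 / (2 * Real.pi)) * ∫ t : ℝ, mellin (boseCor w₁) (1 / 2 + t * Complex.I) *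
        mellin (boseCor w₂) (1 / 2 + ((-t : ℝ) : ℂ) * Complex.I) := by
  -- Only the first factor is replaced, by its Mellin inversion integral. After the exchange of
  -- integrals, x^{-s} = x^{(1-s)-1} makes the x-integral the Mellin transform of the second factor
  -- at 1 - s.
  have hinv : ∀ x ∈ Ioi (0 : ℝ), boseCor w₁ x * boseCor w₂ x =
      (1 / (2 * Real.pi)) * ∫ t : ℝ, ((x : ℂ) ^ (-(1 / 2 + t * Complex.I : ℂ)) * boseCor w₂ x) *
        mellin (boseCor w₁) (1 / 2 + t * Complex.I) := by
    intro x (hx : 0 < x)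
    have h := mellinInv_mellin_eq (1 / 2) (boseCor w₁) hx
      (mellinConvergent_boseCor h₁ (by norm_num) (by norm_num))
      (by simpa [Complex.VerticalIntegrable] using integrable_mellin_boseCor_half h₁)
      ((continuousOn_boseCor h₁).continuousAt (Ioi_mem_nhds hx))
    rw [← h, mellinInv]
    simp only [smul_eq_mul, Complex.real_smul]
    rw [mul_assoc, ← integral_mul_const]
    push_cast
    congr 2 with t
    ring
  rw [setIntegral_congr_fun measurableSet_Ioi hinv, integral_const_mul]
  congr 1
  rw [integral_integral_swap]
  · congr 1 with t
    rw [integral_mul_const, mul_comm]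
    congr 1
    rw [mellin]
    refine setIntegral_congr_fun measurableSet_Ioi fun x hx => ?_
    simp only [smul_eq_mul]
    congr 2
    push_cast
    ring
  · have hprod := (integrableOn_rpow_mul_norm_boseCor h₂).mul_prod
      (integrable_mellin_boseCor_half h₁).norm
    refine hprod.mono' ?_ ?_
    · refine AEStronglyMeasurable.mul (AEStronglyMeasurable.mul ?_ ?_) ?_
      · refine Measurable.aestronglyMeasurable ?_
        fun_prop
      · exact ((continuousOn_boseCor h₂).aestronglyMeasurable measurableSet_Ioi).comp_fst
      · exact (continuous_mellin_boseCor_half h₁).aestronglyMeasurable.comp_snd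
    · filter_upwards [Measure.quasiMeasurePreserving_fst.ae
        (ae_restrict_mem (μ := volume) (measurableSet_Ioi (a := (0 : ℝ))))] with p hp
      simp only [Function.uncurry]
      rw [norm_mul, norm_mul, Complex.norm_cpow_eq_rpow_re_of_pos hp, Complex.neg_re, re_half_add]

/-! ### The Laplace transform of |ζ|² as an integral of Bose functions on two rays -/

/-- The rotation `e^{i(π/2 - δ)} = sin δ + i cos δ`. -/
noncomputable def rayUp (δ : ℂ) : ℂ := Complex.exp (Complex.I * (Real.pi / 2 - δ))

/-- The rotation `e^{-i(π/2 - δ)} = sin δ - i cos δ`. -/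
noncomputable def rayDown (δ : ℂ) : ℂ := Complex.exp (-(Complex.I * (Real.pi / 2 - δ)))

theorem rayUp_eq (δ : ℂ) : rayUp δ = Complex.sin δ + Complex.I * Complex.cos δ := by
  rw [rayUp, mul_comm, Complex.exp_mul_I, Complex.cos_pi_div_two_sub, Complex.sin_pi_div_two_sub]
  ring

theorem rayDown_eq (δ : ℂ) : rayDown δ = Complex.sin δ - Complex.I * Complex.cos δ := by
  rw [rayDown, mul_comm, ← neg_mul, Complex.exp_mul_I, Complex.cos_neg, Complex.sin_neg,
    Complex.cos_pi_div_two_sub, Complex.sin_pi_div_two_sub]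
  ring

theorem rayUp_mul_rayDown (δ : ℂ) : rayUp δ * rayDown δ = 1 := by
  rw [rayUp, rayDown, ← Complex.exp_add, add_neg_cancel, Complex.exp_zero]

theorem rayUp_add_rayDown (δ : ℂ) : rayUp δ + rayDown δ = 2 * Complex.sin δ := by
  rw [rayUp_eq, rayDown_eq]; ring

theorem rayUp_re (δ : ℂ) : (rayUp δ).re = Real.exp δ.im * Real.sin δ.re := by
  rw [rayUp, Complex.exp_re, ← Real.cos_pi_div_two_sub]
  simp

theorem rayDown_re (δ : ℂ) : (rayDown δ).re = Real.exp (-δ.im) * Real.sin δ.re := by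
  rw [rayDown, Complex.exp_re, ← Real.cos_pi_div_two_sub, ← Real.cos_neg (Real.pi / 2 - δ.re)]
  simp

theorem norm_rayUp (δ : ℂ) : ‖rayUp δ‖ = Real.exp δ.im := by
  rw [rayUp, Complex.norm_exp]; simp

theorem norm_rayDown (δ : ℂ) : ‖rayDown δ‖ = Real.exp (-δ.im) := by
  rw [rayDown, Complex.norm_exp]; simp

theorem log_rayUp {δ : ℂ} (h0 : 0 < δ.re) (h1 : δ.re < Real.pi) :
    Complex.log (rayUp δ) = Complex.I * (Real.pi / 2 - δ) := by
  rw [rayUp, Complex.log_exp]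
  · simp; linarith
  · simp; linarith

theorem log_rayDown {δ : ℂ} (h0 : 0 < δ.re) (h1 : δ.re < Real.pi) :
    Complex.log (rayDown δ) = -(Complex.I * (Real.pi / 2 - δ)) := by
  rw [rayDown, Complex.log_exp]
  · simp; linarith
  · simp; linarith

theorem rayUp_re_pos {δ : ℂ} (h0 : 0 < δ.re) (h1 : δ.re < Real.pi) : 0 < (rayUp δ).re := by
  rw [rayUp_re]; exact mul_pos (Real.exp_pos _) (Real.sin_pos_of_pos_of_lt_pi h0 h1)

theorem rayDown_re_pos {δ : ℂ} (h0 : 0 < δ.re) (h1 : δ.re < Real.pi) : 0 < (rayDown δ).re := by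
  rw [rayDown_re]; exact mul_pos (Real.exp_pos _) (Real.sin_pos_of_pos_of_lt_pi h0 h1)

/-- The Fermi-type weight `1 / (1 + e^{-2πt})`. -/
noncomputable def fermi (t : ℝ) : ℝ := 1 / (1 + Real.exp (-(2 * Real.pi * t)))

theorem fermi_pos (t : ℝ) : 0 < fermi t := by unfold fermi; positivity

theorem half_le_fermi {t : ℝ} (ht : 0 ≤ t) : 1 / 2 ≤ fermi t := by
  unfold fermi
  have : Real.exp (-(2 * Real.pi * t)) ≤ 1 := Real.exp_le_one_iff.2 (by
    have := Real.pi_pos; have : 0 ≤ 2 * Real.pi * t := by positivity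
    linarith)
  exact one_div_le_one_div_of_le (by positivity) (by linarith)

theorem fermi_neg_le (t : ℝ) : fermi (-t) ≤ Real.exp (-(2 * Real.pi * t)) := by
  unfold fermi
  rw [mul_neg, neg_neg, Real.exp_neg, ← one_div]
  exact one_div_le_one_div_of_le (Real.exp_pos _) (by linarith)

theorem fermi_add_fermi_neg (t : ℝ) : fermi t + fermi (-t) = 1 := by
  unfold fermi
  rw [mul_neg, neg_neg, Real.exp_neg]
  have := Real.exp_pos (2 * Real.pi * t)
  field_simp
  ring

/-- The powers of the two rays combine to e^{(π - 2δ)t} and the Γζ factors to π|ζ|²/cosh(πt); then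
e^{πt}/cosh(πt) is twice `fermi t`. -/
theorem mellin_boseCor_ray_mul {δ : ℂ} (h0 : 0 < δ.re) (h1 : δ.re < Real.pi) (t : ℝ) :
    mellin (boseCor (rayUp δ)) (1 / 2 + t * Complex.I) *
        mellin (boseCor (rayDown δ)) (1 / 2 + ((-t : ℝ) : ℂ) * Complex.I) =
      2 * Real.pi * ((zetaSq t * fermi t : ℝ) * Complex.exp (-(2 * δ * t))) := by
  have hup := rayUp_re_pos h0 h1
  have hdn := rayDown_re_pos h0 h1
  rw [mellin_boseCor_half hup, mellin_boseCor_half hdn, mul_mul_mul_comm, gammaZeta_mul_neg,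
    Complex.cpow_def_of_ne_zero (ne_zero_of_re_pos hup),
    Complex.cpow_def_of_ne_zero (ne_zero_of_re_pos hdn), log_rayUp h0 h1, log_rayDown h0 h1,
    ← Complex.exp_add]
  have hE : Complex.I * (Real.pi / 2 - δ) * -(1 / 2 + t * Complex.I) +
      -(Complex.I * (Real.pi / 2 - δ)) * -(1 / 2 + ((-t : ℝ) : ℂ) * Complex.I) =
      Real.pi * t + -(2 * δ * t) := by
    push_cast
    linear_combination (-2 * (Real.pi / 2 - δ) * t) * Complex.I_sq
  rw [hE, Complex.exp_add, fermi, Complex.cosh]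
  push_cast
  have e1 : Complex.exp (-(2 * Real.pi * t)) = Complex.exp (-(Real.pi * t)) * Complex.exp (-(Real.pi * t)) := by
    rw [← Complex.exp_add]; congr 1; ring
  have e2 : Complex.exp (Real.pi * t) * Complex.exp (-(Real.pi * t)) = 1 := by
    rw [← Complex.exp_add]; simp
  have hne : Complex.exp (Real.pi * t) + Complex.exp (-(Real.pi * t)) ≠ 0 := by
    rw [← Complex.ofReal_mul, ← Complex.ofReal_neg, ← Complex.ofReal_exp, ← Complex.ofReal_exp,
      ← Complex.ofReal_add]
    exact Complex.ofReal_ne_zero.2 (by positivity)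
  have hne2 : 1 + Complex.exp (-(2 * Real.pi * t)) ≠ 0 := by
    have : (1 + Complex.exp (-(2 * Real.pi * t)) : ℂ) = ((1 + Real.exp (-(2 * Real.pi * t)) : ℝ) : ℂ) := by
      push_cast; rfl
    rw [this]
    exact Complex.ofReal_ne_zero.2 (by positivity)
  rw [e1] at hne2 ⊢
  set E := Complex.exp (Real.pi * t)
  set E' := Complex.exp (-(Real.pi * t))
  rw [← sq] at hne2 ⊢
  field_simp
  linear_combination (E' : ℂ) * zetaSq t * e2

theorem integral_boseCor_ray {δ : ℂ} (h0 : 0 < δ.re) (h1 : δ.re < Real.pi) :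
    ∫ x in Ioi (0 : ℝ), boseCor (rayUp δ) x * boseCor (rayDown δ) x =
      ∫ t : ℝ, ((zetaSq t * fermi t : ℝ) : ℂ) * Complex.exp (-(2 * δ * t)) := by
  rw [integral_boseCor_mul_boseCor (rayUp_re_pos h0 h1) (rayDown_re_pos h0 h1)]
  simp_rw [mellin_boseCor_ray_mul h0 h1]
  rw [integral_const_mul, ← mul_assoc]
  have := Real.pi_ne_zero
  have h : (1 / (2 * Real.pi) : ℂ) * (2 * Real.pi) = 1 := by
    have : (Real.pi : ℂ) ≠ 0 := mod_cast this
    field_simp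
  rw [h, one_mul]

theorem integrable_zetaSq_mul_fermi {δ : ℂ} (h0 : 0 < δ.re) (h1 : δ.re < Real.pi) :
    Integrable fun t : ℝ => ((zetaSq t * fermi t : ℝ) : ℂ) * Complex.exp (-(2 * δ * t)) := by
  have hup := rayUp_re_pos h0 h1
  have hdn := rayDown_re_pos h0 h1
  obtain ⟨C, hC⟩ := exists_norm_mellin_boseCor_le (rayDown δ)
  have h := (integrable_mellin_boseCor_half hup).mul_bdd (c := C)
    (g := fun t : ℝ => mellin (boseCor (rayDown δ)) (1 / 2 + ((-t : ℝ) : ℂ) * Complex.I))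
    ((continuous_mellin_boseCor_half hdn).comp continuous_neg).aestronglyMeasurable
    (Eventually.of_forall fun t => hC (-t))
  have h2 := h.const_mul (1 / (2 * Real.pi) : ℂ)
  refine h2.congr (Eventually.of_forall fun t => ?_)
  simp only
  rw [mellin_boseCor_ray_mul h0 h1]
  have : (Real.pi : ℂ) ≠ 0 := mod_cast Real.pi_ne_zero
  field_simp

theorem norm_ofReal_mul_cexp {a : ℝ} (ha : 0 ≤ a) (δ : ℂ) (t : ℝ) :
    ‖(a : ℂ) * Complex.exp (-(2 * δ * t))‖ = a * Real.exp (-(2 * δ.re * t)) := by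
  rw [norm_mul, norm_cexp_neg_mul, Complex.norm_real, Real.norm_of_nonneg ha]
  simp

/-- No growth bound for ζ is needed: for t > 0 the Fermi weight is at least 1/2, so the integrable
Parseval integrand at a small real δ is a majorant. -/
theorem integrableOn_zetaSq_mul_exp {c : ℝ} (hc : 0 < c) :
    IntegrableOn (fun t : ℝ => zetaSq t * Real.exp (-(c * t))) (Ioi 0) := by
  -- The cap 1 keeps δ = x below π, as the Parseval identity requires.
  set x := min (c / 2) 1 with hx
  have hx0 : 0 < x := lt_min (by linarith) one_pos
  have hx1 : x < Real.pi := (min_le_right _ _).trans_lt (by linarith [Real.pi_gt_three])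
  have h := (integrable_zetaSq_mul_fermi (δ := (x : ℂ)) (by simpa using hx0)
    (by simpa using hx1)).norm.integrableOn (s := Ioi 0)
  refine (h.const_mul 2).mono' ?_ ?_
  · exact (continuous_zetaSq.mul (by fun_prop)).aestronglyMeasurable
  · filter_upwards [ae_restrict_mem measurableSet_Ioi] with t (ht : 0 < t)
    rw [norm_ofReal_mul_cexp (mul_nonneg (zetaSq_nonneg t) (fermi_pos t).le), Real.norm_of_nonneg
      (mul_nonneg (zetaSq_nonneg t) (Real.exp_pos _).le), Complex.ofReal_re]
    have h3 : Real.exp (-(c * t)) ≤ Real.exp (-(2 * x * t)) := by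
      apply Real.exp_le_exp.2
      have : x ≤ c / 2 := min_le_left _ _
      nlinarith
    have h4 := half_le_fermi ht.le
    have h5 := zetaSq_nonneg t
    calc zetaSq t * Real.exp (-(c * t)) ≤ zetaSq t * Real.exp (-(2 * x * t)) := by gcongr
      _ = 2 * (zetaSq t * (1 / 2) * Real.exp (-(2 * x * t))) := by ring
      _ ≤ _ := by gcongr

theorem integrableOn_zetaSq_mul_cexp {δ : ℂ} (h0 : 0 < δ.re) :
    IntegrableOn (fun t : ℝ => (zetaSq t : ℂ) * Complex.exp (-(2 * δ * t))) (Ioi 0) := by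
  refine (integrableOn_zetaSq_mul_exp (c := 2 * δ.re) (by linarith)).mono' ?_ ?_
  · exact Continuous.aestronglyMeasurable
      ((Complex.continuous_ofReal.comp continuous_zetaSq).mul (by fun_prop))
  · exact Eventually.of_forall fun t => (norm_ofReal_mul_cexp (zetaSq_nonneg t) δ t).le

theorem integral_eq_integral_Ioi_add {f : ℝ → ℂ} (hf : Integrable f) :
    ∫ t, f t = (∫ t in Ioi (0 : ℝ), f t) + ∫ t in Ioi (0 : ℝ), f (-t) := by
  rw [integral_comp_neg_Ioi, neg_zero, ← setIntegral_univ, ← Iic_union_Ioi (a := (0 : ℝ)),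
    setIntegral_union (Iic_disjoint_Ioi le_rfl) measurableSet_Ioi hf.integrableOn hf.integrableOn,
    add_comm]

/-- Fold t < 0 onto t > 0, |ζ|² being even, and use that the two Fermi weights add up to 1. What is
left carries the weight `fermi (-t)`, at most e^{-2πt}. -/
theorem integral_zetaSq_mul_cexp {δ : ℂ} (h0 : 0 < δ.re) (h1 : δ.re < Real.pi) :
    ∫ t in Ioi (0 : ℝ), (zetaSq t : ℂ) * Complex.exp (-(2 * δ * t)) =
      (∫ x in Ioi (0 : ℝ), boseCor (rayUp δ) x * boseCor (rayDown δ) x) -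
      ∫ t in Ioi (0 : ℝ), ((zetaSq t * fermi (-t) : ℝ) : ℂ) *
        (Complex.exp (2 * δ * t) - Complex.exp (-(2 * δ * t))) := by
  have hi := integrable_zetaSq_mul_fermi h0 h1
  rw [integral_boseCor_ray h0 h1, integral_eq_integral_Ioi_add hi]
  have hi2 : IntegrableOn (fun t : ℝ => ((zetaSq (-t) * fermi (-t) : ℝ) : ℂ) *
      Complex.exp (-(2 * δ * ((-t : ℝ) : ℂ)))) (Ioi 0) := hi.comp_neg.integrableOn
  have hi3 := integrableOn_zetaSq_mul_cexp h0
  have hi1 := hi.integrableOn (s := Ioi 0)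
  have key : ∫ t in Ioi (0 : ℝ), ((zetaSq t * fermi (-t) : ℝ) : ℂ) *
        (Complex.exp (2 * δ * t) - Complex.exp (-(2 * δ * t))) =
      ∫ t in Ioi (0 : ℝ), ((((zetaSq t * fermi t : ℝ) : ℂ) * Complex.exp (-(2 * δ * t)) +
        ((zetaSq (-t) * fermi (-t) : ℝ) : ℂ) * Complex.exp (-(2 * δ * ((-t : ℝ) : ℂ)))) -
        (zetaSq t : ℂ) * Complex.exp (-(2 * δ * t))) := by
    congr 1 with t
    have hf : (fermi t : ℂ) = 1 - fermi (-t) := by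
      rw [eq_sub_iff_add_eq, ← Complex.ofReal_add, fermi_add_fermi_neg, Complex.ofReal_one]
    rw [zetaSq_neg]
    push_cast
    rw [hf, mul_neg, neg_neg]
    ring
  have hsub := integral_sub (hi1.add hi2) hi3
  simp only [Pi.add_apply] at hsub
  rw [key, hsub, integral_add hi1 hi2]
  ring

theorem norm_cexp_sub_cexp_neg_le (z : ℂ) :
    ‖Complex.exp z - Complex.exp (-z)‖ ≤ 2 * ‖z‖ * Real.exp ‖z‖ := by
  have h1 := Complex.norm_exp_sub_sum_le_norm_mul_exp z 1
  have h2 := Complex.norm_exp_sub_sum_le_norm_mul_exp (-z) 1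
  simp only [Finset.range_one, Finset.sum_singleton, pow_zero, Nat.factorial_zero, Nat.cast_one,
    div_one, pow_one, norm_neg] at h1 h2
  calc ‖Complex.exp z - Complex.exp (-z)‖ = ‖(Complex.exp z - 1) - (Complex.exp (-z) - 1)‖ := by
        congr 1; ring
    _ ≤ _ := (norm_sub_le _ _).trans (by linarith)

/-- The difference of exponentials is at most 4|δ| t e^{2t}, and t ≤ e^t; since 2π > 4, the weight
e^{-2πt} absorbs e^{3t} and still leaves e^{-t}. -/
theorem exists_norm_fermi_remainder_le : ∃ C : ℝ, 0 ≤ C ∧ ∀ δ : ℂ, ‖δ‖ ≤ 1 →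
    ‖∫ t in Ioi (0 : ℝ), ((zetaSq t * fermi (-t) : ℝ) : ℂ) *
        (Complex.exp (2 * δ * t) - Complex.exp (-(2 * δ * t)))‖ ≤ C * ‖δ‖ := by
  refine ⟨∫ t in Ioi (0 : ℝ), 4 * (zetaSq t * Real.exp (-(1 * t))), ?_, fun δ hδ => ?_⟩
  · exact integral_nonneg fun t => by have := zetaSq_nonneg t; positivity
  rw [← integral_mul_const]
  refine norm_integral_le_of_norm_le
    (((integrableOn_zetaSq_mul_exp one_pos).const_mul 4).mul_const _) ?_
  filter_upwards [ae_restrict_mem measurableSet_Ioi] with t (ht : 0 < t)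
  have h5 := zetaSq_nonneg t
  have h6 := (fermi_pos (-t)).le
  rw [norm_mul, Complex.norm_real, Real.norm_of_nonneg (by positivity)]
  have h7 := norm_cexp_sub_cexp_neg_le (2 * δ * t)
  have h8 : ‖2 * δ * t‖ = 2 * ‖δ‖ * t := by
    rw [norm_mul, norm_mul, Complex.norm_real, Real.norm_of_nonneg ht.le, Complex.norm_ofNat]
  rw [h8] at h7
  have h9 : 2 * ‖δ‖ * t ≤ 2 * t := by nlinarith
  have h10 : t ≤ Real.exp t := by linarith [Real.add_one_le_exp t]
  have hpi := Real.pi_gt_three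
  calc zetaSq t * fermi (-t) * ‖Complex.exp (2 * δ * t) - Complex.exp (-(2 * δ * t))‖
      ≤ zetaSq t * Real.exp (-(2 * Real.pi * t)) *
        (2 * (2 * ‖δ‖ * Real.exp t) * Real.exp (2 * t)) := by
        gcongr
        · exact fermi_neg_le t
        · refine h7.trans ?_
          gcongr
    _ = 4 * (zetaSq t * (Real.exp (-(2 * Real.pi * t)) * Real.exp t * Real.exp (2 * t))) * ‖δ‖ := by
        ring
    _ ≤ 4 * (zetaSq t * Real.exp (-(1 * t))) * ‖δ‖ := by
        rw [← Real.exp_add, ← Real.exp_add]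
        gcongr
        nlinarith

/-! ### Evaluation of the product integral and bounds for its remainders -/

/-- The addition formula behind the evaluation: on the two rays a + b = 2x sin δ, so the product of
two Bose functions is traded for one slowly decaying factor times linear terms. -/
theorem bose_mul_bose {a b : ℂ} (ha : 0 < a.re) (hb : 0 < b.re) :
    bose a * bose b = bose (a + b) * (1 + bose a + bose b) := by
  have h1 := cexp_sub_one_ne_zero ha
  have h2 := cexp_sub_one_ne_zero hb
  have h3 : Complex.exp (a + b) - 1 ≠ 0 := cexp_sub_one_ne_zero (by simp; linarith)
  rw [Complex.exp_add] at h3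
  simp only [bose, Complex.exp_add]
  field_simp
  ring

theorem continuousOn_boseReg_mul {w : ℂ} (hw : 0 < w.re) :
    ContinuousOn (fun x : ℝ => boseReg (w * x)) (Ioi 0) :=
  ((continuousOn_boseCor hw).add (continuousOn_const (c := (1 / 2 : ℂ)))).congr fun x _ => by
    simp [boseReg, boseCor]

/-- Equivalent to y/2 ≤ sinh(y/2). It keeps the 1/y singularity and exponential decay of the Bose
function in a single bound. -/
theorem mul_exp_half_le_exp_sub_one {y : ℝ} (hy : 0 ≤ y) :
    y * Real.exp (y / 2) ≤ Real.exp y - 1 := by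
  have h := Real.self_le_sinh_iff.2 (show 0 ≤ y / 2 by linarith)
  rw [Real.sinh_eq] at h
  have h1 : Real.exp y = Real.exp (y / 2) * Real.exp (y / 2) := by rw [← Real.exp_add]; congr 1; ring
  have h2 : Real.exp (y / 2) * Real.exp (-(y / 2)) = 1 := by rw [← Real.exp_add]; simp
  rw [h1]
  nlinarith [Real.exp_pos (y / 2)]

theorem integrableOn_exp_neg_mul {c : ℝ} (hc : 0 < c) :
    IntegrableOn (fun x : ℝ => Real.exp (-(c * x))) (Ioi 0) := by
  simpa [neg_mul] using integrableOn_exp_mul_Ioi (a := -c) (by linarith) 0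

theorem integrableOn_bose_mul_boseReg {w S : ℂ} (hw : 0 < w.re) (hS : 0 < S.re) :
    IntegrableOn (fun x : ℝ => bose (w * x) * boseReg (S * x)) (Ioi 0) := by
  refine ((integrableOn_exp_neg_mul (c := w.re / 2) (by linarith)).const_mul
    (‖S‖ ^ 2 / (8 * S.re) / w.re)).mono' ?_ ?_
  · exact ((continuousOn_bose_mul hw).mul (continuousOn_boseReg_mul hS)).aestronglyMeasurable
      measurableSet_Ioi
  · filter_upwards [ae_restrict_mem measurableSet_Ioi] with x (hx : 0 < x)
    have h1 := norm_bose_le (re_mul_ofReal_pos hw hx)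
    have h2 := norm_boseReg_mul_le hS hx
    rw [re_mul_ofReal] at h1
    have hy : 0 < w.re * x := by positivity
    have h3 := mul_exp_half_le_exp_sub_one hy.le
    have h4 : 1 / (Real.exp (w.re * x) - 1) ≤ 1 / (w.re * x * Real.exp (w.re * x / 2)) :=
      one_div_le_one_div_of_le (by positivity) h3
    rw [norm_mul]
    calc _ ≤ (1 / (w.re * x * Real.exp (w.re * x / 2))) * (‖S‖ ^ 2 / (8 * S.re) * x) := by
          gcongr; exact h1.trans h4
      _ = _ := by
          rw [Real.exp_neg, show w.re / 2 * x = w.re * x / 2 by ring]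
          field_simp

/-- `‖S‖ / Re S`, a measure of how far `S` is from the positive real axis. -/
noncomputable def aperture (S : ℂ) : ℝ := ‖S‖ / S.re

/-- The sum p + sS cannot cancel badly: its real part is at least s Re S, so the sum controls s‖S‖
up to the aperture, and then ‖p‖ by the triangle inequality. -/
theorem norm_add_mul_norm_le {p S : ℂ} (hp : 0 < p.re) (hS : 0 < S.re) {s : ℝ} (hs : 0 ≤ s) :
    ‖p‖ + s * ‖S‖ ≤ (1 + 2 * aperture S) * ‖p + S * s‖ := by
  have h1 : s * S.re ≤ ‖p + S * s‖ := by
    refine le_trans ?_ (Complex.re_le_norm _)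
    simp; nlinarith
  have h2 : s * ‖S‖ ≤ aperture S * ‖p + S * s‖ := by
    calc s * ‖S‖ = aperture S * (s * S.re) := by unfold aperture; field_simp
      _ ≤ _ := by
        gcongr
        unfold aperture
        positivity
  have h3 : ‖p‖ ≤ ‖p + S * s‖ + s * ‖S‖ := by
    have := norm_sub_le (p + S * s) (S * s)
    rwa [add_sub_cancel_right, norm_mul, Complex.norm_real, Real.norm_of_nonneg hs,
      mul_comm ‖S‖] at this
  linarith

theorem hasDerivAt_inv_sq {P Q : ℝ} (hQ : 0 < Q) {s : ℝ} (hs : 0 < P + s * Q) :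
    HasDerivAt (fun s : ℝ => -(1 / (2 * Q)) * ((P + s * Q) ^ 2)⁻¹) (((P + s * Q) ^ 3)⁻¹) s := by
  have h := (((((hasDerivAt_id' s).mul_const Q).const_add P).fun_pow 2).fun_inv
    (pow_ne_zero 2 hs.ne')).const_mul (-(1 / (2 * Q)))
  refine h.congr_deriv ?_
  generalize P + s * Q = y at hs
  field_simp
  norm_num

theorem integrableOn_and_integral_inv_cube {P Q : ℝ} (hP : 0 < P) (hQ : 0 < Q) :
    IntegrableOn (fun s : ℝ => ((P + s * Q) ^ 3)⁻¹) (Ioi 0) ∧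
      ∫ s in Ioi (0 : ℝ), ((P + s * Q) ^ 3)⁻¹ = 1 / (2 * Q * P ^ 2) := by
  have hpos : ∀ s ∈ Ici (0 : ℝ), 0 < P + s * Q := fun s (hs : 0 ≤ s) => by positivity
  have hd : ∀ s ∈ Ici (0 : ℝ), HasDerivAt (fun s : ℝ => -(1 / (2 * Q)) * ((P + s * Q) ^ 2)⁻¹)
      (((P + s * Q) ^ 3)⁻¹) s := fun s hs => hasDerivAt_inv_sq hQ (hpos s hs)
  have hnn : ∀ s ∈ Ioi (0 : ℝ), 0 ≤ ((P + s * Q) ^ 3)⁻¹ := fun s hs => by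
    have := hpos s (Ioi_subset_Ici_self hs); positivity
  have hlim : Tendsto (fun s : ℝ => -(1 / (2 * Q)) * ((P + s * Q) ^ 2)⁻¹) atTop (𝓝 0) := by
    have h1 : Tendsto (fun s : ℝ => P + s * Q) atTop atTop :=
      tendsto_atTop_add_const_left _ _ (tendsto_id.atTop_mul_const hQ)
    have h2 := (tendsto_inv_atTop_zero.comp ((tendsto_pow_atTop two_ne_zero).comp h1)).const_mul
      (-(1 / (2 * Q)))
    simpa using h2
  refine ⟨integrableOn_Ioi_deriv_of_nonneg' hd hnn hlim, ?_⟩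
  rw [integral_Ioi_of_hasDerivAt_of_nonneg' hd hnn hlim]
  field_simp
  simp

theorem integral_sq_mul_cexp {p : ℂ} (hp : 0 < p.re) :
    ∫ x in Ioi (0 : ℝ), (x : ℂ) ^ 2 * Complex.exp (-(p * x)) = 2 / p ^ 3 := by
  have h3 : (0 : ℝ) < (3 : ℂ).re := by simp
  have h := integral_cpow_mul_cexp_neg_mul h3 hp
  have e1 : (3 : ℂ) - 1 = ((2 : ℕ) : ℂ) := by norm_num
  have e2 : (3 : ℂ) = ((3 : ℕ) : ℂ) := by norm_num
  simp_rw [e1, Complex.cpow_natCast] at h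
  rw [h, e2, Complex.cpow_neg, Complex.cpow_natCast]
  have : Complex.Gamma ((3 : ℕ) : ℂ) = 2 := by norm_num
  rw [this]
  rfl

theorem integrable_laplace_kernel {p S : ℂ} (hp : 0 < p.re) (hS : 0 < S.re) :
    Integrable (Function.uncurry fun x s : ℝ => Complex.exp (-(p * x)) * (S * x) ^ 2 *
      ((fractKernel s : ℂ) * Complex.exp (-(S * x * s))))
      ((volume.restrict (Ioi 0)).prod (volume.restrict (Ioi 0))) := by
  have hm : Measurable (Function.uncurry fun x s : ℝ => Complex.exp (-(p * x)) * (S * x) ^ 2 *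
      ((fractKernel s : ℂ) * Complex.exp (-(S * x * s)))) := by
    unfold Function.uncurry
    fun_prop
  rw [integrable_prod_iff hm.aestronglyMeasurable]
  constructor
  · filter_upwards [ae_restrict_mem measurableSet_Ioi] with x hx
    exact (integrableOn_fractKernel_mul_cexp (re_mul_ofReal_pos hS hx)).const_mul
      (Complex.exp (-(p * x)) * (S * x) ^ 2)
  · have hi := (integrableOn_rpow_mul_exp_neg_mul (a := 1) (by norm_num) hp).const_mul
      (‖S‖ ^ 2 * (1 / 8) / S.re)
    refine hi.mono' hm.aestronglyMeasurable.norm.integral_prod_right' ?_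
    filter_upwards [ae_restrict_mem measurableSet_Ioi] with x (hx : 0 < x)
    rw [Real.norm_of_nonneg (integral_nonneg fun _ => norm_nonneg _)]
    have hre := re_mul_ofReal_pos hS hx
    have hb : ∫ s in Ioi (0 : ℝ), ‖Function.uncurry (fun x s : ℝ => Complex.exp (-(p * x)) *
        (S * x) ^ 2 * ((fractKernel s : ℂ) * Complex.exp (-(S * x * s)))) (x, s)‖ ≤
        ∫ s in Ioi (0 : ℝ), Real.exp (-(p.re * x)) * (‖S‖ * x) ^ 2 *
          (1 / 8 * Real.exp (-(S.re * x * s))) := by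
      refine integral_mono_of_nonneg (Eventually.of_forall fun _ => norm_nonneg _)
        (((integrableOn_exp_neg_mul (c := S.re * x) (by positivity)).const_mul _).const_mul _)
        (Eventually.of_forall fun s => ?_)
      simp only [Function.uncurry]
      rw [norm_mul, norm_mul, norm_mul, norm_cexp_neg_mul, norm_cexp_neg_mul, norm_pow, norm_mul,
        Complex.norm_real, Real.norm_of_nonneg hx.le, re_mul_ofReal]
      gcongr
      exact norm_fractKernel_le s
    refine hb.trans_eq ?_
    rw [integral_const_mul, integral_const_mul]
    have := integral_exp_mul_Ioi (a := -(S.re * x)) (by rw [re_mul_ofReal] at hre; linarith) 0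
    simp only [neg_mul] at this ⊢
    rw [this, Real.rpow_one]
    simp
    field_simp

/-- The Laplace transform of `boseReg` along a ray. -/
theorem integral_cexp_mul_boseReg {p S : ℂ} (hp : 0 < p.re) (hS : 0 < S.re) :
    ∫ x in Ioi (0 : ℝ), Complex.exp (-(p * x)) * boseReg (S * x) =
      ∫ s in Ioi (0 : ℝ), (fractKernel s : ℂ) * (2 * S ^ 2 / (p + S * s) ^ 3) := by
  have h1 : ∀ x ∈ Ioi (0 : ℝ), Complex.exp (-(p * x)) * boseReg (S * x) =
      ∫ s in Ioi (0 : ℝ), Complex.exp (-(p * x)) * (S * x) ^ 2 *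
      ((fractKernel s : ℂ) * Complex.exp (-(S * x * s))) := by
    intro x hx
    rw [integral_const_mul, boseReg_eq_integral (re_mul_ofReal_pos hS hx), mul_assoc]
  rw [setIntegral_congr_fun measurableSet_Ioi h1, integral_integral_swap
    (integrable_laplace_kernel hp hS)]
  refine setIntegral_congr_fun measurableSet_Ioi fun s (hs : 0 < s) => ?_
  have hre : 0 < (p + S * s).re := by
    have := re_mul_ofReal_pos hS hs
    rw [Complex.add_re]; linarith
  have h2 : ∀ x : ℝ, Complex.exp (-(p * x)) * (S * x) ^ 2 *
      ((fractKernel s : ℂ) * Complex.exp (-(S * x * s))) =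
      ((fractKernel s : ℂ) * S ^ 2) * ((x : ℂ) ^ 2 * Complex.exp (-((p + S * s) * x))) := by
    intro x
    rw [show -((p + S * s) * x) = -(p * x) + -(S * x * s) by ring, Complex.exp_add]
    ring
  simp_rw [h2]
  rw [integral_const_mul, integral_sq_mul_cexp hre]
  ring

/-- The gain is 1/‖p‖² in place of 1/(Re p)²: it is applied to multiples of a ray almost parallel to
the imaginary axis, where Re p is tiny. Only the aperture of S is paid for. -/
theorem norm_integral_cexp_mul_boseReg_le {p S : ℂ} (hp : 0 < p.re) (hS : 0 < S.re) :
    ‖∫ x in Ioi (0 : ℝ), Complex.exp (-(p * x)) * boseReg (S * x)‖ ≤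
      ‖S‖ * (1 + 2 * aperture S) ^ 3 / 8 * (1 / ‖p‖ ^ 2) := by
  have hp0 : 0 < ‖p‖ := norm_pos_iff.2 (ne_zero_of_re_pos hp)
  have hS0 : 0 < ‖S‖ := norm_pos_iff.2 (ne_zero_of_re_pos hS)
  obtain ⟨hi, hv⟩ := integrableOn_and_integral_inv_cube hp0 hS0
  set A := 1 + 2 * aperture S with hA
  have hA0 : 0 < A := by
    have : 0 ≤ aperture S := by unfold aperture; positivity
    linarith
  rw [integral_cexp_mul_boseReg hp hS]
  have hb : ‖∫ s in Ioi (0 : ℝ), (fractKernel s : ℂ) * (2 * S ^ 2 / (p + S * s) ^ 3)‖ ≤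
      ∫ s in Ioi (0 : ℝ), (‖S‖ ^ 2 * A ^ 3 / 4) * ((‖p‖ + s * ‖S‖) ^ 3)⁻¹ := by
    refine norm_integral_le_of_norm_le (hi.const_mul _) ?_
    filter_upwards [ae_restrict_mem measurableSet_Ioi] with s (hs : 0 < s)
    have h1 := norm_add_mul_norm_le hp hS hs.le
    rw [← hA] at h1
    have hpos : 0 < ‖p‖ + s * ‖S‖ := by positivity
    have h2 : 0 < ‖p + S * s‖ := by
      by_contra h
      have : ‖p + S * s‖ = 0 := le_antisymm (not_lt.1 h) (norm_nonneg _)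
      rw [this] at h1; linarith
    rw [norm_mul, norm_div, norm_mul, norm_pow, norm_pow, Complex.norm_ofNat]
    calc _ ≤ 1 / 8 * (2 * ‖S‖ ^ 2 / ‖p + S * s‖ ^ 3) := by
          gcongr; exact norm_fractKernel_le s
      _ = (‖S‖ ^ 2 * A ^ 3 / 4) * ((A * ‖p + S * s‖) ^ 3)⁻¹ := by field_simp; norm_num
      _ ≤ _ := by gcongr
  refine hb.trans_eq ?_
  rw [integral_const_mul, hv]
  field_simp
  norm_num

theorem re_natCast_mul (n : ℕ) (w : ℂ) : ((n : ℂ) * w).re = n * w.re := by simp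

/-- Expand the Bose factor in its geometric series; the n-th term is the preceding Laplace integral
at p = (n + 1)w, and ∑ 1/(n + 1)² converges. -/
theorem norm_integral_bose_mul_boseReg_le {w S : ℂ} (hw : 0 < w.re) (hS : 0 < S.re) :
    ‖∫ x in Ioi (0 : ℝ), bose (w * x) * boseReg (S * x)‖ ≤
      (∑' n : ℕ, 1 / ((n + 1 : ℕ) : ℝ) ^ 2) * (‖S‖ * (1 + 2 * aperture S) ^ 3 / (8 * ‖w‖ ^ 2)) := by
  have hre : ∀ n : ℕ, 0 < (((n + 1 : ℕ) : ℂ) * w).re := fun n => by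
    rw [re_natCast_mul]; positivity
  set f : ℕ → ℝ → ℂ := fun n x => Complex.exp (-(((n + 1 : ℕ) * w) * x)) * boseReg (S * x) with hf
  set C := ‖S‖ ^ 2 / (8 * S.re) with hC
  have hsummable : Summable fun n : ℕ => 1 / ((n + 1 : ℕ) : ℝ) ^ 2 :=
    (summable_nat_add_iff 1).2 (Real.summable_one_div_nat_pow.2 one_lt_two)
  have hbound : ∀ n, ∀ x ∈ Ioi (0 : ℝ), ‖f n x‖ ≤
      C * (x ^ (1 : ℝ) * Real.exp (-((n + 1 : ℕ) * w.re * x))) := by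
    intro n x hx
    simp only [hf]
    rw [norm_mul, norm_cexp_neg_mul, re_natCast_mul, Real.rpow_one, mul_comm]
    have := norm_boseReg_mul_le hS hx
    calc _ ≤ (C * x) * Real.exp (-((n + 1 : ℕ) * w.re * x)) := by gcongr
      _ = _ := by ring
  have hibound : ∀ n : ℕ, IntegrableOn (fun x : ℝ =>
      C * (x ^ (1 : ℝ) * Real.exp (-((n + 1 : ℕ) * w.re * x)))) (Ioi 0) := fun n =>
    (integrableOn_rpow_mul_exp_neg_mul (by norm_num) (by positivity)).const_mul _
  have hint : ∀ n, Integrable (f n) (volume.restrict (Ioi 0)) := by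
    intro n
    refine (hibound n).mono' ?_ ?_
    · refine ContinuousOn.aestronglyMeasurable ?_ measurableSet_Ioi
      exact ContinuousOn.mul (by fun_prop) (continuousOn_boseReg_mul hS)
    · filter_upwards [ae_restrict_mem measurableSet_Ioi] with x hx using hbound n x hx
  have hsum : Summable fun n => ∫ x in Ioi (0 : ℝ), ‖f n x‖ := by
    refine Summable.of_nonneg_of_le (fun n => integral_nonneg fun _ => norm_nonneg _) (fun n => ?_)
      (hsummable.mul_left (C * (w.re ^ 2)⁻¹))
    calc ∫ x in Ioi (0 : ℝ), ‖f n x‖ ≤ ∫ x in Ioi (0 : ℝ),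
          C * (x ^ (1 : ℝ) * Real.exp (-((n + 1 : ℕ) * w.re * x))) := by
          refine setIntegral_mono_on (hint n).norm (hibound n) measurableSet_Ioi fun x hx => ?_
          exact hbound n x hx
      _ = _ := by
          have := Real.integral_rpow_mul_exp_neg_mul_Ioi (a := 2) (r := (n + 1 : ℕ) * w.re)
            (by norm_num) (by positivity)
          rw [integral_const_mul]
          norm_num at this ⊢
          rw [this]
          field_simp
  have hS' := hasSum_integral_of_summable_integral_norm hint hsum
  have htsum : ∀ x ∈ Ioi (0 : ℝ), ∑' n, f n x = bose (w * x) * boseReg (S * x) := by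
    intro x hx
    have := (hasSum_bose (re_mul_ofReal_pos hw hx)).mul_right (boseReg (S * x))
    rw [← this.tsum_eq]
    simp only [hf, mul_assoc]
  rw [setIntegral_congr_fun measurableSet_Ioi htsum] at hS'
  rw [← hS'.tsum_eq]
  refine tsum_of_norm_bounded (hsummable.hasSum.mul_right _) fun n => ?_
  refine (norm_integral_cexp_mul_boseReg_le (hre n) hS).trans_eq ?_
  have hw0 : ‖w‖ ≠ 0 := norm_ne_zero_iff.2 (ne_zero_of_re_pos hw)
  rw [norm_mul, Complex.norm_natCast]
  field_simp

/-- The addition formula, regrouped so that every summand is integrable by itself. All but the two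
products `bose * boseReg` have integrals already evaluated. -/
theorem boseCor_mul_boseCor {w₁ w₂ : ℂ} (h₁ : 0 < w₁.re) (h₂ : 0 < w₂.re) (h : w₁ * w₂ = 1)
    {x : ℝ} (hx : 0 < x) :
    boseCor w₁ x * boseCor w₂ x = boseSub (w₁ + w₂) x +
      (w₁ + w₂)⁻¹ * (boseCorReg w₁ x / x) + (w₁ + w₂)⁻¹ * (boseCorReg w₂ x / x) +
      bose (w₁ * x) * boseReg ((w₁ + w₂) * x) + bose (w₂ * x) * boseReg ((w₁ + w₂) * x) -
      (1 / 2) * boseSub w₁ x - (1 / 2) * boseSub w₂ x -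
      w₁ * (boseCorReg w₁ x / x) - w₂ * (boseCorReg w₂ x / x) := by
  have hm := bose_mul_bose (re_mul_ofReal_pos h₁ hx) (re_mul_ofReal_pos h₂ hx)
  rw [← add_mul] at hm
  have hS : w₁ + w₂ ≠ 0 := ne_zero_of_re_pos (by rw [Complex.add_re]; linarith)
  have hT := inv_mul_cancel₀ hS
  have hw1 : w₁⁻¹ = w₂ := by rw [inv_eq_of_mul_eq_one_right h]
  have hw2 : w₂⁻¹ = w₁ := by rw [inv_eq_of_mul_eq_one_left h]
  simp only [boseCorReg, boseCor, boseSub, boseReg, div_eq_mul_inv, mul_inv, hw1, hw2, one_mul]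
  set T := (w₁ + w₂)⁻¹
  set r := ((x : ℂ))⁻¹
  -- The leftover multiples of 1/x² cancel because (w₁ + w₂)⁻¹(w₁ + w₂) and w₁w₂ are both 1.
  linear_combination hm + (r ^ 2) * hT - (r ^ 2) * h

theorem integral_add_four_sub_four {α : Type*} [MeasurableSpace α] {m : Measure α}
    {f₁ f₂ f₃ f₄ f₅ f₆ f₇ f₈ f₉ : α → ℂ} (h₁ : Integrable f₁ m) (h₂ : Integrable f₂ m)
    (h₃ : Integrable f₃ m) (h₄ : Integrable f₄ m) (h₅ : Integrable f₅ m) (h₆ : Integrable f₆ m)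
    (h₇ : Integrable f₇ m) (h₈ : Integrable f₈ m) (h₉ : Integrable f₉ m) :
    ∫ x, (f₁ x + f₂ x + f₃ x + f₄ x + f₅ x - f₆ x - f₇ x - f₈ x - f₉ x) ∂m =
      ∫ x, f₁ x ∂m + ∫ x, f₂ x ∂m + ∫ x, f₃ x ∂m + ∫ x, f₄ x ∂m + ∫ x, f₅ x ∂m -
        ∫ x, f₆ x ∂m - ∫ x, f₇ x ∂m - ∫ x, f₈ x ∂m - ∫ x, f₉ x ∂m := by
  change ∫ x, (f₁ + f₂ + f₃ + f₄ + f₅ - f₆ - f₇ - f₈ - f₉) x ∂m = _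
  have a₂ := h₁.add h₂
  have a₃ := a₂.add h₃
  have a₄ := a₃.add h₄
  have a₅ := a₄.add h₅
  have a₆ := a₅.sub h₆
  have a₇ := a₆.sub h₇
  have a₈ := a₇.sub h₈
  rw [integral_sub' a₈ h₉, integral_sub' a₇ h₈, integral_sub' a₆ h₇, integral_sub' a₅ h₆,
    integral_add' a₄ h₅, integral_add' a₃ h₄, integral_add' a₂ h₃, integral_add' h₁ h₂]

/-- The logarithms of the two rays are opposite. They cancel in the terms with the common factor
1/(2 sin δ), but weighted by the rays themselves they add up to (π - 2δ) cos δ, the source of the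
constant π. -/
theorem integral_boseCor_ray_eq {δ : ℂ} (h0 : 0 < δ.re) (h1 : δ.re < Real.pi) :
    ∫ x in Ioi (0 : ℝ), boseCor (rayUp δ) x * boseCor (rayDown δ) x =
      ((Real.eulerMascheroniConstant : ℂ) - Complex.log (2 * Complex.sin δ) -
        Complex.log (2 * Real.pi)) / (2 * Complex.sin δ) +
      (Complex.log (2 * Real.pi) - Real.eulerMascheroniConstant) * Complex.sin δ +
      (Real.pi - 2 * δ) * Complex.cos δ +
      (∫ x in Ioi (0 : ℝ), bose (rayUp δ * x) * boseReg (2 * Complex.sin δ * x)) +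
      ∫ x in Ioi (0 : ℝ), bose (rayDown δ * x) * boseReg (2 * Complex.sin δ * x) := by
  have hu := rayUp_re_pos h0 h1
  have hd := rayDown_re_pos h0 h1
  have hS : 0 < (rayUp δ + rayDown δ).re := by rw [Complex.add_re]; linarith
  have hlu := log_rayUp h0 h1
  have hld := log_rayDown h0 h1
  have hmul := rayUp_mul_rayDown δ
  rw [setIntegral_congr_fun measurableSet_Ioi fun x hx => boseCor_mul_boseCor hu hd hmul hx]
  have i1 := integrableOn_boseSub hS
  have i2 := (integrableOn_boseCorReg_div hu).const_mul (rayUp δ + rayDown δ)⁻¹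
  have i3 := (integrableOn_boseCorReg_div hd).const_mul (rayUp δ + rayDown δ)⁻¹
  have i4 := integrableOn_bose_mul_boseReg hu hS
  have i5 := integrableOn_bose_mul_boseReg hd hS
  have i6 := (integrableOn_boseSub hu).const_mul (1 / 2)
  have i7 := (integrableOn_boseSub hd).const_mul (1 / 2)
  have i8 := (integrableOn_boseCorReg_div hu).const_mul (rayUp δ)
  have i9 := (integrableOn_boseCorReg_div hd).const_mul (rayDown δ)
  rw [integral_add_four_sub_four i1 i2 i3 i4 i5 i6 i7 i8 i9]
  simp only [integral_const_mul]
  rw [integral_boseSub hS, integral_boseSub hu, integral_boseSub hd, integral_boseCorReg_div hu,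
    integral_boseCorReg_div hd, hlu, hld, rayUp_add_rayDown]
  have hw1 : (rayUp δ)⁻¹ = rayDown δ := by rw [inv_eq_of_mul_eq_one_right hmul]
  have hw2 : (rayDown δ)⁻¹ = rayUp δ := by rw [inv_eq_of_mul_eq_one_left hmul]
  simp only [div_eq_mul_inv, hw1, hw2]
  rw [rayUp_eq, rayDown_eq]
  linear_combination (-(Real.pi - 2 * δ) * Complex.cos δ) * Complex.I_sq

/-! ### Comparison with the mean density, uniformly in complex δ -/

/-- The mean density `ln t + 2γ - ln 2π` of `|ζ(1/2 + it)|²`. -/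
noncomputable def meanDensity (t : ℝ) : ℝ :=
  Real.log t + (2 * Real.eulerMascheroniConstant - Real.log (2 * Real.pi))

/-- The Laplace transform `(γ - ln 2π - ln z) / z` of the mean density. -/
noncomputable def meanLaplace (z : ℂ) : ℂ :=
  ((Real.eulerMascheroniConstant - Real.log (2 * Real.pi) : ℝ) - Complex.log z) / z

/-- Differentiate ∫ t^{s-1} e^{-zt} dt = Γ(s) z^{-s} at s = 1. -/
theorem integral_log_mul_cexp {z : ℂ} (hz : 0 < z.re) :
    IntegrableOn (fun t : ℝ => (Real.log t : ℂ) * Complex.exp (-(z * t))) (Ioi 0) ∧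
    ∫ t in Ioi (0 : ℝ), (Real.log t : ℂ) * Complex.exp (-(z * t)) =
      -(Real.eulerMascheroniConstant + Complex.log z) / z := by
  have hz0 := ne_zero_of_re_pos hz
  have htop : (fun t : ℝ => Complex.exp (-(z * t))) =O[atTop] (fun t : ℝ => t ^ (-2 : ℝ)) := by
    refine Asymptotics.IsBigO.trans ?_ (isLittleO_exp_neg_mul_rpow_atTop hz (-2)).isBigO
    refine Asymptotics.IsBigO.of_bound 1 (Eventually.of_forall fun t => ?_)
    rw [norm_cexp_neg_mul, Real.norm_of_nonneg (Real.exp_pos _).le, neg_mul, one_mul]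
  have hbot : (fun t : ℝ => Complex.exp (-(z * t))) =O[𝓝[>] 0] (fun t : ℝ => t ^ (-0 : ℝ)) := by
    refine isBigO_zero_of_norm_le (A := 0) (B := 1) fun t ht => ?_
    rw [norm_cexp_neg_mul, zero_mul, zero_add]
    exact Real.exp_le_one_iff.2 (by nlinarith)
  have hloc : LocallyIntegrableOn (fun t : ℝ => Complex.exp (-(z * t))) (Ioi 0) :=
    Continuous.locallyIntegrable (by fun_prop) |>.locallyIntegrableOn _
  obtain ⟨h1, h2⟩ := mellin_hasDerivAt_of_isBigO_rpow (s := 1) hloc htop (by simp) hbot (by simp)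
  have h3 : HasDerivAt (fun s : ℂ => Complex.Gamma s * z ^ (-s))
      (-(Real.eulerMascheroniConstant + Complex.log z) / z) 1 := by
    have hc : HasDerivAt (fun s : ℂ => z ^ (-s)) (z ^ (-1 : ℂ) * Complex.log z * (-1)) 1 :=
      ((hasDerivAt_id' (1 : ℂ)).fun_neg).const_cpow (Or.inl hz0)
    refine (Complex.hasDerivAt_Gamma_one.fun_mul hc).congr_deriv ?_
    rw [Complex.Gamma_one, Complex.cpow_neg_one]
    field_simp
    ring
  have h4 : mellin (fun t : ℝ => Complex.exp (-(z * t))) =ᶠ[𝓝 1]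
      (fun s : ℂ => Complex.Gamma s * z ^ (-s)) := by
    filter_upwards [(isOpen_lt continuous_const Complex.continuous_re).mem_nhds
      (show (0 : ℝ) < (1 : ℂ).re by simp)] with s hs
    exact integral_cpow_mul_cexp_neg_mul hs hz
  have h5 := h2.unique (h3.congr_of_eventuallyEq h4)
  refine ⟨?_, ?_⟩
  · simpa [MellinConvergent] using h1
  · rw [← h5]; simp [mellin]

theorem integral_meanDensity_mul_cexp {z : ℂ} (hz : 0 < z.re) :
    IntegrableOn (fun t : ℝ => (meanDensity t : ℂ) * Complex.exp (-(z * t))) (Ioi 0) ∧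
    ∫ t in Ioi (0 : ℝ), (meanDensity t : ℂ) * Complex.exp (-(z * t)) = meanLaplace z := by
  have hz0 := ne_zero_of_re_pos hz
  obtain ⟨h1, h2⟩ := integral_log_mul_cexp hz
  have h3 := (integrableOn_cexp_neg_mul hz).const_mul
    ((2 * Real.eulerMascheroniConstant - Real.log (2 * Real.pi) : ℝ) : ℂ)
  have h4 : ∫ t in Ioi (0 : ℝ), Complex.exp (-(z * t)) = 1 / z := by
    have := integral_cpow_mul_cexp_neg_mul (s := 1) (by simp) hz
    simpa [Complex.cpow_neg_one] using this
  have h5 : ∀ t : ℝ, (meanDensity t : ℂ) * Complex.exp (-(z * t)) =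
      (Real.log t : ℂ) * Complex.exp (-(z * t)) +
      ((2 * Real.eulerMascheroniConstant - Real.log (2 * Real.pi) : ℝ) : ℂ) *
        Complex.exp (-(z * t)) := fun t => by
    rw [meanDensity, Complex.ofReal_add]; ring
  simp_rw [h5]
  refine ⟨h1.add h3, ?_⟩
  rw [integral_add h1 h3, h2, integral_const_mul, h4, meanLaplace]
  push_cast
  field_simp
  ring

theorem norm_log_le_of_re_pos {z : ℂ} {y : ℝ} (hy : 0 < y) (h1 : y ≤ ‖z‖) (h2 : ‖z‖ ≤ 1) :
    ‖Complex.log z‖ ≤ 2 / √y + Real.pi := by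
  have hz : 0 < ‖z‖ := hy.trans_le h1
  have h3 : |Real.log ‖z‖| ≤ 2 / √y := by
    have h5 : Real.log ‖z‖ ≤ 0 := Real.log_nonpos hz.le h2
    rw [abs_of_nonpos h5]
    have h6 : -Real.log ‖z‖ ≤ -Real.log y := neg_le_neg (Real.log_le_log hy h1)
    have h7 := Real.log_le_rpow_div (x := y⁻¹) (by positivity) (ε := 1 / 2) (by norm_num)
    rw [Real.log_inv, ← Real.sqrt_eq_rpow, Real.sqrt_inv] at h7
    refine h6.trans (h7.trans_eq ?_)
    field_simp
  have h4 : ‖Complex.log z‖ ≤ |Real.log ‖z‖| + |z.arg| := by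
    have := Complex.norm_le_abs_re_add_abs_im (Complex.log z)
    rwa [Complex.log_re, Complex.log_im] at this
  linarith [Complex.abs_arg_le_pi z]

theorem sin_re_pos {δ : ℂ} (h0 : 0 < δ.re) (h1 : δ.re < Real.pi) : 0 < (2 * Complex.sin δ).re := by
  rw [← rayUp_add_rayDown, Complex.add_re]
  linarith [rayUp_re_pos h0 h1, rayDown_re_pos h0 h1]

theorem norm_sin_sub_le {δ : ℂ} (h : ‖δ‖ ≤ 1 / 4) : ‖2 * Complex.sin δ - 2 * δ‖ ≤ ‖δ‖ ^ 3 := by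
  have h1 := Complex.sin_bound (x := δ) (by linarith)
  have h2 : 2 * Complex.sin δ - 2 * δ = 2 * (Complex.sin δ - (δ - δ ^ 3 / 6)) - δ ^ 3 / 3 := by ring
  have h0 := norm_nonneg δ
  have h5 : ‖δ‖ ^ 5 ≤ ‖δ‖ ^ 3 := pow_le_pow_of_le_one h0 (by linarith) (by norm_num)
  rw [h2]
  calc _ ≤ ‖2 * (Complex.sin δ - (δ - δ ^ 3 / 6))‖ + ‖δ ^ 3 / 3‖ := norm_sub_le _ _
    _ ≤ 2 * (‖δ‖ ^ 5 / 100) + ‖δ‖ ^ 3 / 3 := by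
      rw [norm_mul, norm_div, norm_pow]
      simp only [Complex.norm_ofNat]
      linarith
    _ ≤ _ := by have : 0 ≤ ‖δ‖ ^ 3 := by positivity
                linarith

/-- Mean value inequality: the derivative is O(|δ|^{-5/2}) between the two points, and they differ
by at most |δ|³. -/
theorem exists_norm_meanLaplace_sub_le : ∃ C : ℝ, 0 ≤ C ∧ ∀ δ : ℂ, 0 < δ.re → ‖δ‖ ≤ 1 / 4 →
    ‖meanLaplace (2 * Complex.sin δ) - meanLaplace (2 * δ)‖ ≤ C * √‖δ‖ := by
  set c : ℝ := Real.eulerMascheroniConstant - Real.log (2 * Real.pi) with hc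
  refine ⟨3 + |c| + Real.pi, by positivity, fun δ h0 hδ => ?_⟩
  have hre : δ.re ≤ ‖δ‖ := Complex.re_le_norm δ
  have hpi := Real.pi_gt_three
  have hS := sin_re_pos h0 (by linarith)
  have hy : 0 < ‖δ‖ := by linarith
  set y := ‖δ‖ with hy_def
  have hsq : √y * √y = y := Real.mul_self_sqrt hy.le
  have hsq0 : 0 < √y := Real.sqrt_pos.2 hy
  have hsq1 : √y ≤ 1 := Real.sqrt_le_iff.2 ⟨zero_le_one, by linarith⟩
  have hy3 : y ^ 3 ≤ y := by nlinarith [sq_nonneg y]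
  have hn2 : ‖2 * δ‖ = 2 * y := by rw [norm_mul, Complex.norm_ofNat]
  -- Intersecting with the half-plane keeps the logarithm analytic; on this convex set |δ| ≤ ‖z‖ ≤
  -- 1.
  have hconv : Convex ℝ (Metric.closedBall (2 * δ) (y ^ 3) ∩ {z : ℂ | 0 < z.re}) :=
    (convex_closedBall _ _).inter (convex_halfSpace_re_gt 0)
  have hmv := hconv.norm_image_sub_le_of_norm_hasDerivWithin_le (f := meanLaplace)
    (f' := fun z => (-(1 / z) * z - ((c : ℂ) - Complex.log z) * 1) / z ^ 2)
    (x := 2 * δ) (y := 2 * Complex.sin δ) (C := (1 + |c| + (2 / √y + Real.pi)) / y ^ 2) ?_ ?_ ?_ ?_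
  · refine hmv.trans ?_
    have h3 := norm_sin_sub_le hδ
    rw [← hy_def] at h3
    have h8 : (1 + |c| + (2 / √y + Real.pi)) / y ^ 2 * y ^ 3 = (1 + |c| + Real.pi) * y + 2 * √y := by
      field_simp
      nlinarith
    calc _ ≤ (1 + |c| + (2 / √y + Real.pi)) / y ^ 2 * y ^ 3 := by gcongr
      _ = (1 + |c| + Real.pi) * y + 2 * √y := h8
      _ ≤ (1 + |c| + Real.pi) * √y + 2 * √y := by
        gcongr
        nlinarith
      _ = _ := by ring
  · rintro z ⟨_, hz : 0 < z.re⟩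
    refine HasDerivAt.hasDerivWithinAt ?_
    have hl : HasDerivAt (fun z : ℂ => (c : ℂ) - Complex.log z) (-(1 / z)) z := by
      have := (Complex.hasDerivAt_log (Or.inl hz)).const_sub (c : ℂ)
      simpa using this
    exact hl.fun_div (hasDerivAt_id' z) (ne_zero_of_re_pos hz)
  · rintro z ⟨hz1, hz : 0 < z.re⟩
    rw [Metric.mem_closedBall, dist_eq_norm] at hz1
    have hz0 := ne_zero_of_re_pos hz
    have h4 : y ≤ ‖z‖ := by
      have := norm_sub_norm_le (2 * δ) z
      rw [norm_sub_rev, hn2] at this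
      linarith
    have h5 : ‖z‖ ≤ 1 := by
      have := norm_sub_norm_le z (2 * δ)
      rw [hn2] at this
      linarith
    have h6 := norm_log_le_of_re_pos hy h4 h5
    have h7 : -(1 / z) * z = -1 := by field_simp
    rw [h7, mul_one, norm_div, norm_pow]
    have h9 : ‖-1 - ((c : ℂ) - Complex.log z)‖ ≤ 1 + |c| + (2 / √y + Real.pi) := by
      calc _ ≤ ‖(-1 : ℂ)‖ + ‖(c : ℂ) - Complex.log z‖ := norm_sub_le _ _
        _ ≤ ‖(-1 : ℂ)‖ + (‖(c : ℂ)‖ + ‖Complex.log z‖) := by gcongr; exact norm_sub_le _ _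
        _ ≤ _ := by rw [norm_neg, norm_one, Complex.norm_real, Real.norm_eq_abs]; linarith
    gcongr
  · exact ⟨Metric.mem_closedBall_self (by positivity), by simpa using h0⟩
  · refine ⟨?_, hS⟩
    rw [Metric.mem_closedBall, dist_eq_norm]
    exact norm_sin_sub_le hδ

/-- The Laplace transform of `|ζ(1/2 + it)|²` minus its mean density, at `2δ`. -/
noncomputable def laplaceError (δ : ℂ) : ℂ :=
  ∫ t in Ioi (0 : ℝ), ((zetaSq t - meanDensity t : ℝ) : ℂ) * Complex.exp (-(2 * δ * t))

theorem re_two_mul_pos {δ : ℂ} (h : 0 < δ.re) : 0 < (2 * δ).re := by simpa using h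

theorem integrableOn_error_mul_cexp {δ : ℂ} (h0 : 0 < δ.re) :
    IntegrableOn (fun t : ℝ => ((zetaSq t - meanDensity t : ℝ) : ℂ) *
      Complex.exp (-(2 * δ * t))) (Ioi 0) := by
  have h1 := (integrableOn_zetaSq_mul_cexp h0).sub
    (integral_meanDensity_mul_cexp (re_two_mul_pos h0)).1
  refine h1.congr (Eventually.of_forall fun t => ?_)
  simp only [Pi.sub_apply]
  push_cast
  ring

theorem laplaceError_eq_sub {δ : ℂ} (h0 : 0 < δ.re) :
    laplaceError δ = (∫ t in Ioi (0 : ℝ), (zetaSq t : ℂ) * Complex.exp (-(2 * δ * t))) -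
      meanLaplace (2 * δ) := by
  have h2 := integral_meanDensity_mul_cexp (re_two_mul_pos h0)
  rw [← h2.2, ← integral_sub (integrableOn_zetaSq_mul_cexp h0) h2.1, laplaceError]
  congr 1 with t
  push_cast
  ring

theorem exists_norm_bose_term_le : ∃ C : ℝ, 0 ≤ C ∧ ∀ δ : ℂ, 0 < δ.re → ‖δ‖ ≤ 1 / 4 →
    ∀ w : ℂ, 0 < w.re → 1 / 2 ≤ ‖w‖ →
    ‖∫ x in Ioi (0 : ℝ), bose (w * x) * boseReg (2 * Complex.sin δ * x)‖ ≤
      C * ‖δ‖ * (‖δ‖ / δ.re) ^ 3 := by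
  set Z := ∑' n : ℕ, 1 / ((n + 1 : ℕ) : ℝ) ^ 2
  have hZ : 0 ≤ Z := tsum_nonneg fun n => by positivity
  -- With κ = |δ|/Re δ ≥ 1: ‖2 sin δ‖ ≤ 3|δ|, its aperture is at most 3κ, so 1 + 2·(aperture) ≤ 7κ;
  -- and 8‖w‖² ≥ 2.
  refine ⟨Z * (3 * 7 ^ 3 / 2), by positivity, fun δ h0 hδ w hw hw2 => ?_⟩
  have hre : δ.re ≤ ‖δ‖ := Complex.re_le_norm δ
  have hpi := Real.pi_gt_three
  have hS := sin_re_pos h0 (by linarith)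
  have hb := norm_integral_bose_mul_boseReg_le hw hS
  have hy : 0 < ‖δ‖ := by linarith
  have hSn : ‖2 * Complex.sin δ‖ ≤ 3 * ‖δ‖ := by
    have h3 := norm_sin_sub_le hδ
    have := norm_sub_norm_le (2 * Complex.sin δ) (2 * δ)
    rw [norm_mul 2 δ, Complex.norm_ofNat] at this
    have h4 : ‖δ‖ ^ 3 ≤ ‖δ‖ := by nlinarith [sq_nonneg ‖δ‖]
    linarith
  have hSre : δ.re ≤ (2 * Complex.sin δ).re := by
    have h5 : (2 * Complex.sin δ).re = (Real.exp δ.im + Real.exp (-δ.im)) * Real.sin δ.re := by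
      rw [← rayUp_add_rayDown, Complex.add_re, rayUp_re, rayDown_re]; ring
    have h6 := Real.mul_le_sin h0.le (by linarith)
    have h7 : 2 ≤ Real.exp δ.im + Real.exp (-δ.im) := by
      have := Real.add_one_le_exp δ.im
      have := Real.add_one_le_exp (-δ.im)
      linarith
    have h8 : 1 / 2 * δ.re ≤ 2 / Real.pi * δ.re := by
      refine mul_le_mul_of_nonneg_right ?_ h0.le
      rw [div_le_div_iff₀ (by norm_num) (by positivity)]
      linarith [Real.pi_le_four]
    rw [h5]
    nlinarith
  have hap : aperture (2 * Complex.sin δ) ≤ 3 * (‖δ‖ / δ.re) := by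
    unfold aperture
    calc _ ≤ 3 * ‖δ‖ / δ.re := by gcongr
      _ = _ := by ring
  have hap0 : 0 ≤ aperture (2 * Complex.sin δ) := by unfold aperture; positivity
  have hκ : 1 ≤ ‖δ‖ / δ.re := (one_le_div h0).2 hre
  have hA : 1 + 2 * aperture (2 * Complex.sin δ) ≤ 7 * (‖δ‖ / δ.re) := by linarith
  refine hb.trans ?_
  have hw3 : 1 / 4 ≤ ‖w‖ ^ 2 := by nlinarith
  calc _ ≤ Z * (3 * ‖δ‖ * (7 * (‖δ‖ / δ.re)) ^ 3 / (8 * (1 / 4))) := by gcongr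
    _ = _ := by ring

theorem half_le_exp_of_abs_le {x : ℝ} (h : |x| ≤ 1 / 4) : 1 / 2 ≤ Real.exp x := by
  have := Real.add_one_le_exp x
  linarith [neg_le_of_abs_le h]

/-- In the exact formula every term except (π - 2δ) cos δ is small with δ. Real δ gives the limit π;
the uniformity over complex δ is what the Tauberian argument uses. -/
theorem exists_norm_laplaceError_sub_pi_le : ∃ C : ℝ, 0 ≤ C ∧ ∀ δ : ℂ, 0 < δ.re → ‖δ‖ ≤ 1 / 4 →
    ‖laplaceError δ - Real.pi‖ ≤ C * √‖δ‖ * (‖δ‖ / δ.re) ^ 3 := by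
  obtain ⟨C₁, hC₁, h₁⟩ := exists_norm_meanLaplace_sub_le
  obtain ⟨C₂, hC₂, h₂⟩ := exists_norm_bose_term_le
  obtain ⟨C₃, hC₃, h₃⟩ := exists_norm_fermi_remainder_le
  set c : ℝ := Real.log (2 * Real.pi) - Real.eulerMascheroniConstant with hc
  refine ⟨C₁ + 2 * |c| + 8 + 2 * C₂ + C₃, by positivity, fun δ h0 hδ => ?_⟩
  have hre : δ.re ≤ ‖δ‖ := Complex.re_le_norm δ
  have hpi := Real.pi_gt_three
  have hpi4 := Real.pi_le_four
  have h1 : δ.re < Real.pi := by linarith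
  have hy : 0 < ‖δ‖ := by linarith
  have him : |δ.im| ≤ 1 / 4 := (Complex.abs_im_le_norm δ).trans hδ
  have hκ : 1 ≤ ‖δ‖ / δ.re := (one_le_div h0).2 hre
  have hκ3 : 1 ≤ (‖δ‖ / δ.re) ^ 3 := one_le_pow₀ hκ
  have hsq : √‖δ‖ * √‖δ‖ = ‖δ‖ := Real.mul_self_sqrt hy.le
  have hsq1 : √‖δ‖ ≤ 1 := Real.sqrt_le_iff.2 ⟨zero_le_one, by linarith⟩
  have hsq0 := Real.sqrt_nonneg ‖δ‖
  have hyle : ‖δ‖ ≤ √‖δ‖ := by nlinarith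
  have e1 := h₁ δ h0 hδ
  have e2 := h₂ δ h0 hδ (rayUp δ) (rayUp_re_pos h0 h1) (by
    rw [norm_rayUp]; exact half_le_exp_of_abs_le him)
  have e3 := h₂ δ h0 hδ (rayDown δ) (rayDown_re_pos h0 h1) (by
    rw [norm_rayDown]; exact half_le_exp_of_abs_le (by rwa [abs_neg]))
  have e4 := h₃ δ (by linarith)
  have e5 : ‖2 * Complex.sin δ‖ ≤ 3 * ‖δ‖ := by
    have h3 := norm_sin_sub_le hδ
    have := norm_sub_norm_le (2 * Complex.sin δ) (2 * δ)
    rw [norm_mul 2 δ, Complex.norm_ofNat] at this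
    have h4 : ‖δ‖ ^ 3 ≤ ‖δ‖ := by nlinarith [sq_nonneg ‖δ‖]
    linarith
  have e6 : ‖Complex.sin δ‖ ≤ 2 * ‖δ‖ := by
    rw [norm_mul, Complex.norm_ofNat] at e5; linarith
  have e7 : ‖Complex.cos δ - 1‖ ≤ ‖δ‖ := by
    have hcb := Complex.cos_bound (x := δ) (by linarith)
    have : Complex.cos δ - 1 = (Complex.cos δ - (1 - δ ^ 2 / 2)) - δ ^ 2 / 2 := by ring
    rw [this]
    refine (norm_sub_le _ _).trans ?_
    rw [norm_div, norm_pow, Complex.norm_ofNat]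
    have h4 : ‖δ‖ ^ 4 ≤ ‖δ‖ := by
      calc ‖δ‖ ^ 4 ≤ ‖δ‖ ^ 1 := pow_le_pow_of_le_one hy.le (by linarith) (by norm_num)
        _ = _ := pow_one _
    nlinarith
  have e8 : ‖(Real.pi - 2 * δ) * Complex.cos δ - Real.pi‖ ≤ 8 * ‖δ‖ := by
    have : (Real.pi - 2 * δ) * Complex.cos δ - Real.pi =
        (Real.pi - 2 * δ) * (Complex.cos δ - 1) - 2 * δ := by ring
    rw [this]
    have h9 : ‖(Real.pi : ℂ) - 2 * δ‖ ≤ 6 := by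
      refine (norm_sub_le _ _).trans ?_
      rw [Complex.norm_real, Real.norm_of_nonneg Real.pi_pos.le, norm_mul, Complex.norm_ofNat]
      linarith
    calc _ ≤ ‖(Real.pi - 2 * δ) * (Complex.cos δ - 1)‖ + ‖2 * δ‖ := norm_sub_le _ _
      _ ≤ 6 * ‖δ‖ + 2 * ‖δ‖ := by
        rw [norm_mul, norm_mul, Complex.norm_ofNat]
        gcongr
      _ = _ := by ring
  have hdec : laplaceError δ - Real.pi =
      (meanLaplace (2 * Complex.sin δ) - meanLaplace (2 * δ)) + (c : ℂ) * Complex.sin δ +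
      ((Real.pi - 2 * δ) * Complex.cos δ - Real.pi) +
      (∫ x in Ioi (0 : ℝ), bose (rayUp δ * x) * boseReg (2 * Complex.sin δ * x)) +
      (∫ x in Ioi (0 : ℝ), bose (rayDown δ * x) * boseReg (2 * Complex.sin δ * x)) -
      ∫ t in Ioi (0 : ℝ), ((zetaSq t * fermi (-t) : ℝ) : ℂ) *
        (Complex.exp (2 * δ * t) - Complex.exp (-(2 * δ * t))) := by
    rw [laplaceError_eq_sub h0, integral_zetaSq_mul_cexp h0 h1, integral_boseCor_ray_eq h0 h1, hc]
    simp only [meanLaplace]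
    have hlog : Complex.log (2 * Real.pi) = (Real.log (2 * Real.pi) : ℂ) := by
      rw [Complex.ofReal_log (by positivity)]; push_cast; rfl
    rw [hlog]
    push_cast
    ring
  rw [hdec]
  have hcs : ‖(c : ℂ) * Complex.sin δ‖ ≤ 2 * |c| * ‖δ‖ := by
    rw [norm_mul, Complex.norm_real, Real.norm_eq_abs]
    nlinarith [abs_nonneg c]
  refine (norm_sub_le _ _).trans ?_
  have n1 := norm_add₄_le (a := (meanLaplace (2 * Complex.sin δ) - meanLaplace (2 * δ)))
    (b := (c : ℂ) * Complex.sin δ) (c := ((Real.pi - 2 * δ) * Complex.cos δ - Real.pi))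
    (d := ∫ x in Ioi (0 : ℝ), bose (rayUp δ * x) * boseReg (2 * Complex.sin δ * x))
  have n2 := (norm_add_le ((meanLaplace (2 * Complex.sin δ) - meanLaplace (2 * δ)) +
      (c : ℂ) * Complex.sin δ + ((Real.pi - 2 * δ) * Complex.cos δ - Real.pi) +
      (∫ x in Ioi (0 : ℝ), bose (rayUp δ * x) * boseReg (2 * Complex.sin δ * x)))
      (∫ x in Ioi (0 : ℝ), bose (rayDown δ * x) * boseReg (2 * Complex.sin δ * x)))
  set κ := (‖δ‖ / δ.re) ^ 3
  have m1 : C₁ * √‖δ‖ ≤ C₁ * √‖δ‖ * κ := le_mul_of_one_le_right (by positivity) hκ3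
  have m0 : ‖δ‖ ≤ √‖δ‖ * κ := hyle.trans (le_mul_of_one_le_right hsq0 hκ3)
  have m2 : 2 * |c| * ‖δ‖ ≤ 2 * |c| * (√‖δ‖ * κ) := by gcongr
  have m3 : 8 * ‖δ‖ ≤ 8 * (√‖δ‖ * κ) := by gcongr
  have m4 : C₂ * ‖δ‖ * κ ≤ C₂ * √‖δ‖ * κ := by gcongr
  have m5 : C₃ * ‖δ‖ ≤ C₃ * (√‖δ‖ * κ) := by gcongr
  have goal_eq : (C₁ + 2 * |c| + 8 + 2 * C₂ + C₃) * √‖δ‖ * κ = C₁ * √‖δ‖ * κ +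
      2 * |c| * (√‖δ‖ * κ) + 8 * (√‖δ‖ * κ) + C₂ * √‖δ‖ * κ + C₂ * √‖δ‖ * κ +
      C₃ * (√‖δ‖ * κ) := by ring
  rw [goal_eq]
  linarith

theorem abs_log_le_add_rpow {t : ℝ} (ht : 0 < t) : |Real.log t| ≤ t + 2 * t ^ (-(1 / 2) : ℝ) := by
  have h1 := Real.log_le_self ht.le
  have h2 := Real.log_le_rpow_div (x := t⁻¹) (by positivity) (ε := 1 / 2) (by norm_num)
  rw [Real.log_inv, Real.inv_rpow ht.le, ← Real.rpow_neg ht.le] at h2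
  have h3 := Real.rpow_nonneg ht.le (-(1 / 2) : ℝ)
  rw [abs_le]
  constructor <;> linarith

/-- The difference of `|ζ(1/2 + it)|²` and its mean density. -/
noncomputable def densityError (t : ℝ) : ℝ := zetaSq t - meanDensity t

theorem measurable_densityError : Measurable densityError :=
  continuous_zetaSq.measurable.sub (Real.measurable_log.add_const _)

theorem integrableOn_densityError_mul_exp {x : ℝ} (hx : 0 < x) :
    IntegrableOn (fun t => densityError t * Real.exp (-(2 * x * t))) (Ioi 0) := by
  have h := (integrableOn_error_mul_cexp (δ := x) (by simpa using hx)).norm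
  refine h.mono' (by
    exact (measurable_densityError.mul (by fun_prop)).aestronglyMeasurable) ?_
  refine Eventually.of_forall fun t => ?_
  rw [norm_mul, norm_mul, norm_cexp_neg_mul, Complex.norm_real, Real.norm_eq_abs, Real.norm_eq_abs,
    Real.abs_exp, densityError]
  simp

/-- As |ζ|² ≥ 0, the absolute value of the error exceeds the error itself by at most twice a
majorant of the mean density. So the signed Laplace transform, already bounded, controls the
absolute one. -/
theorem integral_abs_densityError_le : ∃ C : ℝ, 0 ≤ C ∧ ∀ x : ℝ, 0 < x → x ≤ 1 / 4 →
    ∫ t in Ioi (0 : ℝ), |densityError t| * Real.exp (-(2 * x * t)) ≤ C / x ^ 2 := by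
  obtain ⟨C₀, hC₀, h₀⟩ := exists_norm_laplaceError_sub_pi_le
  set c : ℝ := 2 * Real.eulerMascheroniConstant - Real.log (2 * Real.pi) with hc
  refine ⟨(Real.pi + C₀) + 2 * (1 + 4 + |c|), by positivity, fun x hx hx4 => ?_⟩
  have hpi4 := Real.pi_le_four
  have i1 : IntegrableOn (fun t : ℝ => t ^ ((2 : ℝ) - 1) * Real.exp (-(2 * x * t))) (Ioi 0) :=
    integrableOn_rpow_mul_exp_neg_mul (by norm_num) (by positivity)
  have i2 : IntegrableOn (fun t : ℝ => t ^ ((1 / 2 : ℝ) - 1) * Real.exp (-(2 * x * t))) (Ioi 0) :=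
    integrableOn_rpow_mul_exp_neg_mul (by norm_num) (by positivity)
  have i3 : IntegrableOn (fun t : ℝ => t ^ ((1 : ℝ) - 1) * Real.exp (-(2 * x * t))) (Ioi 0) :=
    integrableOn_rpow_mul_exp_neg_mul (by norm_num) (by positivity)
  have v1 := Real.integral_rpow_mul_exp_neg_mul_Ioi (a := 2) (r := 2 * x) (by norm_num) (by positivity)
  have v2 := Real.integral_rpow_mul_exp_neg_mul_Ioi (a := 1 / 2) (r := 2 * x) (by norm_num) (by positivity)
  have v3 := Real.integral_rpow_mul_exp_neg_mul_Ioi (a := 1) (r := 2 * x) (by norm_num) (by positivity)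
  have if0 := integrableOn_densityError_mul_exp hx
  have hreal : ∫ t in Ioi (0 : ℝ), densityError t * Real.exp (-(2 * x * t)) ≤ Real.pi + C₀ := by
    have e1 : laplaceError x =
        ((∫ t in Ioi (0 : ℝ), densityError t * Real.exp (-(2 * x * t)) : ℝ) : ℂ) := by
      rw [laplaceError, ← integral_complex_ofReal]
      congr 1 with t
      rw [densityError]
      push_cast
      rfl
    have e2 := h₀ x (by simpa using hx) (by
      rw [Complex.norm_real, Real.norm_of_nonneg hx.le]; exact hx4)
    rw [Complex.ofReal_re, Complex.norm_real, Real.norm_of_nonneg hx.le, div_self hx.ne', one_pow,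
      mul_one, e1, ← Complex.ofReal_sub, Complex.norm_real, Real.norm_eq_abs] at e2
    have e3 : √x ≤ 1 := Real.sqrt_le_iff.2 ⟨zero_le_one, by linarith⟩
    have e4 := le_abs_self ((∫ t in Ioi (0 : ℝ), densityError t * Real.exp (-(2 * x * t))) - Real.pi)
    nlinarith
  calc _ ≤ ∫ t in Ioi (0 : ℝ), (densityError t * Real.exp (-(2 * x * t)) +
        2 * ((t ^ ((2 : ℝ) - 1) * Real.exp (-(2 * x * t)) +
          2 * (t ^ ((1 / 2 : ℝ) - 1) * Real.exp (-(2 * x * t)))) +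
          |c| * (t ^ ((1 : ℝ) - 1) * Real.exp (-(2 * x * t))))) := by
        refine setIntegral_mono_on ?_ ?_ measurableSet_Ioi fun t (ht : 0 < t) => ?_
        · refine if0.abs.congr (Eventually.of_forall fun t => ?_)
          simp only [abs_mul, Real.abs_exp]
        · exact if0.add (((i1.add (i2.const_mul 2)).add (i3.const_mul |c|)).const_mul 2)
        · have h1 : |densityError t| ≤ densityError t +
              2 * ((t ^ ((2 : ℝ) - 1) + 2 * t ^ ((1 / 2 : ℝ) - 1)) + |c| * t ^ ((1 : ℝ) - 1)) := by
            have h2 := abs_log_le_add_rpow ht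
            have h3 : meanDensity t ≤ |Real.log t| + |c| :=
              add_le_add (le_abs_self _) (le_abs_self _)
            have h4 := zetaSq_nonneg t
            have h5 := abs_nonneg (Real.log t)
            have h6 := abs_nonneg c
            norm_num at h2 ⊢
            unfold densityError
            rw [abs_le]
            constructor <;> linarith
          calc _ ≤ _ := mul_le_mul_of_nonneg_right h1 (Real.exp_pos _).le
            _ = _ := by ring
    _ = (∫ t in Ioi (0 : ℝ), densityError t * Real.exp (-(2 * x * t))) +
        2 * (((1 / (2 * x)) ^ (2 : ℝ) * Real.Gamma 2 + 2 * ((1 / (2 * x)) ^ (1 / 2 : ℝ) *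
          Real.Gamma (1 / 2))) + |c| * ((1 / (2 * x)) ^ (1 : ℝ) * Real.Gamma 1)) := by
        have j2 := i2.const_mul 2
        have j3 := i3.const_mul |c|
        have j12 := i1.add j2
        have j123 := j12.add j3
        simp only [Pi.add_def] at j12 j123
        rw [integral_add if0 (j123.const_mul 2), integral_const_mul,
          integral_add j12 j3, integral_add i1 j2, integral_const_mul, integral_const_mul, v1, v2, v3]
    _ ≤ (Real.pi + C₀) * (1 / x ^ 2) + 2 * ((1 / x ^ 2 + 2 * (1 / x ^ 2 * 2)) + |c| * (1 / x ^ 2)) := by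
        have hy2 : 1 / (2 * x) ≤ 1 / x ^ 2 := by
          apply one_div_le_one_div_of_le (by positivity); nlinarith
        have hy1 : 1 ≤ 1 / (2 * x) := by rw [one_le_div (by positivity)]; linarith
        have hx2 : 1 ≤ 1 / x ^ 2 := hy1.trans hy2
        have p1 : (1 / (2 * x)) ^ (2 : ℝ) ≤ 1 / x ^ 2 := by
          rw [Real.rpow_two, div_pow, one_pow]
          apply one_div_le_one_div_of_le (by positivity); nlinarith
        have p2 : (1 / (2 * x)) ^ (1 / 2 : ℝ) ≤ 1 / x ^ 2 := by
          refine le_trans ?_ hy2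
          calc _ ≤ (1 / (2 * x)) ^ (1 : ℝ) := Real.rpow_le_rpow_of_exponent_le hy1 (by norm_num)
            _ = _ := Real.rpow_one _
        have p3 : √Real.pi ≤ 2 := Real.sqrt_le_iff.2 ⟨by norm_num, by linarith⟩
        rw [Real.Gamma_two, Real.Gamma_one, Real.Gamma_one_half_eq, Real.rpow_one, mul_one, mul_one]
        have hpc : Real.pi + C₀ ≤ (Real.pi + C₀) * (1 / x ^ 2) :=
          le_mul_of_one_le_right (by positivity) hx2
        gcongr
        exact hreal.trans hpc
    _ = _ := by ring

/-- Removes the restriction |δ| ≤ 1/4, because the Fourier variable below is unbounded. For |δ| >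
1/4 the absolute bound C/(Re δ)² suffices, since |δ|/Re δ then exceeds 1/(4 Re δ). -/
theorem norm_laplaceError_le : ∃ C : ℝ, 0 ≤ C ∧ ∀ δ : ℂ, 0 < δ.re → δ.re ≤ 1 / 4 →
    ‖laplaceError δ‖ ≤ C * (‖δ‖ / δ.re) ^ 3 := by
  obtain ⟨C₀, hC₀, h₀⟩ := exists_norm_laplaceError_sub_pi_le
  obtain ⟨C₁, hC₁, h₁⟩ := integral_abs_densityError_le
  refine ⟨Real.pi + C₀ + 64 * C₁, by positivity, fun δ hx hx4 => ?_⟩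
  have hre : δ.re ≤ ‖δ‖ := Complex.re_le_norm δ
  have hκ : 1 ≤ (‖δ‖ / δ.re) ^ 3 := one_le_pow₀ ((one_le_div hx).2 hre)
  have hpi := Real.pi_pos
  rcases le_or_gt ‖δ‖ (1 / 4) with hδ | hδ
  · have e1 := h₀ δ hx hδ
    have e2 : ‖laplaceError δ‖ ≤ ‖laplaceError δ - Real.pi‖ + Real.pi := by
      have := norm_add_le (laplaceError δ - Real.pi) (Real.pi : ℂ)
      rwa [sub_add_cancel, Complex.norm_real, Real.norm_of_nonneg hpi.le] at this
    have e3 : √‖δ‖ ≤ 1 := Real.sqrt_le_iff.2 ⟨zero_le_one, by linarith⟩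
    calc _ ≤ C₀ * 1 * (‖δ‖ / δ.re) ^ 3 + Real.pi * (‖δ‖ / δ.re) ^ 3 := by
          refine e2.trans (add_le_add (e1.trans (by gcongr)) ?_)
          exact le_mul_of_one_le_right hpi.le hκ
      _ ≤ _ := by
          have : 0 ≤ 64 * C₁ * (‖δ‖ / δ.re) ^ 3 := by positivity
          linarith
  · have e1 : ‖laplaceError δ‖ ≤ C₁ / δ.re ^ 2 := by
      refine le_trans ?_ (h₁ δ.re hx hx4)
      refine (norm_integral_le_integral_norm _).trans_eq ?_
      congr 1 with t
      rw [norm_mul, norm_cexp_neg_mul, Complex.norm_real, Real.norm_eq_abs, densityError]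
      simp
    have e2 : 1 / δ.re ^ 2 ≤ 64 * (‖δ‖ / δ.re) ^ 3 := by
      have : (1 / 4 / δ.re) ^ 3 ≤ (‖δ‖ / δ.re) ^ 3 := by gcongr
      have h5 : 1 / δ.re ^ 2 ≤ 1 / δ.re ^ 3 :=
        one_div_le_one_div_of_le (by positivity) (pow_le_pow_of_le_one hx.le (by linarith) (by norm_num))
      have h6 : (1 / 4 / δ.re) ^ 3 = 1 / δ.re ^ 3 / 64 := by rw [div_div, div_pow, mul_pow]; ring
      linarith
    have e3 : C₁ / δ.re ^ 2 ≤ 64 * C₁ * (‖δ‖ / δ.re) ^ 3 := by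
      calc C₁ / δ.re ^ 2 = C₁ * (1 / δ.re ^ 2) := by ring
        _ ≤ C₁ * (64 * (‖δ‖ / δ.re) ^ 3) := by gcongr
        _ = _ := by ring
    have : 0 ≤ (Real.pi + C₀) * (‖δ‖ / δ.re) ^ 3 := by positivity
    linarith

theorem tendsto_laplaceError : Tendsto (fun x : ℝ => laplaceError x) (𝓝[>] 0) (𝓝 Real.pi) := by
  obtain ⟨C₀, hC₀, h₀⟩ := exists_norm_laplaceError_sub_pi_le
  rw [tendsto_iff_norm_sub_tendsto_zero]
  have h1 : Tendsto (fun x : ℝ => C₀ * √x) (𝓝[>] 0) (𝓝 0) := by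
    have : Tendsto (fun x : ℝ => C₀ * √x) (𝓝 0) (𝓝 (C₀ * √0)) :=
      (continuous_const.mul Real.continuous_sqrt).tendsto 0
    rw [Real.sqrt_zero, mul_zero] at this
    exact this.mono_left nhdsWithin_le_nhds
  refine squeeze_zero' (Eventually.of_forall fun _ => norm_nonneg _) ?_ h1
  filter_upwards [Ioo_mem_nhdsGT (show (0 : ℝ) < 1 / 4 by norm_num)] with x hx
  have := h₀ x (by simpa using hx.1) (by
    rw [Complex.norm_real, Real.norm_of_nonneg hx.1.le]; exact hx.2.le)
  rwa [Complex.ofReal_re, Complex.norm_real, Real.norm_of_nonneg hx.1.le, div_self hx.1.ne',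
    one_pow, mul_one] at this

/-! ### The integrated error term and its Laplace transform -/

/-- The integral of the mean density over `[0, y]`. -/
noncomputable def meanIntegral (y : ℝ) : ℝ :=
  y * Real.log y + (2 * Real.eulerMascheroniConstant - Real.log (2 * Real.pi) - 1) * y

/-- The error term `∫₀^y (|ζ(1/2 + it)|² - ln t - 2γ + ln 2π) dt`. -/
noncomputable def errorIntegral (y : ℝ) : ℝ := ∫ t in (0 : ℝ)..y, densityError t

theorem intervalIntegrable_zetaSq (a b : ℝ) : IntervalIntegrable zetaSq volume a b :=
  continuous_zetaSq.intervalIntegrable _ _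

theorem intervalIntegrable_meanDensity (a b : ℝ) : IntervalIntegrable meanDensity volume a b :=
  intervalIntegral.intervalIntegrable_log'.add intervalIntegrable_const

theorem intervalIntegrable_densityError (a b : ℝ) : IntervalIntegrable densityError volume a b :=
  (intervalIntegrable_zetaSq a b).sub (intervalIntegrable_meanDensity a b)

theorem errorIntegral_eq (y : ℝ) : errorIntegral y = hardyLittlewood y - meanIntegral y := by
  unfold errorIntegral hardyLittlewood densityError
  rw [intervalIntegral.integral_sub (intervalIntegrable_zetaSq _ _)
    (intervalIntegrable_meanDensity _ _)]
  congr 1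
  unfold meanDensity meanIntegral
  rw [intervalIntegral.integral_add intervalIntegral.intervalIntegrable_log'
    intervalIntegrable_const, integral_log, intervalIntegral.integral_const]
  simp only [smul_eq_mul]
  ring

theorem continuous_errorIntegral : Continuous errorIntegral :=
  intervalIntegral.continuous_primitive intervalIntegrable_densityError 0

theorem hasDerivAt_errorIntegral {y : ℝ} (hy : 0 < y) :
    HasDerivAt errorIntegral (densityError y) y := by
  refine intervalIntegral.integral_hasDerivAt_right (intervalIntegrable_densityError _ _)
    measurable_densityError.stronglyMeasurable.stronglyMeasurableAtFilter ?_
  unfold densityError meanDensity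
  exact continuous_zetaSq.continuousAt.sub
    ((Real.continuousAt_log hy.ne').add continuousAt_const)

/-- Insert e^{2x(y - t)} ≥ 1 on t ≤ y. Every x > 0 being allowed, the error integral grows slower
than any exponential. -/
theorem abs_errorIntegral_le {x y : ℝ} (hx : 0 < x) (hy : 0 ≤ y) :
    |errorIntegral y| ≤
      (∫ t in Ioi (0 : ℝ), |densityError t| * Real.exp (-(2 * x * t))) * Real.exp (2 * x * y) := by
  have hint : IntegrableOn (fun t => |densityError t| * Real.exp (-(2 * x * t))) (Ioi 0) :=
    (integrableOn_densityError_mul_exp hx).abs.congr (Eventually.of_forall fun t => by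
      simp only [abs_mul, Real.abs_exp])
  rw [errorIntegral, intervalIntegral.integral_of_le hy, ← Real.norm_eq_abs]
  calc _ ≤ ∫ t in Ioc 0 y, |densityError t| := norm_integral_le_integral_norm _
    _ ≤ ∫ t in Ioc 0 y, |densityError t| * Real.exp (-(2 * x * t)) * Real.exp (2 * x * y) := by
      refine setIntegral_mono_on
        ((intervalIntegrable_iff_integrableOn_Ioc_of_le hy).1 (intervalIntegrable_densityError 0 y)).abs
        ((hint.mono_set Ioc_subset_Ioi_self).mul_const _) measurableSet_Ioc fun t ht => ?_
      rw [mul_assoc, ← Real.exp_add]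
      refine le_mul_of_one_le_right (abs_nonneg _) (Real.one_le_exp ?_)
      have := mul_le_mul_of_nonneg_left ht.2 hx.le
      linarith
    _ = (∫ t in Ioc 0 y, |densityError t| * Real.exp (-(2 * x * t))) * Real.exp (2 * x * y) :=
      integral_mul_const _ _
    _ ≤ _ := by
      refine mul_le_mul_of_nonneg_right ?_ (Real.exp_pos _).le
      exact setIntegral_mono_set hint (Eventually.of_forall fun t => by positivity)
        Ioc_subset_Ioi_self.eventuallyLE

theorem norm_errorIntegral_mul_cexp_le {δ : ℂ} (h0 : 0 < δ.re) :
    ∃ C : ℝ, ∀ y : ℝ, 0 ≤ y → ‖(errorIntegral y : ℂ) * Complex.exp (-(2 * δ * y))‖ ≤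
      C * Real.exp (-(δ.re * y)) := by
  refine ⟨∫ t in Ioi (0 : ℝ), |densityError t| * Real.exp (-(2 * (δ.re / 2) * t)), fun y hy => ?_⟩
  have := abs_errorIntegral_le (x := δ.re / 2) (by positivity) hy
  rw [norm_mul, norm_cexp_neg_mul, Complex.norm_real, Real.norm_eq_abs]
  calc _ ≤ _ := mul_le_mul_of_nonneg_right this (Real.exp_pos _).le
    _ = _ := by
      rw [mul_assoc, ← Real.exp_add]
      congr 2
      simp
      ring

theorem integrableOn_errorIntegral_mul_cexp {δ : ℂ} (h0 : 0 < δ.re) :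
    IntegrableOn (fun y : ℝ => (errorIntegral y : ℂ) * Complex.exp (-(2 * δ * y))) (Ioi 0) := by
  obtain ⟨C, hC⟩ := norm_errorIntegral_mul_cexp_le h0
  refine Integrable.mono' ((integrableOn_exp_neg_mul h0).const_mul C) ?_ ?_
  · refine Continuous.aestronglyMeasurable ?_
    have := continuous_errorIntegral
    fun_prop
  · filter_upwards [ae_restrict_mem measurableSet_Ioi] with y hy
    exact hC y (le_of_lt hy)

/-- Integration by parts; the boundary term at 0 vanishes with the error integral, and the one at
infinity by its subexponential growth. -/
theorem integral_errorIntegral_mul_cexp {δ : ℂ} (h0 : 0 < δ.re) :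
    ∫ y in Ioi (0 : ℝ), (errorIntegral y : ℂ) * Complex.exp (-(2 * δ * y)) =
      laplaceError δ / (2 * δ) := by
  have hδ := ne_zero_of_re_pos h0
  obtain ⟨C, hC⟩ := norm_errorIntegral_mul_cexp_le h0
  have hcont : Continuous fun y : ℝ => (errorIntegral y : ℂ) * Complex.exp (-(2 * δ * y)) := by
    have := continuous_errorIntegral
    fun_prop
  have hfun : ((fun y : ℝ => (errorIntegral y : ℂ)) *
      fun y : ℝ => -(Complex.exp (-(2 * δ * y)) / (2 * δ))) =
      fun y : ℝ => ((errorIntegral y : ℂ) * Complex.exp (-(2 * δ * y))) * (-(1 / (2 * δ))) := by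
    ext y
    simp only [Pi.mul_apply]
    ring
  have key := integral_Ioi_mul_deriv_eq_deriv_mul (a := 0) (a' := (0 : ℂ)) (b' := 0)
    (u := fun y : ℝ => (errorIntegral y : ℂ)) (u' := fun y : ℝ => (densityError y : ℂ))
    (v := fun y : ℝ => -(Complex.exp (-(2 * δ * y)) / (2 * δ)))
    (v' := fun y : ℝ => Complex.exp (-(2 * δ * y)))
    (fun y hy => (hasDerivAt_errorIntegral hy).ofReal_comp) (fun y _ => ?_)
    (integrableOn_errorIntegral_mul_cexp h0) ?_ ?_ ?_
  · rw [key, sub_zero, zero_sub, ← integral_neg, laplaceError, ← integral_div]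
    congr 1 with y
    rw [densityError]
    ring
  · have h1 : HasDerivAt (fun y : ℝ => -(2 * δ * (y : ℂ))) (-(2 * δ * 1)) y :=
      ((hasDerivAt_id' y).ofReal_comp.const_mul (2 * δ)).fun_neg
    refine (h1.cexp.div_const (2 * δ)).fun_neg.congr_deriv ?_
    field_simp
  · refine (((integrableOn_error_mul_cexp h0).mul_const (-(1 / (2 * δ)))).congr
      (Eventually.of_forall fun y => ?_))
    simp only [Pi.mul_apply, densityError]
    ring
  · rw [hfun]
    have := (hcont.mul_const (-(1 / (2 * δ)))).tendsto 0
    simp only [errorIntegral, intervalIntegral.integral_same, Complex.ofReal_zero, zero_mul] at this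
    exact this.mono_left nhdsWithin_le_nhds
  · rw [hfun, ← zero_mul (-(1 / (2 * δ)))]
    refine Tendsto.mul_const _ ?_
    refine squeeze_zero_norm' (a := fun y => C * Real.exp (-(δ.re * y))) ?_ ?_
    · filter_upwards [eventually_ge_atTop 0] with y hy using hC y hy
    · rw [← mul_zero C]
      refine Tendsto.const_mul _ (Real.tendsto_exp_atBot.comp ?_)
      exact tendsto_neg_atTop_atBot.comp (tendsto_id.const_mul_atTop h0)

/-! ### Gaussian smoothing of the error term -/

theorem ofReal_exp_neg_sq_div_two (u : ℝ) :
    ((Real.exp (-u ^ 2 / 2) : ℝ) : ℂ) =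
      ∫ η, Complex.exp (u * η * Complex.I) ∂(ProbabilityTheory.gaussianReal 0 1) := by
  rw [← charFun_apply_real, ProbabilityTheory.charFun_gaussianReal]
  push_cast
  congr 1
  ring

/-- Smoothing by a Gaussian is bounded by the Gaussian mean of the Fourier transform. -/
theorem norm_integral_mul_gaussian_le {m : Measure ℝ} [SFinite m] {H : ℝ → ℂ} (hH : Integrable H m)
    (Y σ : ℝ) :
    ‖∫ y, H y * ((Real.exp (-((y - Y) / σ) ^ 2 / 2) : ℝ) : ℂ) ∂m‖ ≤
      ∫ η, ‖∫ y, H y * Complex.exp (y / σ * η * Complex.I) ∂m‖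
        ∂(ProbabilityTheory.gaussianReal 0 1) := by
  set N := ProbabilityTheory.gaussianReal 0 1
  have hint : Integrable (Function.uncurry fun y η : ℝ =>
      H y * Complex.exp (((y - Y) / σ : ℝ) * η * Complex.I)) (m.prod N) := by
    have h1 : Integrable (fun z : ℝ × ℝ => H z.1) (m.prod N) := hH.comp_fst N
    refine h1.mono (h1.aestronglyMeasurable.mul (Continuous.aestronglyMeasurable (by fun_prop)))
      (Eventually.of_forall fun z => ?_)
    simp only [Function.uncurry]
    rw [norm_mul, ← Complex.ofReal_mul, Complex.norm_exp_ofReal_mul_I, mul_one]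
  have h2 : ∫ y, H y * ((Real.exp (-((y - Y) / σ) ^ 2 / 2) : ℝ) : ℂ) ∂m =
      ∫ η, ∫ y, H y * Complex.exp (((y - Y) / σ : ℝ) * η * Complex.I) ∂m ∂N := by
    rw [← integral_integral_swap hint]
    congr 1 with y
    rw [ofReal_exp_neg_sq_div_two, ← integral_const_mul]
  rw [h2]
  refine (norm_integral_le_integral_norm _).trans_eq ?_
  congr 1 with η
  -- The centre Y enters only through a phase of modulus 1, which leaves the y-integral.
  have h3 : ∀ y : ℝ, H y * Complex.exp (((y - Y) / σ : ℝ) * η * Complex.I) =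
      H y * Complex.exp (y / σ * η * Complex.I) * Complex.exp ((-(Y / σ * η) : ℝ) * Complex.I) := by
    intro y
    rw [mul_assoc (H y), ← Complex.exp_add]
    congr 2
    push_cast
    ring
  simp_rw [h3]
  rw [integral_mul_const, norm_mul, Complex.norm_exp_ofReal_mul_I, mul_one]

theorem integrable_one_add_abs_pow_three :
    Integrable (fun η : ℝ => (1 + |η|) ^ 3) (ProbabilityTheory.gaussianReal 0 1) := by
  have h0 : Integrable (fun η : ℝ => ‖id η‖ ^ 3) (ProbabilityTheory.gaussianReal 0 1) :=
    MemLp.integrable_norm_pow (p := 3)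
      (ProbabilityTheory.memLp_id_gaussianReal' _ (ENNReal.natCast_ne_top 3)) (by norm_num)
  refine ((h0.const_mul 4).add (integrable_const 4)).mono'
    (Continuous.aestronglyMeasurable (by fun_prop)) (Eventually.of_forall fun η => ?_)
  have h1 := abs_nonneg η
  simp only [Pi.add_apply, id_eq, Real.norm_eq_abs]
  rw [abs_of_nonneg (by positivity)]
  nlinarith [mul_nonneg (sq_nonneg (|η| - 1)) h1, sq_nonneg (|η| - 1)]

/-- Each Fourier mode is a Laplace transform at δ = 1/(2U) - iη/(2σ), where |δ|/Re δ ≤ (U/σ)(1 +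
|η|) and 1/|2δ| ≤ U. The cubic loss is averaged by the third absolute moment of the Gaussian; U ≥ 2
ensures Re δ ≤ 1/4. -/
theorem exists_abs_smoothed_errorIntegral_le : ∃ C : ℝ, 0 ≤ C ∧ ∀ U σ Y : ℝ, 2 ≤ U → 0 < σ → σ ≤ U →
    |∫ y in Ioi (0 : ℝ), errorIntegral y * Real.exp (-(y / U)) *
      Real.exp (-((y - Y) / σ) ^ 2 / 2)| ≤ C * U * (U / σ) ^ 3 := by
  obtain ⟨C, hC, h⟩ := norm_laplaceError_le
  set N := ProbabilityTheory.gaussianReal 0 1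
  have hmom : Integrable (fun η : ℝ => (1 + |η|) ^ 3) N := integrable_one_add_abs_pow_three
  refine ⟨C * ∫ η, (1 + |η|) ^ 3 ∂N, mul_nonneg hC (integral_nonneg fun η => by positivity),
    fun U σ Y hU hσ hσU => ?_⟩
  have hU0 : 0 < U := by linarith
  set d : ℝ → ℂ := fun η => ((1 / (2 * U) : ℝ) : ℂ) - ((η / (2 * σ) : ℝ) : ℂ) * Complex.I with hd
  have hdre : ∀ η, (d η).re = 1 / (2 * U) := fun η => by
    simp only [hd]
    rw [Complex.sub_re, Complex.re_ofReal_mul, Complex.I_re, mul_zero, sub_zero, Complex.ofReal_re]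
  have hd0 : ∀ η, 0 < (d η).re := fun η => by rw [hdre]; positivity
  have hH : IntegrableOn (fun y : ℝ => (errorIntegral y : ℂ) * Real.exp (-(y / U))) (Ioi 0) := by
    refine (integrableOn_errorIntegral_mul_cexp (δ := ((1 / (2 * U) : ℝ) : ℂ))
      (by rw [Complex.ofReal_re]; positivity)).congr (Eventually.of_forall fun y => ?_)
    simp only
    congr 1
    push_cast
    congr 1
    field_simp
  have hmain := norm_integral_mul_gaussian_le hH Y σ
  have hcast : ∫ y in Ioi (0 : ℝ), (errorIntegral y : ℂ) * Real.exp (-(y / U)) *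
      ((Real.exp (-((y - Y) / σ) ^ 2 / 2) : ℝ) : ℂ) =
      ((∫ y in Ioi (0 : ℝ), errorIntegral y * Real.exp (-(y / U)) *
        Real.exp (-((y - Y) / σ) ^ 2 / 2) : ℝ) : ℂ) := by
    rw [← integral_complex_ofReal]
    push_cast
    rfl
  rw [hcast, Complex.norm_real, Real.norm_eq_abs] at hmain
  refine hmain.trans ?_
  have hstep : ∀ η : ℝ, ‖∫ y in Ioi (0 : ℝ), (errorIntegral y : ℂ) * Real.exp (-(y / U)) *
      Complex.exp (y / σ * η * Complex.I)‖ ≤ C * U * (U / σ) ^ 3 * (1 + |η|) ^ 3 := by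
    intro η
    have e1 : ∫ y in Ioi (0 : ℝ), (errorIntegral y : ℂ) * Real.exp (-(y / U)) *
        Complex.exp (y / σ * η * Complex.I) = laplaceError (d η) / (2 * d η) := by
      rw [← integral_errorIntegral_mul_cexp (hd0 η)]
      congr 1 with y
      rw [mul_assoc, Complex.ofReal_exp, ← Complex.exp_add]
      congr 2
      rw [hd]
      push_cast
      field_simp
      ring
    have e2 := h (d η) (hd0 η) (by
      rw [hdre]; apply one_div_le_one_div_of_le <;> linarith)
    have e3 : 1 / U ≤ ‖2 * d η‖ := by
      have := Complex.re_le_norm (2 * d η)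
      rw [Complex.mul_re, hdre] at this
      simp only [Complex.re_ofNat, Complex.im_ofNat, zero_mul, sub_zero] at this
      refine le_of_eq_of_le ?_ this
      field_simp
    have e4 : ‖d η‖ / (d η).re ≤ (U / σ) * (1 + |η|) := by
      have e5 : ‖d η‖ ≤ 1 / (2 * U) + |η| / (2 * σ) := by
        refine (norm_sub_le _ _).trans_eq ?_
        rw [norm_mul, Complex.norm_I, mul_one, Complex.norm_real, Complex.norm_real,
          Real.norm_eq_abs, Real.norm_eq_abs, abs_of_pos (by positivity : 0 < 1 / (2 * U)), abs_div,
          abs_of_pos (by positivity : 0 < 2 * σ)]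
      rw [hdre, div_le_iff₀ (by positivity)]
      refine e5.trans ?_
      have : U / σ * (1 + |η|) * (1 / (2 * U)) = 1 / (2 * σ) + |η| / (2 * σ) := by
        field_simp
      rw [this]
      have : 1 / (2 * U) ≤ 1 / (2 * σ) := one_div_le_one_div_of_le (by positivity) (by linarith)
      linarith
    rw [e1, norm_div]
    have hpos := hd0 η
    calc _ ≤ C * (‖d η‖ / (d η).re) ^ 3 / (1 / U) := by gcongr
      _ ≤ C * (U / σ * (1 + |η|)) ^ 3 / (1 / U) := by gcongr
      _ = _ := by field_simp
  calc _ ≤ ∫ η, C * U * (U / σ) ^ 3 * (1 + |η|) ^ 3 ∂N := by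
        refine integral_mono_of_nonneg (Eventually.of_forall fun η => norm_nonneg _)
          (hmom.const_mul _) (Eventually.of_forall hstep)
    _ = _ := by rw [integral_const_mul]; ring

/-! ### Tauberian upper bound for the Hardy-Littlewood integral -/

/-- The constant `2γ - 1 - ln 2π` in the asymptotics of the Hardy-Littlewood integral. -/
noncomputable def meanConst : ℝ := 2 * Real.eulerMascheroniConstant - Real.log (2 * Real.pi) - 1

theorem hardyLittlewood_mono {a b : ℝ} (hab : a ≤ b) : hardyLittlewood a ≤ hardyLittlewood b := by
  have h := intervalIntegral.integral_add_adjacent_intervals (intervalIntegrable_zetaSq 0 a)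
    (intervalIntegrable_zetaSq a b)
  have h2 : 0 ≤ ∫ t in a..b, zetaSq t :=
    intervalIntegral.integral_nonneg hab fun t _ => zetaSq_nonneg t
  unfold hardyLittlewood
  linarith

theorem hardyLittlewood_nonneg {a : ℝ} (ha : 0 ≤ a) : 0 ≤ hardyLittlewood a :=
  intervalIntegral.integral_nonneg ha fun t _ => zetaSq_nonneg t

theorem mul_exp_neg_le (s : ℝ) : s * Real.exp (-s) ≤ Real.exp (-1) := by
  have h := Real.add_one_le_exp (s - 1)
  have h2 : Real.exp (-1) = Real.exp (s - 1) * Real.exp (-s) := by rw [← Real.exp_add]; ring_nf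
  rw [h2]
  have := Real.exp_pos (-s)
  nlinarith

theorem abs_mul_exp_neg_sub_le {s : ℝ} (hs : 0 ≤ s) :
    |s * Real.exp (-s) - Real.exp (-1)| ≤ |s - 1| := by
  have h := mul_exp_neg_le s
  rw [abs_of_nonpos (by linarith)]
  have he : Real.exp (-1) ≤ 1 := Real.exp_le_one_iff.2 (by norm_num)
  have he0 := Real.exp_pos (-1)
  have h0 : 0 ≤ s * Real.exp (-s) := mul_nonneg hs (Real.exp_pos _).le
  rcases le_or_gt 2 s with h2 | h2
  · rw [abs_of_nonneg (by linarith)]; linarith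
  · have h3 := Real.add_one_le_exp (1 - s)
    have h4 : Real.exp (-s) = Real.exp (1 - s) * Real.exp (-1) := by rw [← Real.exp_add]; ring_nf
    have h5 : (1 - (s - 1) ^ 2) * Real.exp (-1) ≤ s * Real.exp (-s) := by
      rw [h4, ← mul_assoc]
      refine mul_le_mul_of_nonneg_right ?_ he0.le
      nlinarith
    have h6 : (s - 1) ^ 2 ≤ |s - 1| := by
      rw [← sq_abs]
      have : |s - 1| ≤ 1 := abs_le.2 ⟨by linarith, by linarith⟩
      nlinarith [abs_nonneg (s - 1)]
    nlinarith [sq_nonneg (s - 1)]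

/-- With y = Us, the function s e^{-s} is at most its value e^{-1} at s = 1, so the term U ln U
produces no error. The rest is linear in |y - U| with no logarithm. -/
theorem meanIntegral_mul_exp_le {U y : ℝ} (hU : 1 ≤ U) (hy : 0 < y) :
    meanIntegral y * Real.exp (-(y / U)) ≤
      Real.exp (-1) * meanIntegral U + (1 + |meanConst|) * |y - U| := by
  have hU0 : 0 < U := by linarith
  obtain ⟨s, hs, rfl⟩ : ∃ s, 0 < s ∧ y = U * s := ⟨y / U, by positivity, by field_simp⟩
  have e1 : U * s / U = s := by field_simp
  have e2 : |U * s - U| = U * |s - 1| := by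
    rw [show U * s - U = U * (s - 1) by ring, abs_mul, abs_of_pos hU0]
  have e3 : ∀ y, meanIntegral y = y * Real.log y + meanConst * y := fun y => rfl
  rw [e1, e2, e3, e3, Real.log_mul hU0.ne' hs.ne']
  have hlog := Real.log_nonneg hU
  have he0 := Real.exp_pos (-s)
  have g1 : s * Real.exp (-s) * Real.log U ≤ Real.exp (-1) * Real.log U :=
    mul_le_mul_of_nonneg_right (mul_exp_neg_le s) hlog
  have he : Real.exp (-1) ≤ 1 := Real.exp_le_one_iff.2 (by norm_num)
  have g2 : s * Real.exp (-s) * Real.log s ≤ |s - 1| := by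
    have k1 := Real.log_le_sub_one_of_pos hs
    have k2 : 0 ≤ s * Real.exp (-s) := by positivity
    calc _ ≤ s * Real.exp (-s) * |s - 1| :=
          mul_le_mul_of_nonneg_left (k1.trans (le_abs_self _)) k2
      _ ≤ 1 * |s - 1| :=
          mul_le_mul_of_nonneg_right ((mul_exp_neg_le s).trans he) (abs_nonneg _)
      _ = _ := one_mul _
  have g3 : meanConst * (s * Real.exp (-s) - Real.exp (-1)) ≤ |meanConst| * |s - 1| := by
    refine (le_abs_self _).trans ?_
    rw [abs_mul]
    exact mul_le_mul_of_nonneg_left (abs_mul_exp_neg_sub_le hs.le) (abs_nonneg _)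
  have := mul_le_mul_of_nonneg_left (add_le_add (add_le_add g1 g2) g3) hU0.le
  linarith

theorem integral_sq_mul_gaussianPDFReal (Y : ℝ) {v : NNReal} (hv : v ≠ 0) :
    Integrable (fun y => (y - Y) ^ 2 * ProbabilityTheory.gaussianPDFReal Y v y) ∧
      ∫ y, (y - Y) ^ 2 * ProbabilityTheory.gaussianPDFReal Y v y = v := by
  have h : ∫ y, (y - Y) ^ 2 * ProbabilityTheory.gaussianPDFReal Y v y = v := by
    have h1 := ProbabilityTheory.variance_fun_id_gaussianReal (μ := Y) (v := v)
    rw [ProbabilityTheory.variance_eq_integral measurable_id'.aemeasurable,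
      ProbabilityTheory.integral_id_gaussianReal,
      ProbabilityTheory.integral_gaussianReal_eq_integral_smul hv] at h1
    rw [← h1]
    congr 1 with y
    rw [smul_eq_mul, mul_comm]
  refine ⟨?_, h⟩
  -- A non-integrable function has integral 0 by convention, whereas the variance v is nonzero.
  by_contra hn
  rw [integral_undef hn] at h
  exact hv (by exact_mod_cast h.symm)

/-- Where |y - (U + V)| ≤ V we have U ≤ y ≤ U + 2V and monotonicity of J applies; elsewhere the left
side is nonpositive. The quadratic minorant of the indicator needs only the Gaussian's second
moment. -/
theorem hardyLittlewood_mul_exp_ge {U V y : ℝ} (hU : 0 < U) (hV : 0 < V) (hy : 0 < y) :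
    hardyLittlewood U * Real.exp (-(1 + 2 * V / U)) * (1 - (y - (U + V)) ^ 2 / V ^ 2) ≤
      hardyLittlewood y * Real.exp (-(y / U)) := by
  have hJ := hardyLittlewood_nonneg hU.le
  have hJy := hardyLittlewood_nonneg hy.le
  rcases le_or_gt ((y - (U + V)) ^ 2) (V ^ 2) with h | h
  · obtain ⟨h1, h2⟩ := abs_le_of_sq_le_sq' h hV.le
    have h3 : Real.exp (-(1 + 2 * V / U)) ≤ Real.exp (-(y / U)) := by
      apply Real.exp_le_exp.2
      rw [neg_le_neg_iff, div_le_iff₀ hU]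
      field_simp
      linarith
    calc _ ≤ hardyLittlewood U * Real.exp (-(1 + 2 * V / U)) * 1 := by
          gcongr
          have : 0 ≤ (y - (U + V)) ^ 2 / V ^ 2 := by positivity
          linarith
      _ ≤ _ := by
          rw [mul_one]
          exact mul_le_mul (hardyLittlewood_mono (by linarith)) h3 (Real.exp_pos _).le hJy
  · have h4 : 1 - (y - (U + V)) ^ 2 / V ^ 2 ≤ 0 := by
      rw [sub_nonpos, one_le_div (by positivity)]; exact h.le
    have h5 : 0 ≤ hardyLittlewood U * Real.exp (-(1 + 2 * V / U)) := by positivity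
    have h6 : 0 ≤ hardyLittlewood y * Real.exp (-(y / U)) := by positivity
    nlinarith

/-- The smoothed inequality behind the upper bound for the Hardy-Littlewood integral. -/
theorem exists_hardyLittlewood_smoothed_le : ∃ A B : ℝ, 0 ≤ A ∧ 0 ≤ B ∧ ∀ U σ V : ℝ, 2 ≤ U → 0 < σ →
    σ ≤ U → 0 < V → 0 ≤ meanIntegral U →
    hardyLittlewood U * Real.exp (-(1 + 2 * V / U)) * (1 - σ ^ 2 / V ^ 2) ≤
      Real.exp (-1) * meanIntegral U + A * (V + σ) + B * U * (U / σ) ^ 3 / σ := by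
  obtain ⟨C, hC, h⟩ := exists_abs_smoothed_errorIntegral_le
  set A : ℝ := 1 + |meanConst| with hA
  have hA0 : 0 < A := by positivity
  refine ⟨A, C, hA0.le, hC, fun U σ V hU hσ hσU hV hQ => ?_⟩
  have hU0 : 0 < U := by linarith
  set Y := U + V with hY
  set v : NNReal := ⟨σ ^ 2, by positivity⟩ with hv
  have hvr : (v : ℝ) = σ ^ 2 := rfl
  have hv0 : v ≠ 0 := by
    intro h0
    have : (v : ℝ) = 0 := by rw [h0]; rfl
    rw [hvr] at this
    exact absurd this (by positivity)
  set k := ProbabilityTheory.gaussianPDFReal Y v with hk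
  have hk0 : ∀ y, 0 ≤ k y := fun y => ProbabilityTheory.gaussianPDFReal_nonneg _ _ _
  have ik : Integrable k := ProbabilityTheory.integrable_gaussianPDFReal Y v
  have vk : ∫ y, k y = 1 := ProbabilityTheory.integral_gaussianPDFReal_eq_one Y hv0
  obtain ⟨ik2, vk2⟩ := integral_sq_mul_gaussianPDFReal Y hv0
  rw [← hk] at ik2 vk2
  rw [hvr] at vk2
  set J₁ := hardyLittlewood U * Real.exp (-(1 + 2 * V / U)) with hJ₁
  have hJ₁0 : 0 ≤ J₁ := mul_nonneg (hardyLittlewood_nonneg hU0.le) (Real.exp_pos _).le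
  set Q := Real.exp (-1) * meanIntegral U with hQdef
  have hQ0 : 0 ≤ Q := mul_nonneg (Real.exp_pos _).le hQ
  -- Coefficients of a quadratic minorant a + b(y - Y)² of the damped error term; |y - Y| is made
  -- quadratic by |y - Y| ≤ (σ + (y - Y)²/σ)/2.
  set a : ℝ := J₁ - Q - A * V - A * σ / 2 with ha
  set b : ℝ := -J₁ / V ^ 2 - A / (2 * σ) with hb
  have habs : ∀ y, |y - U| ≤ V + (σ + (y - Y) ^ 2 / σ) / 2 := fun y => by
    have e1 : |y - U| ≤ |y - Y| + V := by
      have := abs_add_le (y - Y) V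
      rw [abs_of_pos hV] at this
      rwa [show y - Y + V = y - U by rw [hY]; ring] at this
    have e2 : |y - Y| ≤ (σ + (y - Y) ^ 2 / σ) / 2 := by
      rw [← sq_abs (y - Y)]
      have : (σ + |y - Y| ^ 2 / σ) / 2 - |y - Y| = (|y - Y| - σ) ^ 2 / (2 * σ) := by
        field_simp; ring
      have : 0 ≤ (|y - Y| - σ) ^ 2 / (2 * σ) := by positivity
      linarith
    linarith
  have hpos : ∀ y, 0 < y → (a + b * (y - Y) ^ 2) ≤ errorIntegral y * Real.exp (-(y / U)) := by
    intro y hy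
    have e1 := hardyLittlewood_mul_exp_ge hU0 hV hy
    have e2 := meanIntegral_mul_exp_le (by linarith : 1 ≤ U) hy
    have e3 := mul_le_mul_of_nonneg_left (habs y) hA0.le
    rw [errorIntegral_eq, sub_mul (hardyLittlewood y)]
    have e4 : a + b * (y - Y) ^ 2 = J₁ * (1 - (y - Y) ^ 2 / V ^ 2) -
        (Q + A * (V + (σ + (y - Y) ^ 2 / σ) / 2)) := by
      rw [ha, hb]; field_simp; ring
    rw [e4]
    linarith
  -- For y ≤ 0 the distance to Y = U + V exceeds V, so the minorant is nonpositive. Hence its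
  -- Gaussian mean over the whole line, known exactly, bounds the integral over y > 0 from below.
  have hneg : ∀ y, y ≤ 0 → a + b * (y - Y) ^ 2 ≤ 0 := by
    intro y hy
    have e4 : a + b * (y - Y) ^ 2 = J₁ * (1 - (y - Y) ^ 2 / V ^ 2) -
        (Q + A * (V + (σ + (y - Y) ^ 2 / σ) / 2)) := by
      rw [ha, hb]; field_simp; ring
    have e5 : 1 - (y - Y) ^ 2 / V ^ 2 ≤ 0 := by
      rw [sub_nonpos, one_le_div (by positivity)]
      nlinarith
    have e6 : 0 ≤ A * (V + (σ + (y - Y) ^ 2 / σ) / 2) := by positivity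
    rw [e4]
    nlinarith
  have ip : Integrable (fun y => (a + b * (y - Y) ^ 2) * k y) := by
    refine ((ik.const_mul a).add (ik2.const_mul b)).congr (Eventually.of_forall fun y => ?_)
    simp only [Pi.add_apply]
    ring
  have vp : ∫ y, (a + b * (y - Y) ^ 2) * k y = a + b * σ ^ 2 := by
    have : ∀ y, (a + b * (y - Y) ^ 2) * k y = a * k y + b * ((y - Y) ^ 2 * k y) := fun y => by ring
    simp_rw [this]
    rw [integral_add (ik.const_mul a) (ik2.const_mul b), integral_const_mul, integral_const_mul,
      vk, vk2, mul_one]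
  have hkform : ∀ y, k y = (σ * √(2 * Real.pi))⁻¹ * Real.exp (-((y - Y) / σ) ^ 2 / 2) := by
    intro y
    rw [hk, ProbabilityTheory.gaussianPDFReal_def, hvr]
    simp only
    rw [Real.sqrt_mul' _ (sq_nonneg σ), Real.sqrt_sq hσ.le, mul_comm (√(2 * Real.pi))]
    congr 2
    field_simp
  set E : ℝ → ℝ := fun y => errorIntegral y * Real.exp (-(y / U)) * k y with hE
  have iE : IntegrableOn E (Ioi 0) := by
    have h1 : IntegrableOn (fun y : ℝ => errorIntegral y * Real.exp (-(y / U))) (Ioi 0) := by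
      refine ((integrableOn_errorIntegral_mul_cexp (δ := ((1 / (2 * U) : ℝ) : ℂ))
        (by rw [Complex.ofReal_re]; positivity)).norm.mono' ?_ (Eventually.of_forall fun y => ?_))
      · have := continuous_errorIntegral
        exact Continuous.aestronglyMeasurable (by fun_prop)
      · rw [norm_mul, norm_mul, norm_cexp_neg_mul, Complex.norm_real, Real.norm_eq_abs (Real.exp _),
          Real.abs_exp]
        refine le_of_eq ?_
        congr 3
        rw [← Complex.ofReal_ofNat, ← Complex.ofReal_mul, Complex.ofReal_re]
        field_simp
    refine Integrable.mul_bdd (c := (σ * √(2 * Real.pi))⁻¹) h1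
      ((ProbabilityTheory.measurable_gaussianPDFReal Y v).aestronglyMeasurable)
      (Eventually.of_forall fun y => ?_)
    rw [Real.norm_of_nonneg (hk0 y), hkform]
    refine mul_le_of_le_one_right (by positivity) (Real.exp_le_one_iff.2 ?_)
    have := sq_nonneg ((y - Y) / σ)
    linarith
  have hmain : a + b * σ ^ 2 ≤ ∫ y in Ioi 0, E y := by
    rw [← vp, ← integral_add_compl measurableSet_Ioi ip (s := Ioi (0 : ℝ))]
    have s1 : ∫ y in (Ioi (0 : ℝ))ᶜ, (a + b * (y - Y) ^ 2) * k y ≤ 0 := by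
      refine setIntegral_nonpos measurableSet_Ioi.compl fun y hy => ?_
      exact mul_nonpos_of_nonpos_of_nonneg (hneg y (not_lt.1 hy)) (hk0 y)
    have s2 : ∫ y in Ioi (0 : ℝ), (a + b * (y - Y) ^ 2) * k y ≤ ∫ y in Ioi 0, E y := by
      refine setIntegral_mono_on ip.integrableOn iE measurableSet_Ioi fun y hy => ?_
      exact mul_le_mul_of_nonneg_right (hpos y hy) (hk0 y)
    linarith
  have hEle : ∫ y in Ioi 0, E y ≤ C * U * (U / σ) ^ 3 / σ := by
    have e1 : ∫ y in Ioi 0, E y = (σ * √(2 * Real.pi))⁻¹ * ∫ y in Ioi (0 : ℝ),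
        errorIntegral y * Real.exp (-(y / U)) * Real.exp (-((y - Y) / σ) ^ 2 / 2) := by
      rw [← integral_const_mul]
      congr 1 with y
      rw [hE]
      simp only
      rw [hkform]
      ring
    have e2 := (le_abs_self _).trans (h U σ Y hU hσ hσU)
    have e3 : 1 ≤ √(2 * Real.pi) := Real.one_le_sqrt.2 (by linarith [Real.pi_gt_three])
    have e4 : (σ * √(2 * Real.pi))⁻¹ ≤ σ⁻¹ := inv_anti₀ hσ (by nlinarith)
    rw [e1]
    calc _ ≤ (σ * √(2 * Real.pi))⁻¹ * (C * U * (U / σ) ^ 3) := by gcongr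
      _ ≤ σ⁻¹ * (C * U * (U / σ) ^ 3) := by gcongr
      _ = _ := by ring
  have hfin : a + b * σ ^ 2 = J₁ * (1 - σ ^ 2 / V ^ 2) - Q - A * (V + σ) := by
    rw [ha, hb]; field_simp; ring
  linarith

/-- The Hardy-Littlewood integral is at most its main term plus `o(U)`. -/
theorem eventually_hardyLittlewood_le {ε : ℝ} (hε : 0 < ε) :
    ∀ᶠ U in atTop, hardyLittlewood U ≤ meanIntegral U + ε * U := by
  obtain ⟨A, B, hA, hB, h⟩ := exists_hardyLittlewood_smoothed_le
  have hlim : Tendsto (fun u : ℝ => 3 * (20 * (Real.log u / u) + (|meanConst| + ε) / u) +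
      3 * (2 * A / u + B / u)) atTop (𝓝 0) := by
    have l1 : Tendsto (fun u : ℝ => Real.log u / u) atTop (𝓝 0) := by
      have := Real.isLittleO_log_id_atTop.tendsto_div_nhds_zero
      exact this
    have l2 : ∀ c : ℝ, Tendsto (fun u : ℝ => c / u) atTop (𝓝 0) := fun c =>
      tendsto_const_nhds.div_atTop tendsto_id
    have := ((((l1.const_mul 20).add (l2 (|meanConst| + ε))).const_mul 3).add
      (((l2 (2 * A)).add (l2 B)).const_mul 3))
    simpa using this
  -- With U = u²⁰, V = u¹⁹, σ = u¹⁸ all exponents are integers: V/U = 1/u, σ²/V² = 1/u², and the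
  -- smoothing error is B u⁸. The total loss is O(u¹⁹ ln u), hence o(U).
  have hev : ∀ᶠ u : ℝ in atTop, hardyLittlewood (u ^ 20) ≤ meanIntegral (u ^ 20) + ε * u ^ 20 := by
    filter_upwards [hlim.eventually_lt_const hε, eventually_ge_atTop 4,
      eventually_ge_atTop (Real.exp |meanConst|)] with u hu hu4 hue
    have hu0 : 0 < u := by linarith
    by_contra! hcon
    have hlogu : |meanConst| ≤ Real.log u := (Real.le_log_iff_exp_le hu0).2 hue
    have hL0 := abs_nonneg meanConst
    have hLn := neg_abs_le meanConst
    have hLp := le_abs_self meanConst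
    have em : meanIntegral (u ^ 20) = u ^ 20 * (20 * Real.log u + meanConst) := by
      unfold meanIntegral
      rw [Real.log_pow]
      push_cast
      unfold meanConst
      ring
    have hu20 : 0 < u ^ 20 := by positivity
    have hm0 : 0 ≤ meanIntegral (u ^ 20) := by
      rw [em]
      exact mul_nonneg hu20.le (by linarith)
    have h1u : 1 ≤ u := by linarith
    have hU2 : 2 ≤ u ^ 20 := by
      calc (2 : ℝ) ≤ u := by linarith
        _ = u ^ 1 := (pow_one u).symm
        _ ≤ u ^ 20 := pow_le_pow_right₀ h1u (by norm_num)
    have key := h (u ^ 20) (u ^ 18) (u ^ 19) hU2 (by positivity)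
      (pow_le_pow_right₀ h1u (by norm_num)) (by positivity) hm0
    have e1 : 2 * u ^ 19 / u ^ 20 = 2 / u := by field_simp
    have e2 : (u ^ 18) ^ 2 / (u ^ 19) ^ 2 = 1 / u ^ 2 := by field_simp
    have e3 : B * u ^ 20 * (u ^ 20 / u ^ 18) ^ 3 / u ^ 18 = B * u ^ 8 := by field_simp
    rw [e1, e2, e3] at key
    have f1 : Real.exp (-1) * (1 - 2 / u) ≤ Real.exp (-(1 + 2 / u)) := by
      rw [neg_add, Real.exp_add]
      refine mul_le_mul_of_nonneg_left ?_ (Real.exp_pos _).le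
      have := Real.add_one_le_exp (-(2 / u))
      linarith
    have hui : 1 / u ≤ 1 / 4 := one_div_le_one_div_of_le (by norm_num) hu4
    have hui0 : 0 < 1 / u := by positivity
    have h2u : 2 / u = 2 * (1 / u) := by ring
    have hsq : 1 / u ^ 2 = (1 / u) ^ 2 := by ring
    have f2 : Real.exp (-1) * (1 - 3 / u) ≤ Real.exp (-(1 + 2 / u)) * (1 - 1 / u ^ 2) := by
      calc _ ≤ Real.exp (-1) * ((1 - 2 / u) * (1 - 1 / u ^ 2)) := by
            refine mul_le_mul_of_nonneg_left ?_ (Real.exp_pos _).le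
            rw [h2u, hsq, show 3 / u = 3 * (1 / u) by ring]
            nlinarith [mul_pos hui0 hui0, mul_pos hui0 (mul_pos hui0 hui0)]
        _ = Real.exp (-1) * (1 - 2 / u) * (1 - 1 / u ^ 2) := by ring
        _ ≤ _ := by
            refine mul_le_mul_of_nonneg_right f1 ?_
            rw [hsq]; nlinarith
    set J := hardyLittlewood (u ^ 20)
    have hJ0 : 0 ≤ J := hardyLittlewood_nonneg hu20.le
    have f3 : Real.exp (-1) * (J * (1 - 3 / u)) ≤ Real.exp (-1) * meanIntegral (u ^ 20) +
        A * (u ^ 19 + u ^ 18) + B * u ^ 8 := by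
      refine le_trans ?_ key
      calc _ = J * (Real.exp (-1) * (1 - 3 / u)) := by ring
        _ ≤ J * (Real.exp (-(1 + 2 / u)) * (1 - 1 / u ^ 2)) := mul_le_mul_of_nonneg_left f2 hJ0
        _ = _ := by ring
    have f4 : A * (u ^ 19 + u ^ 18) + B * u ^ 8 ≤ u ^ 20 * (2 * A / u + B / u) := by
      have g1 : u ^ 20 * (2 * A / u + B / u) = A * (u ^ 19 + u ^ 19) + B * u ^ 19 := by
        field_simp; ring
      rw [g1]
      have g2 : u ^ 18 ≤ u ^ 19 := pow_le_pow_right₀ h1u (by norm_num)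
      have g3 : u ^ 8 ≤ u ^ 19 := pow_le_pow_right₀ h1u (by norm_num)
      gcongr
    have hR : 0 ≤ u ^ 20 * (2 * A / u + B / u) := by positivity
    -- Cancelling e^{-1} multiplies the error terms by e, which is below 3.
    have f5 : J * (1 - 3 / u) ≤ meanIntegral (u ^ 20) + 3 * (u ^ 20 * (2 * A / u + B / u)) := by
      have e3 : 1 / 3 ≤ Real.exp (-1) := by
        rw [Real.exp_neg, ← one_div]
        exact one_div_le_one_div_of_le (Real.exp_pos 1) Real.exp_one_lt_three.le
      have he0 := Real.exp_pos (-1)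
      have : Real.exp (-1) * (J * (1 - 3 / u)) ≤ Real.exp (-1) *
          (meanIntegral (u ^ 20) + 3 * (u ^ 20 * (2 * A / u + B / u))) := by
        nlinarith
      exact le_of_mul_le_mul_left this he0
    have h3u : 0 ≤ 1 - 3 / u := by rw [show 3 / u = 3 * (1 / u) by ring]; linarith
    have f6 := mul_le_mul_of_nonneg_right hcon.le h3u
    rw [em] at f6 f5
    have f7 : u ^ 20 * ε ≤ u ^ 20 * (3 * (20 * (Real.log u / u) + (|meanConst| + ε) / u) +
      3 * (2 * A / u + B / u)) := by
      have g4 : u ^ 20 * (3 * (meanConst / u)) ≤ u ^ 20 * (3 * (|meanConst| / u)) := by gcongr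
      have g5 : (u ^ 20 * (20 * Real.log u + meanConst) + ε * u ^ 20) * (1 - 3 / u) =
          u ^ 20 * (20 * Real.log u + meanConst) + u ^ 20 * ε -
          u ^ 20 * (3 * (20 * (Real.log u / u) + (meanConst + ε) / u)) := by ring
      have g6 : u ^ 20 * (3 * (20 * (Real.log u / u) + (meanConst + ε) / u)) =
        u ^ 20 * (3 * (20 * (Real.log u / u) + ε / u)) + u ^ 20 * (3 * (meanConst / u)) := by ring
      have g7 : u ^ 20 * (3 * (20 * (Real.log u / u) + (|meanConst| + ε) / u) +
          3 * (2 * A / u + B / u)) = u ^ 20 * (3 * (20 * (Real.log u / u) + ε / u)) +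
          u ^ 20 * (3 * (|meanConst| / u)) + 3 * (u ^ 20 * (2 * A / u + B / u)) := by ring
      rw [g7]
      linarith
    exact absurd (le_of_mul_le_mul_left f7 hu20) (not_le.2 hu)
  have hroot : Tendsto (fun U : ℝ => U ^ (1 / 20 : ℝ)) atTop atTop :=
    tendsto_rpow_atTop (by norm_num)
  filter_upwards [hroot.eventually hev, eventually_ge_atTop 0] with U hU hU0
  have : (U ^ (1 / 20 : ℝ)) ^ 20 = U := by
    rw [← Real.rpow_natCast, ← Real.rpow_mul hU0]
    norm_num
  rwa [this] at hU

/-! ### Asymptotics of the truncated Laplace transform -/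

/-- The main term `x ln x + (γ - ln 2π) x` of the Laplace transform at `1 / x`. -/
noncomputable def laplaceMain (x : ℝ) : ℝ :=
  x * Real.log x + (Real.eulerMascheroniConstant - Real.log (2 * Real.pi)) * x

/-- The Laplace transform of `|ζ(1/2 + it)|²`. -/
noncomputable def zetaLaplace (c : ℝ) : ℝ := ∫ t in Ioi (0 : ℝ), zetaSq t * Real.exp (-(c * t))

theorem zetaLaplace_one_div {x : ℝ} (hx : 0 < x) :
    ((zetaLaplace (1 / x) - laplaceMain x : ℝ) : ℂ) = laplaceError ((1 / (2 * x) : ℝ) : ℂ) := by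
  have h0 : 0 < (((1 / (2 * x) : ℝ) : ℂ)).re := by rw [Complex.ofReal_re]; positivity
  have e2 : (2 : ℂ) * ((1 / (2 * x) : ℝ) : ℂ) = ((1 / x : ℝ) : ℂ) := by
    push_cast; field_simp
  rw [laplaceError_eq_sub h0, e2, Complex.ofReal_sub]
  congr 1
  · rw [zetaLaplace, ← integral_complex_ofReal]
    congr 1 with t
    push_cast
    rfl
  · rw [meanLaplace, ← Complex.ofReal_log (by positivity), ← Complex.ofReal_sub,
      ← Complex.ofReal_div, Real.log_div one_ne_zero hx.ne', Real.log_one, laplaceMain]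
    congr 1
    field_simp
    ring

theorem tendsto_zetaLaplace_sub :
    Tendsto (fun x : ℝ => zetaLaplace (1 / x) - laplaceMain x) atTop (𝓝 Real.pi) := by
  have h1 : Tendsto (fun x : ℝ => 1 / (2 * x)) atTop (𝓝[>] 0) := by
    refine tendsto_nhdsWithin_iff.2 ⟨?_, ?_⟩
    · exact tendsto_const_nhds.div_atTop (tendsto_id.const_mul_atTop two_pos)
    · filter_upwards [eventually_gt_atTop 0] with x hx
      exact div_pos one_pos (mul_pos two_pos hx)
  have h2 := (Complex.continuous_re.tendsto _).comp (tendsto_laplaceError.comp h1)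
  rw [Complex.ofReal_re] at h2
  refine h2.congr' ?_
  filter_upwards [eventually_gt_atTop 0] with x hx
  simp only [Function.comp_apply]
  rw [← zetaLaplace_one_div hx, Complex.ofReal_re]

theorem Admissible.nonneg {μ : ℝ → ℝ} {y₀ : ℝ} (hμ : Admissible μ y₀) {y : ℝ} (hy : y₀ ≤ y) :
    0 ≤ μ y := by
  have h1 := hμ.one_le
  have := hμ.lower_bound y hy
  have h2 := Real.log_nonneg (h1.trans hy)
  have : 0 ≤ 7 * y * Real.log y := by
    have : 0 ≤ y := by linarith
    positivity
  linarith

theorem Admissible.pos {μ : ℝ → ℝ} {y₀ : ℝ} (hμ : Admissible μ y₀) {y : ℝ} (hy : y₀ < y) :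
    0 < μ y := by
  have h1 := hμ.one_le
  have := hμ.lower_bound y hy.le
  have h2 := Real.log_pos (h1.trans_lt hy)
  have : 0 < 7 * y * Real.log y := by
    have : 0 < y := by linarith
    positivity
  linarith

theorem continuous_zetaSq_mul_exp (y : ℝ) :
    Continuous fun t => zetaSq t * Real.exp (-(2 * t / y)) :=
  continuous_zetaSq.mul (by fun_prop)

theorem zetaSq_mul_exp_nonneg (t y : ℝ) : 0 ≤ zetaSq t * Real.exp (-(2 * t / y)) :=
  mul_nonneg (zetaSq_nonneg t) (Real.exp_pos _).le

/-- Split e^{-2t/y} into two factors e^{-t/y}. Beyond μ(y) ≥ 7y ln y one factor is at most y^{-7},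
and the other leaves the convergent transform at 1/y, whose growth is only of order y ln y. -/
theorem abs_truncatedLaplace_sub_le {μ : ℝ → ℝ} {y₀ : ℝ} (hμ : Admissible μ y₀) {y : ℝ}
    (hy : y₀ ≤ y) :
    |truncatedLaplace μ y - zetaLaplace (2 / y)| ≤ zetaLaplace (1 / y) / y ^ 7 := by
  have hy1 : 1 ≤ y := hμ.one_le.trans hy
  have hy0 : 0 < y := by linarith
  have hm := hμ.nonneg hy
  have i2 : IntegrableOn (fun t => zetaSq t * Real.exp (-(2 / y * t))) (Ioi 0) :=
    integrableOn_zetaSq_mul_exp (by positivity)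
  have i1 : IntegrableOn (fun t => zetaSq t * Real.exp (-(1 / y * t))) (Ioi 0) :=
    integrableOn_zetaSq_mul_exp (by positivity)
  have e1 : truncatedLaplace μ y = ∫ t in Ioc 0 (μ y), zetaSq t * Real.exp (-(2 / y * t)) := by
    rw [truncatedLaplace, intervalIntegral.integral_of_le hm]
    congr 1 with t
    congr 3
    ring
  have e2 : zetaLaplace (2 / y) = (∫ t in Ioc 0 (μ y), zetaSq t * Real.exp (-(2 / y * t))) +
      ∫ t in Ioi (μ y), zetaSq t * Real.exp (-(2 / y * t)) := by
    rw [zetaLaplace, ← Ioc_union_Ioi_eq_Ioi hm]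
    exact setIntegral_union (Ioc_disjoint_Ioi le_rfl) measurableSet_Ioi
      (i2.mono_set Ioc_subset_Ioi_self) (i2.mono_set (Ioi_subset_Ioi hm))
  have e3 : 0 ≤ ∫ t in Ioi (μ y), zetaSq t * Real.exp (-(2 / y * t)) :=
    integral_nonneg fun t => mul_nonneg (zetaSq_nonneg t) (Real.exp_pos _).le
  rw [e1, e2, sub_add_cancel_left, abs_neg, abs_of_nonneg e3]
  have hexp : Real.exp (-(μ y / y)) ≤ 1 / y ^ 7 := by
    have h1 : 7 * Real.log y ≤ μ y / y := by
      rw [le_div_iff₀ hy0]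
      linarith [hμ.lower_bound y hy]
    calc _ ≤ Real.exp (-(7 * Real.log y)) := Real.exp_le_exp.2 (neg_le_neg h1)
      _ = _ := by
        rw [Real.exp_neg, show 7 * Real.log y = Real.log (y ^ 7) by rw [Real.log_pow]; norm_num,
          Real.exp_log (by positivity), one_div]
  calc _ ≤ ∫ t in Ioi (μ y), 1 / y ^ 7 * (zetaSq t * Real.exp (-(1 / y * t))) := by
        refine setIntegral_mono_on (i2.mono_set (Ioi_subset_Ioi hm))
          ((i1.mono_set (Ioi_subset_Ioi hm)).const_mul _) measurableSet_Ioi fun t ht => ?_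
        have h1 : Real.exp (-(2 / y * t)) = Real.exp (-(t / y)) * Real.exp (-(1 / y * t)) := by
          rw [← Real.exp_add]; congr 1; ring
        have h2 : Real.exp (-(t / y)) ≤ 1 / y ^ 7 := by
          refine le_trans (Real.exp_le_exp.2 (neg_le_neg ?_)) hexp
          exact div_le_div_of_nonneg_right (le_of_lt ht) hy0.le
        have h3 : 0 ≤ zetaSq t * Real.exp (-(1 / y * t)) :=
          mul_nonneg (zetaSq_nonneg t) (Real.exp_pos _).le
        rw [h1]
        calc _ = Real.exp (-(t / y)) * (zetaSq t * Real.exp (-(1 / y * t))) := by ring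
          _ ≤ _ := mul_le_mul_of_nonneg_right h2 h3
    _ = 1 / y ^ 7 * ∫ t in Ioi (μ y), zetaSq t * Real.exp (-(1 / y * t)) := integral_const_mul _ _
    _ ≤ 1 / y ^ 7 * zetaLaplace (1 / y) := by
        refine mul_le_mul_of_nonneg_left ?_ (by positivity)
        exact setIntegral_mono_set i1 (Eventually.of_forall fun t =>
          mul_nonneg (zetaSq_nonneg t) (Real.exp_pos _).le) (Ioi_subset_Ioi hm).eventuallyLE
    _ = _ := by ring

theorem tendsto_truncatedLaplace_sub {μ : ℝ → ℝ} {y₀ : ℝ} (hμ : Admissible μ y₀) :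
    Tendsto (fun x : ℝ => truncatedLaplace μ (2 * x) - laplaceMain x) atTop (𝓝 Real.pi) := by
  have htail : Tendsto (fun y : ℝ => zetaLaplace (1 / y) / y ^ 7) atTop (𝓝 0) := by
    have h1 : Tendsto (fun y : ℝ => (zetaLaplace (1 / y) - laplaceMain y) / y ^ 7) atTop (𝓝 0) :=
      tendsto_zetaLaplace_sub.div_atTop (tendsto_pow_atTop (by norm_num))
    have h2 : Tendsto (fun y : ℝ => laplaceMain y / y ^ 7) atTop (𝓝 0) := by
      have l1 : Tendsto (fun u : ℝ => Real.log u / u) atTop (𝓝 0) :=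
        Real.isLittleO_log_id_atTop.tendsto_div_nhds_zero
      have l2 : Tendsto (fun u : ℝ => 1 / u) atTop (𝓝 0) :=
        tendsto_const_nhds.div_atTop tendsto_id
      have l3 := (l1.mul (l2.pow 5)).add ((l2.pow 6).const_mul
        (Real.eulerMascheroniConstant - Real.log (2 * Real.pi)))
      simp only [ne_eq, OfNat.ofNat_ne_zero, not_false_eq_true, zero_pow, mul_zero, add_zero] at l3
      refine l3.congr' ?_
      filter_upwards [eventually_gt_atTop 0] with u hu
      rw [laplaceMain]
      field_simp
    have := h1.add h2
    rw [add_zero] at this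
    refine this.congr fun y => ?_
    ring
  have h2x : Tendsto (fun x : ℝ => 2 * x) atTop atTop := tendsto_id.const_mul_atTop two_pos
  have hdiff : Tendsto (fun x : ℝ => truncatedLaplace μ (2 * x) - zetaLaplace (2 / (2 * x))) atTop
      (𝓝 0) := by
    refine squeeze_zero_norm' ?_ (htail.comp h2x)
    filter_upwards [h2x.eventually (eventually_ge_atTop y₀)] with x hx
    exact abs_truncatedLaplace_sub_le hμ hx
  have := hdiff.add tendsto_zetaLaplace_sub
  rw [zero_add] at this
  refine this.congr' ?_
  filter_upwards [eventually_gt_atTop 0] with x hx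
  rw [show 2 / (2 * x) = 1 / x by field_simp]
  ring

/-! ### Invertibility of the ladder and its reverse iterates -/

/-- A compact set contains only finitely many zeros of ζ, while the segment is infinite. -/
theorem exists_zetaSq_pos {b : ℝ} (hb : 0 < b) : ∃ c ∈ Ioc 0 b, 0 < zetaSq c := by
  by_contra! hcon
  have hz : ∀ c ∈ Ioc 0 b, riemannZeta (1 / 2 + (c : ℂ) * Complex.I) = 0 := fun c hc => by
    have h1 := hcon c hc
    have h2 : zetaSq c = 0 := le_antisymm h1 (zetaSq_nonneg c)
    unfold zetaSq at h2
    exact norm_eq_zero.1 (pow_eq_zero_iff two_ne_zero |>.1 h2)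
  set g : ℝ → ℂ := fun t => 1 / 2 + (t : ℂ) * Complex.I with hg
  have hgc : Continuous g := by fun_prop
  have hinj : Function.Injective g := fun s t hst => by
    have := congrArg Complex.im hst
    simpa [hg] using this
  have hfin := (isCompact_Icc.image hgc : IsCompact (g '' Icc 0 b)).inter_riemannZetaZeros_finite
  have hsub : g '' Ioc 0 b ⊆ g '' Icc 0 b ∩ riemannZetaZeros := by
    rintro _ ⟨c, hc, rfl⟩
    exact ⟨⟨c, Ioc_subset_Icc_self hc, rfl⟩, mem_riemannZetaZeros.2 (hz c hc)⟩
  exact (Ioc_infinite hb) ((hfin.subset hsub).of_finite_image hinj.injOn)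

/-- Raising the upper limit gives only a weak inequality. Strictness comes from the weight
e^{-2t/y}, which increases with y, at a point where ζ does not vanish. -/
theorem strictMonoOn_truncatedLaplace {μ : ℝ → ℝ} {y₀ : ℝ} (hμ : Admissible μ y₀) :
    StrictMonoOn (truncatedLaplace μ) (Ici y₀) := by
  intro y hy y' hy' hlt
  have hy0 : 0 < y := lt_of_lt_of_le (by linarith [hμ.one_le]) hy
  have hm := hμ.nonneg hy
  have hm' := hμ.pos (lt_of_le_of_lt hy hlt)
  have hmm := hμ.monotoneOn hy hy' hlt.le
  have h1 : truncatedLaplace μ y ≤ ∫ t in (0 : ℝ)..μ y', zetaSq t * Real.exp (-(2 * t / y)) :=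
    intervalIntegral.integral_mono_interval le_rfl hm hmm
      (Eventually.of_forall fun t => zetaSq_mul_exp_nonneg t y)
      ((continuous_zetaSq_mul_exp y).intervalIntegrable _ _)
  refine h1.trans_lt ?_
  obtain ⟨c, hc, hcpos⟩ := exists_zetaSq_pos hm'
  refine intervalIntegral.integral_lt_integral_of_continuousOn_of_le_of_exists_lt hm'
    (continuous_zetaSq_mul_exp y).continuousOn (continuous_zetaSq_mul_exp y').continuousOn
    (fun t ht => ?_) ⟨c, Ioc_subset_Icc_self hc, ?_⟩
  · refine mul_le_mul_of_nonneg_left (Real.exp_le_exp.2 (neg_le_neg ?_)) (zetaSq_nonneg t)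
    exact div_le_div_of_nonneg_left (by linarith [ht.1]) hy0 hlt.le
  · refine mul_lt_mul_of_pos_left (Real.exp_lt_exp.2 (neg_lt_neg ?_)) hcpos
    exact div_lt_div_of_pos_left (by linarith [hc.1]) hy0 hlt

theorem continuousOn_truncatedLaplace {μ : ℝ → ℝ} {y₀ : ℝ} (hμ : Admissible μ y₀) :
    ContinuousOn (truncatedLaplace μ) (Ici y₀) := by
  rw [continuousOn_iff_continuous_domRestrict]
  have hs : Continuous fun y : Ici y₀ => μ y :=
    continuousOn_iff_continuous_domRestrict.1 hμ.contDiffOn.continuousOn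
  have hF : Continuous (Function.uncurry fun (y : Ici y₀) (t : ℝ) =>
      zetaSq t * Real.exp (-(2 * t / (y : ℝ)))) := by
    have h0 : ∀ z : Ici y₀ × ℝ, ((z.1 : ℝ)) ≠ 0 := fun z =>
      (lt_of_lt_of_le (by linarith [hμ.one_le]) z.1.2).ne'
    refine (continuous_zetaSq.comp continuous_snd).mul (Real.continuous_exp.comp ?_)
    exact (Continuous.div (by fun_prop) (by fun_prop) h0).neg
  exact intervalIntegral.continuous_parametric_intervalIntegral_of_continuous hF hs

theorem tendsto_laplaceMain : Tendsto laplaceMain atTop atTop := by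
  have h : Tendsto (fun x : ℝ => x * (Real.log x +
      (Real.eulerMascheroniConstant - Real.log (2 * Real.pi)))) atTop atTop :=
    tendsto_id.atTop_mul_atTop₀ (tendsto_atTop_add_const_right _ _ Real.tendsto_log_atTop)
  refine h.congr fun x => ?_
  rw [laplaceMain]
  ring

theorem tendsto_truncatedLaplace_two_mul {μ : ℝ → ℝ} {y₀ : ℝ} (hμ : Admissible μ y₀) :
    Tendsto (fun x : ℝ => truncatedLaplace μ (2 * x)) atTop atTop := by
  refine ((tendsto_truncatedLaplace_sub hμ).add_atTop tendsto_laplaceMain).congr fun x => ?_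
  ring

theorem truncatedLaplace_le_hardyLittlewood {μ : ℝ → ℝ} {y₀ : ℝ} (hμ : Admissible μ y₀) {y : ℝ}
    (hy : y₀ ≤ y) : truncatedLaplace μ y ≤ hardyLittlewood (μ y) := by
  have hy0 : 0 < y := lt_of_lt_of_le (by linarith [hμ.one_le]) hy
  refine intervalIntegral.integral_mono_on (hμ.nonneg hy)
    ((continuous_zetaSq_mul_exp y).intervalIntegrable _ _) (intervalIntegrable_zetaSq _ _)
    fun t ht => ?_
  refine mul_le_of_le_one_right (zetaSq_nonneg t) (Real.exp_le_one_iff.2 ?_)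
  have : 0 ≤ 2 * t / y := div_nonneg (by linarith [ht.1]) hy0.le
  linarith

theorem continuous_hardyLittlewood : Continuous hardyLittlewood :=
  intervalIntegral.continuous_primitive intervalIntegrable_zetaSq 0

theorem mem_image_truncatedLaplace {μ : ℝ → ℝ} {y₀ : ℝ} (hμ : Admissible μ y₀) {s : ℝ}
    (hs : truncatedLaplace μ y₀ ≤ s) : s ∈ truncatedLaplace μ '' Ici y₀ := by
  obtain ⟨x, hx, hx0⟩ := ((tendsto_truncatedLaplace_two_mul hμ).eventually_ge_atTop s |>.and
    (eventually_ge_atTop y₀)).exists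
  have hle : y₀ ≤ 2 * x := by linarith [hμ.one_le]
  have hcont := (continuousOn_truncatedLaplace hμ).mono
    (Icc_subset_Ici_self : Icc y₀ (2 * x) ⊆ Ici y₀)
  exact image_mono Icc_subset_Ici_self (intermediate_value_Icc hle hcont ⟨hs, hx⟩)

/-- The inverse of the ladder at `U` is the height `T ≥ 0` with `J(T) = Φ(2U)`. -/
theorem ladderInv_spec {μ : ℝ → ℝ} {y₀ : ℝ} (hμ : Admissible μ y₀) {U : ℝ} (hU : y₀ ≤ 2 * U) :
    0 ≤ ladderInv μ y₀ U ∧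
      hardyLittlewood (ladderInv μ y₀ U) = truncatedLaplace μ (2 * U) := by
  have hinj := (strictMonoOn_truncatedLaplace hμ).injOn
  have hΦ0 : 0 ≤ truncatedLaplace μ (2 * U) :=
    intervalIntegral.integral_nonneg (hμ.nonneg hU) fun t _ => zetaSq_mul_exp_nonneg t _
  obtain ⟨T, hT, hJT⟩ : truncatedLaplace μ (2 * U) ∈ hardyLittlewood '' Icc 0 (μ (2 * U)) := by
    refine intermediate_value_Icc (hμ.nonneg hU) continuous_hardyLittlewood.continuousOn ⟨?_, ?_⟩
    · simpa [hardyLittlewood] using hΦ0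
    · exact truncatedLaplace_le_hardyLittlewood hμ hU
  -- Injectivity of Φ identifies the ladder value at T. Injectivity of J is not needed: whichever
  -- preimage the inverse function picks, J takes the same value there.
  have hex : ∃ T ∈ ladderDomain μ y₀, ladder μ y₀ T = U := by
    refine ⟨T, ⟨hT.1, ?_⟩, ?_⟩
    · rw [hJT]
      exact (strictMonoOn_truncatedLaplace hμ).monotoneOn self_mem_Ici hU hU
    · have himg : ∃ y ∈ Ici y₀, truncatedLaplace μ y = hardyLittlewood T := ⟨2 * U, hU, hJT.symm⟩
      have h1 : integralEquationSolution μ y₀ T = 2 * U :=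
        hinj (Function.invFunOn_mem himg) hU ((Function.invFunOn_eq himg).trans hJT)
      rw [ladder, h1]
      ring
  have hmem : ladderInv μ y₀ U ∈ ladderDomain μ y₀ := Function.invFunOn_mem hex
  have heq : ladder μ y₀ (ladderInv μ y₀ U) = U := Function.invFunOn_eq hex
  refine ⟨hmem.1, ?_⟩
  have h2 : integralEquationSolution μ y₀ (ladderInv μ y₀ U) = 2 * U := by
    rw [ladder] at heq
    linarith
  have h3 : truncatedLaplace μ (integralEquationSolution μ y₀ (ladderInv μ y₀ U)) =
      hardyLittlewood (ladderInv μ y₀ U) := Function.invFunOn_eq (mem_image_truncatedLaplace hμ hmem.2)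
  rw [← h3, h2]

theorem tendsto_ladderInv {μ : ℝ → ℝ} {y₀ : ℝ} (hμ : Admissible μ y₀) :
    Tendsto (ladderInv μ y₀) atTop atTop := by
  rw [tendsto_atTop]
  intro M
  filter_upwards [(tendsto_truncatedLaplace_two_mul hμ).eventually_gt_atTop (hardyLittlewood M),
    eventually_ge_atTop y₀] with U hU hU0
  by_contra! hcon
  have h1 := hardyLittlewood_mono hcon.le
  rw [(ladderInv_spec hμ (by linarith [hμ.one_le])).2] at h1
  linarith

/-- If φ₁⁻¹(U) < U, then Φ(2U) = J(φ₁⁻¹(U)) ≤ J(U). But the linear coefficient of Φ(2U) is γ - ln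
2π, while that of J(U) is at most 2γ - 1 - ln 2π + ε. -/
theorem eventually_le_ladderInv {μ : ℝ → ℝ} {y₀ : ℝ} (hμ : Admissible μ y₀) :
    ∀ᶠ U in atTop, U ≤ ladderInv μ y₀ U := by
  filter_upwards [eventually_hardyLittlewood_le (ε := 1 / 4) (by norm_num),
    (tendsto_truncatedLaplace_sub hμ).eventually_const_lt Real.pi_pos,
    eventually_ge_atTop y₀] with U h1 h2 hU
  have hU1 := hμ.one_le.trans hU
  by_contra! hcon
  have h3 := hardyLittlewood_mono hcon.le
  rw [(ladderInv_spec hμ (by linarith)).2] at h3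
  -- With ε = 1/4 the contradiction needs 2γ - 1 + 1/4 ≤ γ, that is γ ≤ 3/4.
  have h4 := Real.eulerMascheroniConstant_lt_two_thirds
  unfold laplaceMain at h2
  unfold meanIntegral at h1
  nlinarith

theorem reverseIterate_succ (μ : ℝ → ℝ) (y₀ : ℝ) (r : ℕ) (T : ℝ) :
    reverseIterate μ y₀ (r + 1) T = ladderInv μ y₀ (reverseIterate μ y₀ r T) :=
  Function.iterate_succ_apply' _ _ _

theorem tendsto_reverseIterate {μ : ℝ → ℝ} {y₀ : ℝ} (hμ : Admissible μ y₀) (r : ℕ) :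
    Tendsto (reverseIterate μ y₀ r) atTop atTop := by
  induction r with
  | zero => exact tendsto_id
  | succ r ih =>
    exact ((tendsto_ladderInv hμ).comp ih).congr fun T => (reverseIterate_succ μ y₀ r T).symm

theorem integral_posPart_sub_integral_negPart {a b : ℝ} (hab : a ≤ b) :
    (∫ t in posPart a b, (Real.log t - zetaSq t)) - ∫ t in negPart a b, (-Real.log t + zetaSq t) =
      (∫ t in a..b, Real.log t) - ∫ t in a..b, zetaSq t := by
  have hint : IntervalIntegrable (fun t => Real.log t - zetaSq t) volume a b :=
    intervalIntegral.intervalIntegrable_log'.sub (intervalIntegrable_zetaSq a b)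
  have hI : IntegrableOn (fun t => Real.log t - zetaSq t) (Ioc a b) :=
    (intervalIntegrable_iff_integrableOn_Ioc_of_le hab).1 hint
  have hmeas : MeasurableSet {t : ℝ | zetaSq t < Real.log t} :=
    measurableSet_lt continuous_zetaSq.measurable Real.measurable_log
  have hpos : posPart a b = Ioc a b ∩ {t : ℝ | zetaSq t < Real.log t} := rfl
  have hneg : negPart a b = Ioc a b \ {t : ℝ | zetaSq t < Real.log t} := by
    ext t
    exact and_congr_right fun _ => not_lt.symm
  have h1 : ∫ t in negPart a b, (-Real.log t + zetaSq t) =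
      -∫ t in negPart a b, (Real.log t - zetaSq t) := by
    rw [← integral_neg]
    congr 1 with t
    ring
  rw [h1, sub_neg_eq_add, hpos, hneg, integral_inter_add_sdiff hmeas hI,
    ← intervalIntegral.integral_of_le hab, intervalIntegral.integral_sub
      intervalIntegral.intervalIntegrable_log' (intervalIntegrable_zetaSq a b)]

end JacobLadder

theorem theorem3 (μ : ℝ → ℝ) (y₀ : ℝ) (hμ : JacobLadder.Admissible μ y₀) (k : ℕ) :
    ∀ r ∈ Finset.Icc 1 k,
      Tendsto (fun T : ℝ =>
        (∫ t in JacobLadder.posPart (JacobLadder.reverseIterate μ y₀ (r - 1) T)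
            (JacobLadder.reverseIterate μ y₀ r T), (Real.log t - JacobLadder.zetaSq t))
        - (∫ t in JacobLadder.negPart (JacobLadder.reverseIterate μ y₀ (r - 1) T)
            (JacobLadder.reverseIterate μ y₀ r T), (-Real.log t + JacobLadder.zetaSq t))
        + (∫ t in (JacobLadder.reverseIterate μ y₀ (r - 1) T)..(JacobLadder.reverseIterate μ y₀ r T),
            JacobLadder.zetaSq t)
        - (∫ t in (JacobLadder.reverseIterate μ y₀ r T)..(JacobLadder.reverseIterate μ y₀ (r + 1) T),
            JacobLadder.zetaSq t)
        - (Real.log (2 * Real.pi) - 1 - Real.eulerMascheroniConstant)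
            * (JacobLadder.reverseIterate μ y₀ r T - JacobLadder.reverseIterate μ y₀ (r - 1) T))
        atTop (𝓝 0) := by
  intro r hr
  obtain ⟨n, rfl⟩ : ∃ n, r = n + 1 := ⟨r - 1, by have := (Finset.mem_Icc.1 hr).1; omega⟩
  rw [Nat.add_sub_cancel]
  have hE := JacobLadder.tendsto_truncatedLaplace_sub hμ
  have h1 := JacobLadder.tendsto_reverseIterate hμ n
  have h2 := JacobLadder.tendsto_reverseIterate hμ (n + 1)
  -- Both terms tend to π, so only the existence of the limit matters.
  have hlim := (hE.comp h1).sub (hE.comp h2)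
  rw [sub_self] at hlim
  refine hlim.congr' ?_
  filter_upwards [h1.eventually (JacobLadder.eventually_le_ladderInv hμ),
    h1.eventually (eventually_ge_atTop y₀), h2.eventually (eventually_ge_atTop y₀)] with T hle ha hb
  simp only [Function.comp_apply]
  rw [← JacobLadder.reverseIterate_succ] at hle
  have hJb := (JacobLadder.ladderInv_spec hμ
    (by linarith [hμ.one_le] : y₀ ≤ 2 * JacobLadder.reverseIterate μ y₀ n T)).2
  have hJc := (JacobLadder.ladderInv_spec hμ
    (by linarith [hμ.one_le] : y₀ ≤ 2 * JacobLadder.reverseIterate μ y₀ (n + 1) T)).2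
  rw [← JacobLadder.reverseIterate_succ] at hJb hJc
  -- Here the order of consecutive iterates is used: it lets the ± parts recombine into an oriented
  -- integral.
  rw [JacobLadder.integral_posPart_sub_integral_negPart hle, integral_log, ← hJb, ← hJc]
  have hadd := intervalIntegral.integral_add_adjacent_intervals
    (JacobLadder.intervalIntegrable_zetaSq 0 (JacobLadder.reverseIterate μ y₀ (n + 1) T))
    (JacobLadder.intervalIntegrable_zetaSq (JacobLadder.reverseIterate μ y₀ (n + 1) T)
      (JacobLadder.reverseIterate μ y₀ (n + 1 + 1) T))
  unfold JacobLadder.laplaceMain JacobLadder.hardyLittlewood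
  linarith
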